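/- **Conventions.** A complete orthomodular lattice (COML) is a complete lattice $A$ with an order-reversing involution $a\mapsto a'$ such that $a\wedge a'=0$, $a\vee a'=1$, and $a\le b$ implies $b=a\vee(a'\wedge b)$; the one-element lattice is allowed. $\mathbf{COML}$ is the category of complete orthomodular lattices and ortholattice homomorphisms that preserve all joins. Boolean subalgebras of $A$ are its distributive sub-ortholattices; blocks are maximal Boolean subalgebras. *Orthogeometries.* A pre-orthogeometry $\mathcal G=(P,L)$ is a set $P$ of points and a set $L$ of lines, each a set of three points, such that two distinct points lie on at most one line. A plane is a set of seven points $a,b,c,d$ (its vertices), $x,y,z$ such that the lines containing at least two of the seven points are exactly $\{a,b,x\},\{c,d,x\},\{a,c,y\},\{b,d,y\},\{a,d,z\},\{b,c,z\}$. Two lines $\ell,m$ through $p$ are opposite at $p$ if they lie in a plane in which they are the only lines through $p$. For a COML $A$, $\mathcal G(A)$ has as points and lines the Boolean subalgebras of $A$ with 4 and 8 elements, with inclusion as incidence. *Morphisms.* For a partial function $\alpha$ between points, $\alpha[S]$ is the set of values of $\alpha$ on $S$. A morphism $\mathcal G_1\to\mathcal G_2$ is a partial function $\alpha$ between the points such that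 (i) for each line $\ell$, either $\alpha$ is undefined on $\ell$, or it is undefined at exactly one point of $\ell$ and takes the same value at the other two, or it is defined on $\ell$ and $\alpha[\ell]$ is a line; (ii) if $\alpha$ is defined at the four vertices of a plane, then it maps this plane one-to-one onto a plane, vertices to vertices; (iii) if $\ell,m$ are lines through $p$ and $\alpha[\ell],\alpha[m]$ are lines that are opposite at $\alpha(p)$, then $\ell,m$ are opposite at $p$. It is *proper* if it is defined at some point, each point $p$ lies on a line $\ell$ with $\alpha[\ell]\supsetneq\alpha[\{p\}]$, and each line $\ell$ with $|\alpha[\ell]|\le 1$ lies in a plane $w$ with $\alpha[w]\supsetneq\alpha[\ell]$. A $\mathbf{COML}$-morphism $f:A\to B$ is *proper* if each Boolean subalgebra $S$ of $A$ with $|S|\le 8$ and $|f[S]|\le 4$ is contained in a block $C$ with $f[C]\supsetneq f[S]$ (in particular, if $|f[S]|=4$ the image of the block has more than four elements). *Directions.* A direction for a point $p$ assigns $\uparrow$ or $\downarrow$ to each line through $p$ so that two lines get different values iff they are opposite at $p$; a point on no line is given two directions. The directions of $\mathcal G$ are those for its points together with $0$ and $1$. They are ordered with $0$ least and $1$ largest,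 and, for directions $d$ for $p$ and $e$ for $q$, $d\le e$ iff $d=e$, or $p\ne q$ lie on a line $\ell$ with $d(\ell)=\downarrow$, $e(\ell)=\uparrow$. A map $F$ from the directions of $\mathcal G_1$ to those of $\mathcal G_2$ is *induced by* a morphism $\alpha$ if $F(0)=0$, $F(1)=1$ and for each direction $d$ for a point $p$: if $\alpha(p)$ is defined, $F(d)$ is a direction for $\alpha(p)$ with $F(d)(\alpha[\ell])=d(\ell)$ for each line $\ell\ni p$ such that $\alpha[\ell]$ is a line; if $\alpha(p)$ is undefined, $F(d)\in\{0,1\}$, and for each line $\ell\ni p$ with $\alpha[\ell]\neq\emptyset$, $F(d)=0$ if $d(\ell)=\downarrow$ and $F(d)=1$ if $d(\ell)=\uparrow$. The morphism $\alpha$ *preserves all joins* if it induces some $F$ that takes each least upper bound $e$ of a set $D$ of directions to a least upper bound $F(e)$ of $F[D]$. $\mathbf{COG}$ is the category of pre-orthogeometries isomorphic to $\mathcal G(A)$ for some complete orthomodular lattice $A$, with the morphisms that preserve all joins. **Theorem.** There is a functor $\mathcal G:\mathbf{COML}\to\mathbf{COG}$ given on objects by $A\mapsto\mathcal G(A)$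 and on morphisms $f:A\to B$ by $\mathcal G(f)(p)=f[p]$ if the four-element Boolean subalgebra $p$ has a four-element image, $\mathcal G(f)(p)$ being undefined otherwise. Moreover: 1. $\mathcal G$ is essentially surjective. 2. $\mathcal G$ is injective on objects with the exception of lattices with at most two elements, in both senses: if $\mathcal G(A)$ and $\mathcal G(B)$ are isomorphic, then $A$ and $B$ are isomorphic or both have at most two elements; and if $A,B$ (on subsets of one set) have the same 4-element and the same 8-element Boolean subalgebras, as structured Boolean algebras, then $A=B$ or both have at most two elements. 3. $\mathcal G$ is full and faithful with respect to proper morphisms: $f$ is proper iff $\mathcal G(f)$ is proper; proper $f,g:A\to B$ with $\mathcal G(f)=\mathcal G(g)$ are equal; and each proper $\mathbf{COG}$-morphism $\mathcal G(A)\to\mathcal G(B)$ is $\mathcal G(f)$ for some proper $f:A\to B$. 4. A proper morphism $\alpha$ (not assumed to preserve joins) between objects of $\mathbf{COG}$ induces exactly one map $f_\alpha$ of directions; so $\alpha$ preserves all joins iff $f_\alpha$ takes least upper bounds to least upper bounds. -/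

import Mathlib

open CategoryTheory

universe u

/-! ### Complete orthomodular lattices -/

/-- A complete orthomodular lattice. The one-element lattice is allowed. -/
class CompleteOML (A : Type u) extends CompleteLattice A, Compl A where
  inf_compl' : ∀ a : A, a ⊓ aᶜ = ⊥
  sup_compl' : ∀ a : A, a ⊔ aᶜ = ⊤
  compl_compl' : ∀ a : A, aᶜᶜ = a
  compl_anti' : ∀ a b : A, a ≤ b → bᶜ ≤ aᶜ
  orthomodular' : ∀ a b : A, a ≤ b → a ⊔ (aᶜ ⊓ b) = b

/-- An ortholattice homomorphism preserving all joins. Preservation of `⊥`, `⊤`, `⊔`, `⊓` and of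
all meets follows from the two conditions. -/
@[ext]
structure CompleteOMLHom (A B : Type u) [CompleteOML A] [CompleteOML B] where
  toFun : A → B
  map_sSup' : ∀ s : Set A, toFun (sSup s) = sSup (toFun '' s)
  map_compl' : ∀ a : A, toFun aᶜ = (toFun a)ᶜ

/-- The objects of the category of complete orthomodular lattices. -/
structure COML : Type (u + 1) where
  carrier : Type u
  [str : CompleteOML carrier]

attribute [instance] COML.str

instance : Category COML.{u} where
  Hom A B := CompleteOMLHom A.carrier B.carrier
  id A := ⟨id, fun s => by simp, fun _ => rfl⟩
  comp f g := ⟨fun x => g.toFun (f.toFun x),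
    fun s => by rw [f.map_sSup', g.map_sSup', Set.image_image],
    fun a => by rw [f.map_compl', g.map_compl']⟩

/-! ### Boolean subalgebras -/

section BooleanSubalgebras

variable {A B : Type u} [CompleteOML A] [CompleteOML B]

/-- Boolean subalgebras: distributive subalgebras of the ortholattice `A`. -/
structure IsBooleanSub (S : Set A) : Prop where
  bot_mem : ⊥ ∈ S
  top_mem : ⊤ ∈ S
  compl_mem : ∀ x ∈ S, xᶜ ∈ S
  sup_mem : ∀ x ∈ S, ∀ y ∈ S, x ⊔ y ∈ S
  inf_mem : ∀ x ∈ S, ∀ y ∈ S, x ⊓ y ∈ S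
  distrib : ∀ x ∈ S, ∀ y ∈ S, ∀ z ∈ S, x ⊓ (y ⊔ z) = (x ⊓ y) ⊔ (x ⊓ z)

/-- Blocks: maximal Boolean subalgebras. -/
def IsBlock (S : Set A) : Prop := Maximal IsBooleanSub S

/-- A morphism of complete orthomodular lattices is proper if every Boolean subalgebra with at most
8 elements whose image has at most 4 elements lies in a block whose image is larger. -/
def CompleteOMLHom.IsProper (f : CompleteOMLHom A B) : Prop :=
  ∀ S : Set A, IsBooleanSub S → S.Finite → S.ncard ≤ 8 → (f.toFun '' S).ncard ≤ 4 →
    ∃ C : Set A, IsBlock C ∧ S ⊆ C ∧ f.toFun '' S ⊂ f.toFun '' C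

/-- The Boolean algebra carried by `S`, as a structured set: given an injection `i` of `A` into an
ambient set `U`, it is the order relation of `S`, as a set of pairs of elements of `U`. It
determines the underlying set and all operations of the Boolean algebra `S`. -/
def booleanGraph {U : Type u} (i : A → U) (S : Set A) : Set (U × U) :=
  {z | ∃ x ∈ S, ∃ y ∈ S, x ≤ y ∧ z = (i x, i y)}

/-- The structured Boolean subalgebras of `A` with exactly `n` elements. -/
def booleanGraphs {U : Type u} (i : A → U) (n : ℕ) : Set (Set (U × U)) :=
  {R | ∃ S : Set A, IsBooleanSub S ∧ S.ncard = n ∧ R = booleanGraph i S}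

namespace CompleteOML

theorem compl_bot' : (⊥ : A)ᶜ = ⊤ := by
  have := sup_compl' (⊥ : A); simpa using this

theorem compl_top' : (⊤ : A)ᶜ = ⊥ := by
  have := inf_compl' (⊤ : A); simpa using this

theorem compl_inj' {a b : A} (h : aᶜ = bᶜ) : a = b := by
  rw [← compl_compl' a, h, compl_compl']

theorem compl_sup' (a b : A) : (a ⊔ b)ᶜ = aᶜ ⊓ bᶜ := by
  apply le_antisymm
  · exact le_inf (compl_anti' _ _ le_sup_left) (compl_anti' _ _ le_sup_right)
  · have h1 : a ≤ (aᶜ ⊓ bᶜ)ᶜ := by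
      have := compl_anti' _ _ (inf_le_left : aᶜ ⊓ bᶜ ≤ aᶜ); rwa [compl_compl'] at this
    have h2 : b ≤ (aᶜ ⊓ bᶜ)ᶜ := by
      have := compl_anti' _ _ (inf_le_right : aᶜ ⊓ bᶜ ≤ bᶜ); rwa [compl_compl'] at this
    have := compl_anti' _ _ (sup_le h1 h2)
    rwa [compl_compl'] at this

theorem compl_inf' (a b : A) : (a ⊓ b)ᶜ = aᶜ ⊔ bᶜ := by
  apply compl_inj'
  rw [compl_compl', compl_sup', compl_compl', compl_compl']

theorem compl_ne_self {a : A} (h : a ≠ ⊥) : aᶜ ≠ a := by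
  intro e
  have := inf_compl' a
  rw [e, inf_idem] at this
  exact h this

end CompleteOML

open CompleteOML

theorem CompleteOMLHom.map_sup (f : CompleteOMLHom A B) (a b : A) :
    f.toFun (a ⊔ b) = f.toFun a ⊔ f.toFun b := by
  rw [← sSup_pair, f.map_sSup', Set.image_pair, sSup_pair]

theorem CompleteOMLHom.map_bot (f : CompleteOMLHom A B) : f.toFun ⊥ = ⊥ := by
  rw [← sSup_empty, f.map_sSup', Set.image_empty, sSup_empty]

theorem CompleteOMLHom.map_top (f : CompleteOMLHom A B) : f.toFun ⊤ = ⊤ := by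
  rw [← compl_bot', f.map_compl', f.map_bot, compl_bot']

theorem CompleteOMLHom.map_inf (f : CompleteOMLHom A B) (a b : A) :
    f.toFun (a ⊓ b) = f.toFun a ⊓ f.toFun b := by
  apply compl_inj'
  rw [← f.map_compl', compl_inf', compl_inf', f.map_sup, f.map_compl', f.map_compl']

theorem IsBooleanSub.image (f : CompleteOMLHom A B) {S : Set A} (hS : IsBooleanSub S) :
    IsBooleanSub (f.toFun '' S) where
  bot_mem := ⟨⊥, hS.bot_mem, f.map_bot⟩
  top_mem := ⟨⊤, hS.top_mem, f.map_top⟩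
  compl_mem := by
    rintro _ ⟨x, hx, rfl⟩; exact ⟨xᶜ, hS.compl_mem x hx, f.map_compl' x⟩
  sup_mem := by
    rintro _ ⟨x, hx, rfl⟩ _ ⟨y, hy, rfl⟩; exact ⟨_, hS.sup_mem x hx y hy, f.map_sup x y⟩
  inf_mem := by
    rintro _ ⟨x, hx, rfl⟩ _ ⟨y, hy, rfl⟩; exact ⟨_, hS.inf_mem x hx y hy, f.map_inf x y⟩
  distrib := by
    rintro _ ⟨x, hx, rfl⟩ _ ⟨y, hy, rfl⟩ _ ⟨z, hz, rfl⟩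
    rw [← f.map_sup, ← f.map_inf, hS.distrib x hx y hy z hz, f.map_sup, f.map_inf, f.map_inf]

theorem isBooleanSub_four (a : A) : IsBooleanSub ({⊥, ⊤, a, aᶜ} : Set A) where
  bot_mem := by simp
  top_mem := by simp
  compl_mem := by
    rintro x (rfl | rfl | rfl | rfl) <;> simp [compl_bot', compl_top', compl_compl']
  sup_mem := by
    have h1 := sup_compl' a
    have h2 : aᶜ ⊔ a = ⊤ := by rw [sup_comm]; exact h1
    rintro x (rfl | rfl | rfl | rfl) y (rfl | rfl | rfl | rfl) <;> simp [h1, h2]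
  inf_mem := by
    have h1 := inf_compl' a
    have h2 : aᶜ ⊓ a = ⊥ := by rw [inf_comm]; exact h1
    rintro x (rfl | rfl | rfl | rfl) y (rfl | rfl | rfl | rfl) <;> simp [h1, h2]
  distrib := by
    have h1 := inf_compl' a
    have h2 : aᶜ ⊓ a = ⊥ := by rw [inf_comm]; exact h1
    have h3 := sup_compl' a
    have h4 : aᶜ ⊔ a = ⊤ := by rw [sup_comm]; exact h3
    rintro x (rfl | rfl | rfl | rfl) y (rfl | rfl | rfl | rfl) z (rfl | rfl | rfl | rfl) <;>
      simp [h1, h2, h3, h4]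

theorem ncard_four {a : A} (h0 : a ≠ ⊥) (h1 : a ≠ ⊤) :
    ({⊥, ⊤, a, aᶜ} : Set A).ncard = 4 := by
  have h01 : (⊥ : A) ≠ ⊤ := fun h => h0 (le_antisymm (h ▸ le_top) bot_le)
  have h2 : aᶜ ≠ a := compl_ne_self h0
  have h3 : aᶜ ≠ ⊥ := fun h => h1 (by rw [← compl_compl' a, h, compl_bot'])
  have h4 : aᶜ ≠ ⊤ := fun h => h0 (by rw [← compl_compl' a, h, compl_top'])
  rw [Set.ncard_insert_of_notMem (by simp [h01, h0.symm, h3.symm]),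
    Set.ncard_insert_of_notMem (by simp [h1.symm, h4.symm]),
    Set.ncard_pair h2.symm]

theorem IsBooleanSub.eq_four {S : Set A} (hS : IsBooleanSub S) (h4 : S.ncard = 4) {a : A}
    (ha : a ∈ S) (h0 : a ≠ ⊥) (h1 : a ≠ ⊤) : S = {⊥, ⊤, a, aᶜ} := by
  symm
  apply Set.eq_of_subset_of_ncard_le
  · rintro x (rfl | rfl | rfl | rfl)
    exacts [hS.bot_mem, hS.top_mem, ha, hS.compl_mem _ ha]
  · rw [h4, ncard_four h0 h1]
  · exact Set.finite_of_ncard_ne_zero (by omega)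

theorem IsBooleanSub.exists_four {S : Set A} (h4 : S.ncard = 4) :
    ∃ a ∈ S, a ≠ ⊥ ∧ a ≠ ⊤ := by
  by_contra! h
  have : S ⊆ {⊥, ⊤} := fun x hx => by
    by_cases hx0 : x = ⊥
    · simp [hx0]
    · simp [h x hx hx0]
  have h2 := Set.ncard_le_ncard this (by simp)
  have h3 := Set.ncard_insert_le (⊥ : A) {⊤}
  rw [Set.ncard_singleton] at h3
  omega

end BooleanSubalgebras

/-! ### Orthogeometries -/

/-- A set of points and a set of lines, each line a set of 3 points, such that any two points lie
on at most one line. -/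
structure PreOrthogeometry : Type (u + 1) where
  Point : Type u
  lines : Set (Set Point)
  ncard_line : ∀ l ∈ lines, l.ncard = 3
  line_unique : ∀ p q : Point, p ≠ q → ∀ l ∈ lines, ∀ m ∈ lines,
    p ∈ l → q ∈ l → p ∈ m → q ∈ m → l = m

/-- Isomorphisms of pre-orthogeometries. -/
structure PreOrthogeometry.Iso (G H : PreOrthogeometry.{u}) where
  equiv : G.Point ≃ H.Point
  mem_lines_iff : ∀ l : Set G.Point, l ∈ G.lines ↔ equiv '' l ∈ H.lines

section OfOML

variable (A : Type u) [CompleteOML A]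

/-- The four-element Boolean subalgebras. -/
def BoolPoint : Type u := {S : Set A // IsBooleanSub S ∧ S.ncard = 4}

variable {A}

open CompleteOML

/-- The four-element Boolean subalgebras contained in `T`. -/
def boolLine (T : Set A) : Set (BoolPoint A) := {p | p.1 ⊆ T}

theorem ncard_insert_pair {X : Set A} (hX : X.Finite) (hc : ∀ x ∈ X, xᶜ ∈ X) (h0 : ⊥ ∈ X) {c : A}
    (h : c ∉ X) : (insert c (insert cᶜ X)).ncard = X.ncard + 2 := by
  have h1 : cᶜ ∉ X := fun h1 => h (by have := hc _ h1; rwa [compl_compl'] at this)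
  have h2 : cᶜ ≠ c := compl_ne_self (fun h2 => h (h2 ▸ h0))
  rw [Set.ncard_insert_of_notMem (by simp [h2.symm, h]) (hX.insert _),
    Set.ncard_insert_of_notMem h1 hX]

theorem compl_mem_insert_pair {X : Set A} (hc : ∀ x ∈ X, xᶜ ∈ X) (c : A) :
    ∀ x ∈ insert c (insert cᶜ X), xᶜ ∈ insert c (insert cᶜ X) := by
  rintro x (rfl | rfl | h)
  · simp
  · simp [compl_compl']
  · simp [hc x h]

/-- The four-element Boolean subalgebra containing `a`. -/
def fourPoint (a : A) (h0 : a ≠ ⊥) (h1 : a ≠ ⊤) : BoolPoint A :=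
  ⟨{⊥, ⊤, a, aᶜ}, isBooleanSub_four a, ncard_four h0 h1⟩

theorem ncard_boolLine {T : Set A} (hT : IsBooleanSub T) (h8 : T.ncard = 8) :
    (boolLine T).ncard = 3 := by
  have hfin : T.Finite := Set.finite_of_ncard_ne_zero (by omega)
  have hpair : ({⊥, ⊤} : Set A).ncard ≤ 2 := by
    have := Set.ncard_insert_le (⊥ : A) {⊤}
    rwa [Set.ncard_singleton] at this
  obtain ⟨a, haT, ha⟩ := Set.exists_mem_notMem_of_ncard_lt_ncard
    (s := ({⊥, ⊤} : Set A)) (t := T) (by omega) (by simp)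
  have ha0 : a ≠ ⊥ := fun h => ha (by simp [h])
  have ha1 : a ≠ ⊤ := fun h => ha (by simp [h])
  set X4 : Set A := {⊥, ⊤, a, aᶜ} with hX4
  have n4 : X4.ncard = 4 := ncard_four ha0 ha1
  have f4 : X4.Finite := by simp [hX4]
  have c4 : ∀ x ∈ X4, xᶜ ∈ X4 := (isBooleanSub_four a).compl_mem
  have z4 : ⊥ ∈ X4 := by simp [hX4]
  have t4 : ⊤ ∈ X4 := by simp [hX4]
  obtain ⟨b, hbT, hb⟩ := Set.exists_mem_notMem_of_ncard_lt_ncard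
    (s := X4) (t := T) (by omega) f4
  set X6 : Set A := insert b (insert bᶜ X4) with hX6
  have n6 : X6.ncard = 6 := by rw [ncard_insert_pair f4 c4 z4 hb, n4]
  have f6 : X6.Finite := (f4.insert _).insert _
  have c6 : ∀ x ∈ X6, xᶜ ∈ X6 := compl_mem_insert_pair c4 b
  have z6 : ⊥ ∈ X6 := by simp [hX6, z4]
  have t6 : ⊤ ∈ X6 := by simp [hX6, t4]
  obtain ⟨c, hcT, hc⟩ := Set.exists_mem_notMem_of_ncard_lt_ncard
    (s := X6) (t := T) (by omega) f6
  have n8 : (insert c (insert cᶜ X6)).ncard = 8 := by rw [ncard_insert_pair f6 c6 z6 hc, n6]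
  have hTeq : insert c (insert cᶜ X6) = T := by
    apply Set.eq_of_subset_of_ncard_le _ (by omega) hfin
    rintro x (rfl | rfl | rfl | rfl | rfl | rfl | rfl | rfl)
    exacts [hcT, hT.compl_mem _ hcT, hbT, hT.compl_mem _ hbT, hT.bot_mem, hT.top_mem, haT,
      hT.compl_mem _ haT]
  have hb0 : b ≠ ⊥ := fun h => hb (h ▸ z4)
  have hb1 : b ≠ ⊤ := fun h => hb (h ▸ t4)
  have hc0 : c ≠ ⊥ := fun h => hc (h ▸ z6)
  have hc1 : c ≠ ⊤ := fun h => hc (h ▸ t6)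
  have key : boolLine T = {fourPoint a ha0 ha1, fourPoint b hb0 hb1, fourPoint c hc0 hc1} := by
    ext p
    simp only [Set.mem_insert_iff, Set.mem_singleton_iff]
    constructor
    · intro hp
      obtain ⟨d, hd, hd0, hd1⟩ := IsBooleanSub.exists_four p.2.2
      have hdT : d ∈ T := hp hd
      have aux : ∀ (e : A) (he0 : e ≠ ⊥) (he1 : e ≠ ⊤), e ∈ p.1 → p = fourPoint e he0 he1 :=
        fun e he0 he1 he => Subtype.ext (p.2.1.eq_four p.2.2 he he0 he1)
      have aux' : ∀ e : A, d = eᶜ → e ∈ p.1 := fun e he => by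
        have := p.2.1.compl_mem _ hd; rwa [he, compl_compl'] at this
      rw [← hTeq] at hdT
      rcases hdT with h | h | h | h | h | h | h | h
      · exact Or.inr (Or.inr (aux c hc0 hc1 (h ▸ hd)))
      · exact Or.inr (Or.inr (aux c hc0 hc1 (aux' c h)))
      · exact Or.inr (Or.inl (aux b hb0 hb1 (h ▸ hd)))
      · exact Or.inr (Or.inl (aux b hb0 hb1 (aux' b h)))
      · exact absurd h hd0
      · exact absurd h hd1
      · exact Or.inl (aux a ha0 ha1 (h ▸ hd))
      · exact Or.inl (aux a ha0 ha1 (aux' a h))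
    · have aux : ∀ (e : A) (he0 : e ≠ ⊥) (he1 : e ≠ ⊤), e ∈ T →
          fourPoint e he0 he1 ∈ boolLine T := by
        rintro e he0 he1 he x (rfl | rfl | rfl | rfl)
        exacts [hT.bot_mem, hT.top_mem, he, hT.compl_mem _ he]
      rintro (rfl | rfl | rfl)
      exacts [aux a _ _ haT, aux b _ _ hbT, aux c _ _ hcT]
  have hself : ∀ e : A, e ∈ ({⊥, ⊤, e, eᶜ} : Set A) := fun e => by simp
  rw [key, Set.ncard_eq_three]
  refine ⟨_, _, _, fun h => hb ?_, fun h => hc ?_, fun h => hc ?_, rfl⟩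
  · have h' : X4 = {⊥, ⊤, b, bᶜ} := congrArg Subtype.val h
    rw [h']; exact hself b
  · have h' : X4 = {⊥, ⊤, c, cᶜ} := congrArg Subtype.val h
    have : c ∈ X4 := by rw [h']; exact hself c
    simp [hX6, this]
  · have h' : ({⊥, ⊤, b, bᶜ} : Set A) = {⊥, ⊤, c, cᶜ} := congrArg Subtype.val h
    have : c ∈ ({⊥, ⊤, b, bᶜ} : Set A) := by rw [h']; exact hself c
    rcases this with h | h | h | h
    · exact absurd h hc0
    · exact absurd h hc1
    · simp [hX6, show c = b from h]
    · simp [hX6, show c = bᶜ from h]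

theorem IsBooleanSub.inter {S T : Set A} (hS : IsBooleanSub S) (hT : IsBooleanSub T) :
    IsBooleanSub (S ∩ T) where
  bot_mem := ⟨hS.bot_mem, hT.bot_mem⟩
  top_mem := ⟨hS.top_mem, hT.top_mem⟩
  compl_mem x hx := ⟨hS.compl_mem x hx.1, hT.compl_mem x hx.2⟩
  sup_mem x hx y hy := ⟨hS.sup_mem x hx.1 y hy.1, hT.sup_mem x hx.2 y hy.2⟩
  inf_mem x hx y hy := ⟨hS.inf_mem x hx.1 y hy.1, hT.inf_mem x hx.2 y hy.2⟩
  distrib x hx y hy z hz := hS.distrib x hx.1 y hy.1 z hz.1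

theorem eq_bot_of_le_compl {a : A} (h : a ≤ aᶜ) : a = ⊥ := by
  rw [← inf_compl' a]; exact (inf_eq_left.2 h).symm

theorem le_compl_comm' {a b : A} (h : a ≤ bᶜ) : b ≤ aᶜ := by
  have := compl_anti' _ _ h; rwa [compl_compl'] at this

/-- In a Boolean subalgebra, a chain `⊥ < a < b < ⊤` generates more than six elements. -/
theorem not_six_of_le {R : Set A} (hR : IsBooleanSub R) {a b : A} (ha : a ∈ R) (hb : b ∈ R)
    (h0 : a ≠ ⊥) (h1 : b ≠ ⊤) (hab : a ≤ b) (hne : a ≠ b)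
    (h : ∀ x ∈ R, x = ⊥ ∨ x = ⊤ ∨ x = a ∨ x = aᶜ ∨ x = b ∨ x = bᶜ) : False := by
  have hle1 : aᶜ ⊓ b ≤ aᶜ := inf_le_left
  have hle2 : aᶜ ⊓ b ≤ b := inf_le_right
  rcases h _ (hR.inf_mem _ (hR.compl_mem _ ha) _ hb) with e | e | e | e | e | e
  · have := orthomodular' a b hab
    rw [e, sup_bot_eq] at this; exact hne this
  · rw [e] at hle2; exact h1 (top_le_iff.1 hle2)
  · rw [e] at hle1; exact h0 (eq_bot_of_le_compl hle1)
  · rw [e] at hle2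
    apply h1; rw [← top_le_iff, ← sup_compl' a]; exact sup_le hab hle2
  · rw [e] at hle1
    exact h0 (eq_bot_of_le_compl (hab.trans hle1))
  · rw [e] at hle2
    apply h1; rw [← top_le_iff, ← sup_compl' b]; exact sup_le le_rfl hle2

theorem not_six {R : Set A} (hR : IsBooleanSub R) {a b : A} (ha : a ∈ R) (hb : b ∈ R)
    (ha0 : a ≠ ⊥) (ha1 : a ≠ ⊤) (hb0 : b ≠ ⊥) (hb1 : b ≠ ⊤) (hne : a ≠ b) (hne' : b ≠ aᶜ)
    (h : ∀ x ∈ R, x = ⊥ ∨ x = ⊤ ∨ x = a ∨ x = aᶜ ∨ x = b ∨ x = bᶜ) : False := by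
  have hb1' : bᶜ ≠ ⊤ := fun e => hb0 (by rw [← compl_compl' b, e, compl_top'])
  have hne'' : a ≠ bᶜ := fun e => hne' (by rw [e, compl_compl'])
  have hbot : a ⊓ b = ⊥ → False := fun e => by
    have h2 : a ≤ bᶜ := by
      have := hR.distrib a ha b hb bᶜ (hR.compl_mem _ hb)
      rw [sup_compl', inf_top_eq, e, bot_sup_eq] at this
      rw [this]; exact inf_le_right
    refine not_six_of_le hR ha (hR.compl_mem _ hb) ha0 hb1' h2 hne'' fun x hx => ?_
    rw [compl_compl']
    have := h x hx; tauto
  have hle1 : a ⊓ b ≤ a := inf_le_left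
  have hle2 : a ⊓ b ≤ b := inf_le_right
  rcases h _ (hR.inf_mem _ ha _ hb) with e | e | e | e | e | e
  · exact hbot e
  · rw [e] at hle1; exact ha1 (top_le_iff.1 hle1)
  · rw [e] at hle2; exact not_six_of_le hR ha hb ha0 hb1 hle2 hne h
  · rw [e] at hle1
    apply ha1; rw [← top_le_iff, ← sup_compl' a]; exact sup_le le_rfl hle1
  · rw [e] at hle1
    refine not_six_of_le hR hb ha hb0 ha1 hle1 hne.symm fun x hx => ?_
    have := h x hx; tauto
  · rw [e] at hle2
    apply hb1; rw [← top_le_iff, ← sup_compl' b]; exact sup_le le_rfl hle2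

/-- A Boolean subalgebra contained in an eight-element one and containing two distinct points is
the whole of it. -/
theorem eq_of_two_points {R T : Set A} (hR : IsBooleanSub R) (h8 : T.ncard = 8) (hRT : R ⊆ T)
    {p q : BoolPoint A} (hpq : p ≠ q) (hp : p.1 ⊆ R) (hq : q.1 ⊆ R) : R = T := by
  have hfin : T.Finite := Set.finite_of_ncard_ne_zero (by omega)
  have hRfin := hfin.subset hRT
  obtain ⟨a, ha, ha0, ha1⟩ := IsBooleanSub.exists_four p.2.2
  obtain ⟨b, hb, hb0, hb1⟩ := IsBooleanSub.exists_four q.2.2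
  have ep := p.2.1.eq_four p.2.2 ha ha0 ha1
  have eq' := q.2.1.eq_four q.2.2 hb hb0 hb1
  have hbp : b ∉ p.1 := fun h =>
    hpq (Subtype.ext ((p.2.1.eq_four p.2.2 h hb0 hb1).trans eq'.symm))
  have n6 : (insert b (insert bᶜ p.1)).ncard = 6 := by
    rw [ncard_insert_pair (Set.finite_of_ncard_ne_zero (by rw [p.2.2]; omega)) p.2.1.compl_mem
      p.2.1.bot_mem hbp, p.2.2]
  have hsub : insert b (insert bᶜ p.1) ⊆ R := by
    rintro x (rfl | rfl | hx)
    exacts [hq hb, hR.compl_mem _ (hq hb), hp hx]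
  have hex : ∃ c ∈ R, c ∉ insert b (insert bᶜ p.1) := by
    by_contra! hcon
    refine not_six hR (hp ha) (hq hb) ha0 ha1 hb0 hb1 (fun e => hbp (e ▸ ha))
      (fun e => hbp (e ▸ p.2.1.compl_mem _ ha)) fun x hx => ?_
    have := hcon x hx
    rw [ep] at this
    simp only [Set.mem_insert_iff, Set.mem_singleton_iff] at this
    tauto
  obtain ⟨c, hcR, hc⟩ := hex
  have f6 : (insert b (insert bᶜ p.1)).Finite := hRfin.subset hsub
  have n8 := ncard_insert_pair f6 (compl_mem_insert_pair p.2.1.compl_mem b)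
    (by simp [p.2.1.bot_mem]) hc
  have hsub8 : insert c (insert cᶜ (insert b (insert bᶜ p.1))) ⊆ R := by
    rintro x (rfl | rfl | hx)
    exacts [hcR, hR.compl_mem _ hcR, hsub hx]
  have := Set.ncard_le_ncard hsub8 hRfin
  exact Set.eq_of_subset_of_ncard_le hRT (by omega) hfin

theorem boolLine_unique {p q : BoolPoint A} (hpq : p ≠ q) {T T' : Set A} (hT : IsBooleanSub T)
    (h8 : T.ncard = 8) (hT' : IsBooleanSub T') (h8' : T'.ncard = 8) (hp : p.1 ⊆ T) (hq : q.1 ⊆ T)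
    (hp' : p.1 ⊆ T') (hq' : q.1 ⊆ T') : T = T' := by
  have hR := hT.inter hT'
  have e1 := eq_of_two_points hR h8 Set.inter_subset_left hpq
    (Set.subset_inter hp hp') (Set.subset_inter hq hq')
  have e2 := eq_of_two_points hR h8' Set.inter_subset_right hpq
    (Set.subset_inter hp hp') (Set.subset_inter hq hq')
  exact e1.symm.trans e2

variable (A)

/-- The points and lines of `A`: the Boolean subalgebras with 4 and with 8 elements. A line is
identified with the set of the points contained in it. -/
def orthogeometryOf : PreOrthogeometry.{u} where
  Point := BoolPoint A
  lines := {l | ∃ T : Set A, IsBooleanSub T ∧ T.ncard = 8 ∧ l = boolLine T}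
  ncard_line := by
    rintro _ ⟨T, hT, h8, rfl⟩
    exact ncard_boolLine hT h8
  line_unique := by
    rintro p q hpq _ ⟨T, hT, h8, rfl⟩ _ ⟨T', hT', h8', rfl⟩ hp hq hp' hq'
    rw [boolLine_unique hpq hT h8 hT' h8' hp hq hp' hq']

end OfOML

namespace PreOrthogeometry

variable (G H K : PreOrthogeometry.{u})

/-- A plane of `G` with its points labelled: the 7 points are distinct, and the lines having at
least two points in common with the plane are exactly the 6 lines displayed. The vertices
`a, b, c, d` lie on three of these lines each, the points `x, y, z` on two each. In
particular a plane is a subspace. -/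
def IsPlane (a b c d x y z : G.Point) : Prop :=
  [a, b, c, d, x, y, z].Nodup ∧
    {l ∈ G.lines | (l ∩ {a, b, c, d, x, y, z}).Nontrivial} =
      {{a, b, x}, {c, d, x}, {a, c, y}, {b, d, y}, {a, d, z}, {b, c, z}}

/-- `w` is the set of points of a plane. -/
def IsPlaneSet (w : Set G.Point) : Prop :=
  ∃ a b c d x y z : G.Point, G.IsPlane a b c d x y z ∧ w = {a, b, c, d, x, y, z}

/-- The lines `l` and `m` lie in a plane in which they are the only lines containing `p`. -/
def Opposite (p : G.Point) (l m : Set G.Point) : Prop :=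
  ∃ a b c d y z : G.Point, G.IsPlane a b c d p y z ∧ l = {a, b, p} ∧ m = {c, d, p}

/-- The two values of a direction. -/
inductive Arrow : Type
  | up
  | down

/-- A direction for a point: an assignment of arrows to the lines containing the point, opposite
values corresponding to the lines that are opposite at this point. A point lying on no line has
two directions, distinguished by `sign`; for a point on some line, `sign` carries no information. -/
@[ext]
structure Direction where
  point : G.Point
  val : {l : Set G.Point // l ∈ G.lines ∧ point ∈ l} → Arrow
  sign : (∀ l ∈ G.lines, point ∉ l) → Arrow
  val_ne_iff : ∀ l m, val l ≠ val m ↔ G.Opposite point l.1 m.1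

/-- The directions of `G`: the directions for its points and the two directions `0` and `1`. -/
inductive Dir : Type u
  | zero : Dir
  | one : Dir
  | of : G.Direction → Dir

variable {G H K}

/-- The natural ordering of the directions. -/
def Dir.le : G.Dir → G.Dir → Prop
  | .zero, _ => True
  | _, .one => True
  | .of d, .of e => d = e ∨ ∃ (l : Set G.Point) (hl : l ∈ G.lines) (hd : d.point ∈ l)
      (he : e.point ∈ l), d.point ≠ e.point ∧ d.val ⟨l, hl, hd⟩ = Arrow.down ∧
        e.val ⟨l, hl, he⟩ = Arrow.up
  | _, _ => False

instance : LE G.Dir := ⟨Dir.le⟩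

/-- The image of a set of points under a partial function. -/
def img (α : G.Point → Option H.Point) (S : Set G.Point) : Set H.Point :=
  {q | ∃ p ∈ S, α p = some q}

/-- Morphisms of orthogeometries are partial functions `α` between the points such that:
a line is either mapped to nothing, or one of its points is mapped to nothing and the other two
are mapped to the same point, or it is mapped onto a line; a plane on whose vertices `α` is
defined is mapped one-to-one onto a plane; and lines whose images are opposite at a point are
opposite. -/
structure IsMorphism (α : G.Point → Option H.Point) : Prop where
  line : ∀ l ∈ G.lines, (∀ p ∈ l, α p = none) ∨
    (∃ p ∈ l, ∃ s, α p = none ∧ ∀ q ∈ l, q ≠ p → α q = some s) ∨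
    ((∀ p ∈ l, ∃ s, α p = some s) ∧ img α l ∈ H.lines)
  plane : ∀ a b c d x y z, G.IsPlane a b c d x y z → ∀ a' b' c' d',
    α a = some a' → α b = some b' → α c = some c' → α d = some d' →
      ∃ x' y' z', α x = some x' ∧ α y = some y' ∧ α z = some z' ∧
        H.IsPlane a' b' c' d' x' y' z'
  opposite : ∀ p p', α p = some p' → ∀ l ∈ G.lines, ∀ m ∈ G.lines, p ∈ l → p ∈ m →
    H.Opposite p' (img α l) (img α m) → G.Opposite p l m

/-- A morphism is proper if it is defined somewhere, every point lies on a line having a larger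
image, and every line whose image has at most one point lies in a plane having a larger image. -/
structure IsProper (α : G.Point → Option H.Point) : Prop where
  bot : ∃ p q, α p = some q
  point : ∀ p, ∃ l ∈ G.lines, p ∈ l ∧ img α {p} ⊂ img α l
  line : ∀ l ∈ G.lines, (img α l).Subsingleton →
    ∃ w, G.IsPlaneSet w ∧ l ⊆ w ∧ img α l ⊂ img α w

/-- `F` is a map of directions induced by `α`: it preserves `0` and `1`; if `p` is mapped to a
point `q` then a direction `d` for `p` is mapped to a direction for `q` that takes at the image of
a line `l` the value of `d` at `l`, whenever this image is a line; if `p` is mapped to nothing then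
`d` is mapped to `0` or `1`, to `0` if `d` has the value `↓`, and to `1` if `d` has the value `↑`,
at a line with non-empty image. -/
structure IsDirMap (α : G.Point → Option H.Point) (F : G.Dir → H.Dir) : Prop where
  zero : F .zero = .zero
  one : F .one = .one
  of_some : ∀ (d : G.Direction) (q : H.Point), α d.point = some q →
    ∃ e : H.Direction, F (.of d) = .of e ∧ e.point = q ∧
      ∀ l h (h' : img α l ∈ H.lines ∧ e.point ∈ img α l), e.val ⟨img α l, h'⟩ = d.val ⟨l, h⟩
  of_none : ∀ d : G.Direction, α d.point = none →
    (F (.of d) = .zero ∨ F (.of d) = .one) ∧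
      ∀ l h, (img α l).Nonempty → (d.val ⟨l, h⟩ = Arrow.down → F (.of d) = .zero) ∧
        (d.val ⟨l, h⟩ = Arrow.up → F (.of d) = .one)

/-- `α` preserves all joins: it induces a map of directions that takes a minimal cone (least upper
bound) of a set `D` of directions to a minimal cone of the image of `D`. -/
def PreservesJoins (α : G.Point → Option H.Point) : Prop :=
  ∃ F : G.Dir → H.Dir, IsDirMap α F ∧
    ∀ (D : Set G.Dir) (e : G.Dir), IsLUB D e → IsLUB (F '' D) (F e)

theorem img_some (S : Set G.Point) : img (fun p : G.Point => some p) S = S := by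
  ext q; simp [img]

theorem img_bind (α : G.Point → Option H.Point) (β : H.Point → Option K.Point)
    (S : Set G.Point) : img (fun p => (α p).bind β) S = img β (img α S) := by
  ext r
  simp only [img, Set.mem_ofPred_eq, Option.bind_eq_some_iff]
  constructor
  · rintro ⟨p, hp, q, hq, hr⟩; exact ⟨q, ⟨p, hp, hq⟩, hr⟩
  · rintro ⟨q, ⟨p, hp, hq⟩, hr⟩; exact ⟨p, hp, q, hq, hr⟩

theorem IsMorphism.id : IsMorphism (fun p : G.Point => some p) where
  line l hl := Or.inr (Or.inr ⟨fun p _ => ⟨p, rfl⟩, by rwa [img_some]⟩)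
  plane := by
    rintro a b c d x y z h a' b' c' d' ⟨⟩ ⟨⟩ ⟨⟩ ⟨⟩
    exact ⟨x, y, z, rfl, rfl, rfl, h⟩
  opposite := by
    rintro p p' ⟨⟩ l _ m _ _ _ h
    simpa only [img_some] using h

/-- If the image of a line under the composite has at least two points, its image under the first
map is a line. -/
theorem IsMorphism.line_of_nontrivial {α : G.Point → Option H.Point} (hα : IsMorphism α)
    (β : H.Point → Option K.Point) {l : Set G.Point} (hl : l ∈ G.lines)
    (h : (img β (img α l)).Nontrivial) :
    (∀ p ∈ l, ∃ s, α p = some s) ∧ img α l ∈ H.lines := by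
  obtain ⟨r, ⟨q, ⟨p, hp, hpq⟩, hqr⟩, r', ⟨q', ⟨p', hp', hpq'⟩, hqr'⟩, hne⟩ := h
  rcases hα.line l hl with h | ⟨t, ht, s, hts, h⟩ | h
  · simp [h p hp] at hpq
  · exfalso
    have e1 : q = s := by
      by_cases e : p = t
      · subst e; simp [hts] at hpq
      · have := h p hp e; rw [hpq] at this; exact Option.some.inj this
    have e2 : q' = s := by
      by_cases e : p' = t
      · subst e; simp [hts] at hpq'
      · have := h p' hp' e; rw [hpq'] at this; exact Option.some.inj this
    subst e1; subst e2
    rw [hqr] at hqr'; exact hne (Option.some.inj hqr')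
  · exact h

theorem nontrivial_line {l : Set G.Point} (hl : l ∈ G.lines) : l.Nontrivial := by
  have := G.ncard_line l hl
  have : Finite l := Set.finite_of_ncard_ne_zero (s := l) (by omega)
  exact Set.one_lt_ncard_iff_nontrivial.1 (by omega)

/-- A morphism is injective on a line that it maps onto a line. -/
theorem injOn_line {α : G.Point → Option H.Point} {l : Set G.Point} (hl : l ∈ G.lines)
    (h : img α l ∈ H.lines) {p q : G.Point} (hp : p ∈ l) (hq : q ∈ l)
    (hpq : α p = α q) : p = q := by
  have h3 := G.ncard_line l hl
  have h3' := H.ncard_line _ h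
  have hfin : l.Finite := Set.finite_of_ncard_ne_zero (by omega)
  have himg : (some '' (img α l)) ⊆ α '' l := by
    rintro _ ⟨s, ⟨t, ht, hs⟩, rfl⟩; exact ⟨t, ht, hs⟩
  have h1 := Set.ncard_le_ncard himg (hfin.image _)
  rw [Set.ncard_image_of_injective _ (Option.some_injective _)] at h1
  have h2 := Set.ncard_image_le (f := α) hfin
  exact (Set.ncard_image_iff hfin).1 (by omega) hp hq hpq

theorem Opposite.mem_lines {p : G.Point} {l m : Set G.Point} (h : G.Opposite p l m) :
    l ∈ G.lines ∧ m ∈ G.lines := by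
  obtain ⟨a, b, c, d, y, z, ⟨_, h⟩, rfl, rfl⟩ := h
  have h1 : ({a, b, p} : Set G.Point) ∈
      {l ∈ G.lines | (l ∩ {a, b, c, d, p, y, z}).Nontrivial} := by rw [h]; simp
  have h2 : ({c, d, p} : Set G.Point) ∈
      {l ∈ G.lines | (l ∩ {a, b, c, d, p, y, z}).Nontrivial} := by rw [h]; simp
  exact ⟨h1.1, h2.1⟩

theorem IsMorphism.comp {α : G.Point → Option H.Point} {β : H.Point → Option K.Point}
    (hα : IsMorphism α) (hβ : IsMorphism β) : IsMorphism (fun p => (α p).bind β) where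
  line l hl := by
    rcases hα.line l hl with h | ⟨t, ht, s, hts, h⟩ | ⟨h, hl'⟩
    · exact Or.inl fun p hp => by simp [h p hp]
    · cases hs : β s with
      | none =>
        refine Or.inl fun p hp => ?_
        by_cases e : p = t
        · simp [e, hts]
        · simp [h p hp e, hs]
      | some r =>
        exact Or.inr (Or.inl ⟨t, ht, r, by simp [hts], fun q hq e => by simp [h q hq e, hs]⟩)
    · rcases hβ.line _ hl' with k | ⟨t, ⟨p, hp, hpt⟩, r, htr, k⟩ | ⟨k, hl''⟩
      · refine Or.inl fun p hp => ?_
        obtain ⟨s, hs⟩ := h p hp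
        simp [hs, k s ⟨p, hp, hs⟩]
      · refine Or.inr (Or.inl ⟨p, hp, r, by simp [hpt, htr], fun q hq e => ?_⟩)
        obtain ⟨s, hs⟩ := h q hq
        have : s ≠ t := fun e' => e (injOn_line hl hl' hq hp (by rw [hs, hpt, e']))
        simp [hs, k s ⟨q, hq, hs⟩ this]
      · refine Or.inr (Or.inr ⟨fun p hp => ?_, by rwa [img_bind]⟩)
        obtain ⟨s, hs⟩ := h p hp
        obtain ⟨r, hr⟩ := k s ⟨p, hp, hs⟩
        exact ⟨r, by simp [hs, hr]⟩
  plane a b c d x y z hw a' b' c' d' ha hb hc hd := by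
    obtain ⟨a1, ha1, ha2⟩ := Option.bind_eq_some_iff.1 ha
    obtain ⟨b1, hb1, hb2⟩ := Option.bind_eq_some_iff.1 hb
    obtain ⟨c1, hc1, hc2⟩ := Option.bind_eq_some_iff.1 hc
    obtain ⟨d1, hd1, hd2⟩ := Option.bind_eq_some_iff.1 hd
    obtain ⟨x1, y1, z1, hx, hy, hz, hw1⟩ := hα.plane _ _ _ _ _ _ _ hw _ _ _ _ ha1 hb1 hc1 hd1
    obtain ⟨x2, y2, z2, hx2, hy2, hz2, hw2⟩ := hβ.plane _ _ _ _ _ _ _ hw1 _ _ _ _ ha2 hb2 hc2 hd2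
    exact ⟨x2, y2, z2, by simp [hx, hx2], by simp [hy, hy2], by simp [hz, hz2], hw2⟩
  opposite p p' hp l hl m hm hpl hpm h := by
    obtain ⟨p1, hp1, hp2⟩ := Option.bind_eq_some_iff.1 hp
    rw [img_bind, img_bind] at h
    have hl1 := hα.line_of_nontrivial β hl (nontrivial_line h.mem_lines.1)
    have hm1 := hα.line_of_nontrivial β hm (nontrivial_line h.mem_lines.2)
    exact hα.opposite p p1 hp1 l hl m hm hpl hpm
      (hβ.opposite p1 p' hp2 _ hl1.2 _ hm1.2 ⟨p, hpl, hp1⟩ ⟨p, hpm, hp1⟩ h)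

theorem PreservesJoins.id : PreservesJoins (fun p : G.Point => some p) := by
  refine ⟨_root_.id, ⟨rfl, rfl, ?_, ?_⟩, fun D e h => by simpa using h⟩
  · rintro d q ⟨⟩
    refine ⟨d, rfl, rfl, fun l h h' => ?_⟩
    congr 1
    exact Subtype.ext (img_some l)
  · intro d h; cases h

theorem PreservesJoins.comp {α : G.Point → Option H.Point} {β : H.Point → Option K.Point}
    (hm : IsMorphism α) (hα : PreservesJoins α) (hβ : PreservesJoins β) :
    PreservesJoins (fun p => (α p).bind β) := by
  obtain ⟨F, hF, hFj⟩ := hα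
  obtain ⟨E, hE, hEj⟩ := hβ
  refine ⟨fun d => E (F d), ⟨by rw [hF.zero, hE.zero], by rw [hF.one, hE.one], ?_, ?_⟩, ?_⟩
  · intro d r hr
    obtain ⟨q, hq, hqr⟩ := Option.bind_eq_some_iff.1 hr
    obtain ⟨e, he, rfl, hev⟩ := hF.of_some d q hq
    obtain ⟨c, hc, rfl, hcv⟩ := hE.of_some e r hqr
    refine ⟨c, by rw [he, hc], rfl, fun l h h' => ?_⟩
    have h1 : img (fun p => (α p).bind β) l = img β (img α l) := img_bind α β l
    have h2 := h'
    rw [h1] at h2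
    have hl1 := hm.line_of_nontrivial β h.1 (nontrivial_line h2.1)
    have h3 : img α l ∈ H.lines ∧ e.point ∈ img α l := ⟨hl1.2, d.point, h.2, hq⟩
    rw [← hev l h h3, ← hcv (img α l) h3 h2]
    congr 1
    exact Subtype.ext h1
  · intro d hd
    cases hq : α d.point with
    | none =>
      obtain ⟨h1, h2⟩ := hF.of_none d hq
      refine ⟨?_, fun l h hne => ?_⟩
      · rcases h1 with h1 | h1
        · left; simp only [h1, hE.zero]
        · right; simp only [h1, hE.one]
      · rw [img_bind] at hne
        obtain ⟨r, q, hq', _⟩ := hne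
        obtain ⟨h3, h4⟩ := h2 l h ⟨q, hq'⟩
        exact ⟨fun k => by simp only [h3 k, hE.zero], fun k => by simp only [h4 k, hE.one]⟩
    | some q =>
      have hqn : β q = none := by simpa [hq] using hd
      obtain ⟨e, he, rfl, hev⟩ := hF.of_some d q hq
      obtain ⟨h1, h2⟩ := hE.of_none e hqn
      simp only [he]
      refine ⟨h1, fun l h hne => ?_⟩
      rw [img_bind] at hne
      have hl1 : img α l ∈ H.lines := by
        obtain ⟨r, s, ⟨p, hp, hps⟩, hsr⟩ := hne
        rcases hm.line l h.1 with k | ⟨t, ht, u, htu, k⟩ | k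
        · simp [k p hp] at hps
        · exfalso
          have e1 : d.point ≠ t := fun e1 => by rw [e1, htu] at hq; cases hq
          have e2 : p ≠ t := fun e2 => by rw [e2, htu] at hps; cases hps
          have e3 := k _ h.2 e1
          have e4 := k _ hp e2
          rw [hq] at e3; rw [hps] at e4
          rw [Option.some.inj e4, ← Option.some.inj e3, hqn] at hsr
          cases hsr
        · exact k.2
      have h3 : img α l ∈ H.lines ∧ e.point ∈ img α l := ⟨hl1, d.point, h.2, hq⟩
      rw [← hev l h h3]
      exact h2 (img α l) h3 hne
  · intro D e h
    have := hEj _ _ (hFj D e h)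
    rwa [Set.image_image] at this

end PreOrthogeometry

/-- The objects of the category `COG`: the pre-orthogeometries isomorphic to the orthogeometry of
some complete orthomodular lattice. -/
structure COG : Type (u + 1) where
  toPre : PreOrthogeometry.{u}
  exists_iso : ∃ A : COML.{u}, Nonempty (toPre.Iso (orthogeometryOf A.carrier))

/-- The morphisms of `COG`: the morphisms of orthogeometries that preserve all joins. -/
@[ext]
structure COG.Hom (X Y : COG.{u}) where
  toFun : X.toPre.Point → Option Y.toPre.Point
  isMorphism : PreOrthogeometry.IsMorphism toFun
  preservesJoins : PreOrthogeometry.PreservesJoins toFun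

instance : Category COG.{u} where
  Hom X Y := COG.Hom X Y
  id X := ⟨fun p => some p, .id, .id⟩
  comp f g := ⟨fun p => (f.toFun p).bind g.toFun, f.isMorphism.comp g.isMorphism,
    .comp f.isMorphism f.preservesJoins g.preservesJoins⟩
  id_comp f := by apply COG.Hom.ext; funext p; rfl
  comp_id f := by apply COG.Hom.ext; funext p; simp
  assoc f g h := by apply COG.Hom.ext; funext p; simp [Option.bind_assoc]

/-- The orthogeometry of a complete orthomodular lattice as an object of `COG`. -/
def COG.of (A : COML.{u}) : COG.{u} where
  toPre := orthogeometryOf A.carrier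
  exists_iso := ⟨A, ⟨⟨Equiv.refl _, fun l => by simp⟩⟩⟩

open Classical in
/-- The partial function between points induced by a morphism of complete orthomodular lattices:
a four-element Boolean subalgebra `p` is mapped to its image `f[p]` if this has four elements. -/
noncomputable def pointMap {A B : COML.{u}} (f : A ⟶ B) :
    (COG.of A).toPre.Point → Option (COG.of B).toPre.Point :=
  fun p : BoolPoint A.carrier =>
    if h : (CompleteOMLHom.toFun f '' p.1).ncard = 4 then
      some (⟨CompleteOMLHom.toFun f '' p.1, p.2.1.image f, h⟩ : BoolPoint B.carrier)
    else none

/-- `A` has at most two elements. -/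
def COML.AtMostTwo (A : COML.{u}) : Prop := ∀ x : A.carrier, x = ⊥ ∨ x = ⊤

/-! ### Finite partitions of unity -/

section Partitions

variable {A B : Type u} [CompleteOML A] [CompleteOML B]

namespace CompleteOML

/-! A point of the geometry of `A` is a complementary pair `{x, xᶜ}` of nontrivial elements, a line
is a partition of unity into three nonzero pairwise orthogonal elements (`mem_lines_iff`), and a
plane is one into four (`isPlane_iff_part4`). A line through the point of `x` has exactly one of
`x`, `xᶜ` among its atoms, and two lines are opposite at the point iff they have complementary atoms
there (`opposite_iff`). Hence choosing `x` rather than `xᶜ` amounts to choosing a direction: `↓` at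
the lines of which `x` is an atom. If `x < y`, the line with atoms `x`, `yᶜ`, `xᶜ ⊓ y` exhibits the
inequality of the directions, and orthogonality of distinct atoms gives the converse. So a lattice
with `⊥ ≠ ⊤` is isomorphic, as a poset, to the directions of its geometry (`toDirIso`). The
complement is recovered as well, since `x` and `xᶜ` are the two nontrivial elements of one point.
This gives injectivity on objects.

A lattice homomorphism sends a partition to pairwise orthogonal elements with join `⊤`. Either none
of them is `⊥` and they form a partition again, or some atom is killed and a line collapses as the
definition of a morphism permits (`isMorphism_boolMap`). Under the identification of elements with
directions, the homomorphism is itself an induced map of directions (`isDirMap_boolMap`), so join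
preservation carries over.

Conversely, let `α` be a proper morphism. Every point lies on a line with larger image, and the
arrow of a direction at this line prescribes the induced value, so the induced map is unique. It
exists because the plane and opposition conditions make the arrows at different lines compatible
(`exists_isDirMap`). Uniqueness yields faithfulness. For fullness, the induced map becomes a map of
lattices; it preserves joins by hypothesis, and complements because the two directions of a point
take different values at a line with larger image (`exists_boolMap_eq`).

The two notions of properness agree by splitting. If a block contains `y` with `f y` outside `f[S]`,
then for some atom `a` of `S` the image of `a ⊓ y` is neither `⊥` nor `f a`, so refining the
partition at `a` gives the required line or plane. In the other direction, a line or plane extends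
to a block by Zorn's lemma. -/

theorem compl_ne_bot {a : A} (h : a ≠ ⊤) : aᶜ ≠ ⊥ :=
  fun e => h (by rw [← compl_compl' a, e, compl_bot'])

theorem compl_ne_top {a : A} (h : a ≠ ⊥) : aᶜ ≠ ⊤ :=
  fun e => h (by rw [← compl_compl' a, e, compl_top'])

theorem eq_bot_of_le_of_le_compl {a b : A} (h : a ≤ b) (h' : a ≤ bᶜ) : a = ⊥ :=
  le_bot_iff.1 (inf_compl' b ▸ le_inf h h')

/-- Orthomodularity makes an orthogonal complement unique: the part `aᶜ ⊓ bᶜ` by which `bᶜ` exceeds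
`a` is the complement of `a ⊔ b = ⊤`. -/
theorem eq_compl_of_orthogonal {a b : A} (h : a ≤ bᶜ) (h1 : a ⊔ b = ⊤) : bᶜ = a := by
  have := orthomodular' a bᶜ h
  rw [← compl_sup', h1, compl_top', sup_bot_eq] at this
  exact this.symm

end CompleteOML

open CompleteOML

/-- A partition of unity: a finite family of pairwise orthogonal elements with join `⊤`. -/
structure IsPartition {n : ℕ} (e : Fin n → A) : Prop where
  orth : ∀ i j, i ≠ j → e i ≤ (e j)ᶜ
  sup_eq : Finset.univ.sup e = ⊤

namespace IsPartition

variable {n : ℕ} {e : Fin n → A}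

theorem sup_orth (h : IsPartition e) {s t : Finset (Fin n)} (hst : Disjoint s t) :
    s.sup e ≤ (t.sup e)ᶜ := by
  refine Finset.sup_le fun i hi => le_compl_comm' (Finset.sup_le fun j hj => h.orth j i ?_)
  rintro rfl
  exact Finset.disjoint_left.1 hst hi hj

theorem compl_sup (h : IsPartition e) (s : Finset (Fin n)) : (s.sup e)ᶜ = sᶜ.sup e := by
  apply eq_compl_of_orthogonal (h.sup_orth disjoint_compl_left)
  rw [← Finset.sup_union, ← h.sup_eq]
  congr 1
  ext i; simp [em']

/-- De Morgan reduces meets to complements and joins, so no distributivity of `A` is needed. -/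
theorem inf_sup (h : IsPartition e) (s t : Finset (Fin n)) :
    s.sup e ⊓ t.sup e = (s ∩ t).sup e := by
  apply compl_inj'
  rw [compl_inf', h.compl_sup, h.compl_sup, h.compl_sup, ← Finset.sup_union, Finset.compl_inter]

/-- Sending a set of indices to its join respects all operations, so distributivity is inherited
from the finite subsets of `Fin n`. -/
theorem isBooleanSub (h : IsPartition e) :
    IsBooleanSub (Set.range fun s : Finset (Fin n) => s.sup e) where
  bot_mem := ⟨∅, by simp⟩
  top_mem := ⟨Finset.univ, h.sup_eq⟩
  compl_mem := by rintro _ ⟨s, rfl⟩; exact ⟨sᶜ, (h.compl_sup s).symm⟩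
  sup_mem := by rintro _ ⟨s, rfl⟩ _ ⟨t, rfl⟩; exact ⟨s ∪ t, Finset.sup_union⟩
  inf_mem := by rintro _ ⟨s, rfl⟩ _ ⟨t, rfl⟩; exact ⟨s ∩ t, (h.inf_sup s t).symm⟩
  distrib := by
    rintro _ ⟨s, rfl⟩ _ ⟨t, rfl⟩ _ ⟨r, rfl⟩
    simp only
    rw [← Finset.sup_union, h.inf_sup, h.inf_sup, h.inf_sup, ← Finset.sup_union,
      Finset.inter_union_distrib_left]

/-- An index in `s` but not in `t` would give an element both below and orthogonal to the join over
`t`, hence `⊥`. -/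
theorem sup_le_sup_iff (h : IsPartition e) (h0 : ∀ i, e i ≠ ⊥) {s t : Finset (Fin n)} :
    s.sup e ≤ t.sup e ↔ s ⊆ t := by
  refine ⟨fun hst i hi => ?_, fun hst => Finset.sup_mono hst⟩
  by_contra hit
  refine h0 i (eq_bot_of_le_of_le_compl ((Finset.le_sup hi).trans hst) ?_)
  have := h.sup_orth (s := {i}) (t := t) (by simpa using hit)
  simpa using this

theorem sup_injective (h : IsPartition e) (h0 : ∀ i, e i ≠ ⊥) :
    Function.Injective fun s : Finset (Fin n) => s.sup e := fun _ _ hst =>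
  Finset.Subset.antisymm ((h.sup_le_sup_iff h0).1 (le_of_eq hst))
    ((h.sup_le_sup_iff h0).1 (le_of_eq hst.symm))

theorem ncard_range (h : IsPartition e) (h0 : ∀ i, e i ≠ ⊥) :
    (Set.range fun s : Finset (Fin n) => s.sup e).ncard = 2 ^ n := by
  rw [← Set.image_univ, Set.ncard_image_of_injective _ (h.sup_injective h0), Set.ncard_univ]
  simp

theorem range_subset {S : Set A} (hS : IsBooleanSub S) (h : ∀ i, e i ∈ S) :
    (Set.range fun s : Finset (Fin n) => s.sup e) ⊆ S := by
  rintro _ ⟨s, rfl⟩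
  exact Finset.sup_mem S hS.bot_mem (fun x hx y hy => hS.sup_mem x hx y hy) s e fun i _ => h i

end IsPartition

/-- Three nonzero pairwise orthogonal elements with join `⊤`: the atoms of an eight-element Boolean
subalgebra. -/
structure Part3 (a b c : A) : Prop where
  ha : a ≠ ⊥
  hb : b ≠ ⊥
  hc : c ≠ ⊥
  ab : a ≤ bᶜ
  ac : a ≤ cᶜ
  bc : b ≤ cᶜ
  sup : a ⊔ b ⊔ c = ⊤

/-- Four nonzero pairwise orthogonal elements with join `⊤`: the atoms of a sixteen-element Boolean
subalgebra. -/
structure Part4 (a b c d : A) : Prop where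
  ha : a ≠ ⊥
  hb : b ≠ ⊥
  hc : c ≠ ⊥
  hd : d ≠ ⊥
  ab : a ≤ bᶜ
  ac : a ≤ cᶜ
  ad : a ≤ dᶜ
  bc : b ≤ cᶜ
  bd : b ≤ dᶜ
  cd : c ≤ dᶜ
  sup : a ⊔ b ⊔ c ⊔ d = ⊤

namespace Part3

variable {a b c : A}

theorem rotate (h : Part3 a b c) : Part3 b c a :=
  ⟨h.hb, h.hc, h.ha, h.bc, le_compl_comm' h.ab, le_compl_comm' h.ac, by
    rw [← h.sup, sup_comm (b ⊔ c), sup_assoc]⟩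

theorem swap (h : Part3 a b c) : Part3 a c b :=
  ⟨h.ha, h.hc, h.hb, h.ac, h.ab, le_compl_comm' h.bc, by
    rw [← h.sup, sup_assoc, sup_assoc, sup_comm b]⟩

theorem compl_eq (h : Part3 a b c) : aᶜ = b ⊔ c :=
  eq_compl_of_orthogonal (sup_le (le_compl_comm' h.ab) (le_compl_comm' h.ac))
    (by rw [sup_comm, ← sup_assoc, h.sup])

theorem ne_top (h : Part3 a b c) : a ≠ ⊤ := fun e =>
  h.hb (eq_bot_of_le_of_le_compl (e ▸ le_top : b ≤ a) (le_compl_comm' h.ab))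

theorem isPartition (h : Part3 a b c) : IsPartition ![a, b, c] where
  orth i j hij := by
    fin_cases i <;> fin_cases j <;>
      first
      | exact absurd rfl hij
      | exact h.ab
      | exact h.ac
      | exact h.bc
      | exact le_compl_comm' h.ab
      | exact le_compl_comm' h.ac
      | exact le_compl_comm' h.bc
  sup_eq := by
    rw [← h.sup, show (Finset.univ : Finset (Fin 3)) = {0, 1, 2} from rfl]
    simp [sup_assoc]

theorem ne_bot (h : Part3 a b c) (i : Fin 3) : ![a, b, c] i ≠ ⊥ := by
  fin_cases i
  exacts [h.ha, h.hb, h.hc]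

theorem of_orthogonal (ha : a ≠ ⊥) (hb : b ≠ ⊥) (hab : a ≤ bᶜ) (h1 : a ⊔ b ≠ ⊤) :
    Part3 a b (a ⊔ b)ᶜ where
  ha := ha
  hb := hb
  hc := compl_ne_bot h1
  ab := hab
  ac := by rw [compl_compl']; exact le_sup_left
  bc := by rw [compl_compl']; exact le_sup_right
  sup := sup_compl' _

/-- A chain `⊥ < a < b < ⊤` determines an eight-element Boolean subalgebra. -/
theorem of_lt (ha : a ≠ ⊥) (hb : b ≠ ⊤) (hab : a < b) : Part3 a bᶜ (aᶜ ⊓ b) where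
  ha := ha
  hb := compl_ne_bot hb
  hc e := by
    have := orthomodular' a b hab.le
    rw [e, sup_bot_eq] at this
    exact hab.ne this
  ab := by rw [compl_compl']; exact hab.le
  ac := by rw [compl_inf', compl_compl']; exact le_sup_left
  bc := by rw [compl_inf', compl_compl']; exact le_sup_right
  sup := by
    rw [sup_assoc, sup_comm bᶜ, ← sup_assoc, orthomodular' a b hab.le, sup_compl']

end Part3

namespace Part4

variable {a b c d : A}

theorem rotate (h : Part4 a b c d) : Part4 b c d a :=
  ⟨h.hb, h.hc, h.hd, h.ha, h.bc, h.bd, le_compl_comm' h.ab, h.cd, le_compl_comm' h.ac,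
    le_compl_comm' h.ad, by rw [← h.sup, sup_comm (b ⊔ c ⊔ d), sup_assoc, sup_assoc, sup_assoc]⟩

theorem swap (h : Part4 a b c d) : Part4 b a c d :=
  ⟨h.hb, h.ha, h.hc, h.hd, le_compl_comm' h.ab, h.bc, h.bd, h.ac, h.ad, h.cd, by
    rw [← h.sup, sup_comm a]⟩

theorem part3 (h : Part4 a b c d) : Part3 a b (c ⊔ d) :=
  ⟨h.ha, h.hb, fun e => h.hc (sup_eq_bot_iff.1 e).1, h.ab,
    by rw [compl_sup']; exact le_inf h.ac h.ad, by rw [compl_sup']; exact le_inf h.bc h.bd,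
    by rw [← h.sup, ← sup_assoc]⟩

theorem isPartition (h : Part4 a b c d) : IsPartition ![a, b, c, d] where
  orth i j hij := by
    fin_cases i <;> fin_cases j <;>
      first
      | exact absurd rfl hij
      | exact h.ab
      | exact h.ac
      | exact h.ad
      | exact h.bc
      | exact h.bd
      | exact h.cd
      | exact le_compl_comm' h.ab
      | exact le_compl_comm' h.ac
      | exact le_compl_comm' h.ad
      | exact le_compl_comm' h.bc
      | exact le_compl_comm' h.bd
      | exact le_compl_comm' h.cd
  sup_eq := by
    rw [← h.sup, show (Finset.univ : Finset (Fin 4)) = {0, 1, 2, 3} from rfl]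
    simp [sup_assoc]

theorem ne_bot (h : Part4 a b c d) (i : Fin 4) : ![a, b, c, d] i ≠ ⊥ := by
  fin_cases i
  exacts [h.ha, h.hb, h.hc, h.hd]

/-- Here `a ⊔ b = xᶜ` and `c ⊔ d = x`, so each partition splits the complementary half of unity.
This is how two lines with complementary atoms span a plane. -/
theorem of_part3 {x : A} (h : Part3 x a b) (h' : Part3 xᶜ c d) : Part4 a b c d where
  ha := h.hb
  hb := h.hc
  hc := h'.hb
  hd := h'.hc
  ab := h.bc
  ac := (le_compl_comm' h.ab).trans h'.ab
  ad := (le_compl_comm' h.ab).trans h'.ac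
  bc := (le_compl_comm' h.ac).trans h'.ab
  bd := (le_compl_comm' h.ac).trans h'.ac
  cd := h'.bc
  sup := by rw [sup_assoc, ← h.compl_eq, ← h'.compl_eq, sup_compl']

end Part4

/-! ### Points and lines -/

theorem BoolPoint.mem_or {p : BoolPoint A} {x y : A} (hx : x ∈ p.1) (h0 : x ≠ ⊥) (h1 : x ≠ ⊤)
    (hy : y ∈ p.1) (hy0 : y ≠ ⊥) (hy1 : y ≠ ⊤) : y = x ∨ y = xᶜ := by
  rw [p.2.1.eq_four p.2.2 hx h0 h1] at hy
  simpa [hy0, hy1] using hy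

theorem BoolPoint.eq {p q : BoolPoint A} {x : A} (hx : x ∈ p.1) (hx' : x ∈ q.1) (h0 : x ≠ ⊥)
    (h1 : x ≠ ⊤) : p = q :=
  Subtype.ext ((p.2.1.eq_four p.2.2 hx h0 h1).trans (q.2.1.eq_four q.2.2 hx' h0 h1).symm)

theorem mem_fourPoint (x : A) (h0 : x ≠ ⊥) (h1 : x ≠ ⊤) : x ∈ (fourPoint x h0 h1).1 :=
  Or.inr (Or.inr (Or.inl rfl))

theorem BoolPoint.subset_iff {p : BoolPoint A} {x : A} (hx : x ∈ p.1) (h0 : x ≠ ⊥) (h1 : x ≠ ⊤)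
    {S : Set A} (hS : IsBooleanSub S) : p.1 ⊆ S ↔ x ∈ S := by
  refine ⟨fun h => h hx, fun h => ?_⟩
  rw [p.2.1.eq_four p.2.2 hx h0 h1]
  rintro y (rfl | rfl | rfl | rfl)
  exacts [hS.bot_mem, hS.top_mem, h, hS.compl_mem _ h]

/-- The points containing one of three given elements. -/
def tri (a b c : A) : Set (BoolPoint A) := {p | a ∈ p.1 ∨ b ∈ p.1 ∨ c ∈ p.1}

theorem tri_rotate (a b c : A) : tri a b c = tri b c a := by
  ext p; simp only [tri, Set.mem_ofPred_eq]; tauto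

theorem Part3.tri_eq {a b c : A} (h : Part3 a b c) {p q r : BoolPoint A} (hp : a ∈ p.1)
    (hq : b ∈ q.1) (hr : c ∈ r.1) : tri a b c = {p, q, r} := by
  ext s
  constructor
  · rintro (k | k | k)
    · exact Or.inl (BoolPoint.eq k hp h.ha h.ne_top)
    · exact Or.inr (Or.inl (BoolPoint.eq k hq h.hb h.rotate.ne_top))
    · exact Or.inr (Or.inr (BoolPoint.eq k hr h.hc h.rotate.rotate.ne_top))
  · rintro (rfl | rfl | rfl)
    exacts [Or.inl hp, Or.inr (Or.inl hq), Or.inr (Or.inr hr)]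

theorem Finset.fin_three_cases (s : Finset (Fin 3)) :
    s = ∅ ∨ s = Finset.univ ∨ (s = {0} ∨ s = {0}ᶜ) ∨ (s = {1} ∨ s = {1}ᶜ) ∨
      (s = {2} ∨ s = {2}ᶜ) := by
  revert s; decide

/-- Besides `⊥` and `⊤`, the subalgebra consists of the three atoms and their complements. From here
on a line can be treated as `tri a b c`. -/
theorem Part3.boolLine_eq {a b c : A} (h : Part3 a b c) :
    boolLine (Set.range fun s : Finset (Fin 3) => s.sup ![a, b, c]) = tri a b c := by
  have hP := h.isPartition
  ext p
  obtain ⟨x, hx, h0, h1⟩ := IsBooleanSub.exists_four p.2.2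
  have hxc := p.2.1.compl_mem x hx
  rw [boolLine, Set.mem_ofPred_eq, BoolPoint.subset_iff hx h0 h1 hP.isBooleanSub]
  constructor
  · rintro ⟨s, hs⟩
    have hs' : s.sup ![a, b, c] = x := hs
    rcases Finset.fin_three_cases s with rfl | rfl | (rfl | rfl) | (rfl | rfl) | (rfl | rfl)
    · exact absurd hs'.symm (by simpa using h0)
    · rw [hP.sup_eq] at hs'; exact absurd hs'.symm h1
    all_goals
      try rw [← hP.compl_sup] at hs'
      simp at hs'
      subst hs'
      try rw [compl_compl'] at hxc
      simp [tri, *]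
  · have aux : ∀ i : Fin 3, ![a, b, c] i ∈ p.1 →
        x ∈ Set.range fun s : Finset (Fin 3) => s.sup ![a, b, c] := by
      intro i hi
      have hi' : ![a, b, c] i ∈ Set.range fun s : Finset (Fin 3) => s.sup ![a, b, c] :=
        ⟨{i}, by simp⟩
      have hi1 : ![a, b, c] i ≠ ⊤ := by
        fin_cases i
        exacts [h.ne_top, h.rotate.ne_top, h.rotate.rotate.ne_top]
      rcases BoolPoint.mem_or hi (h.ne_bot i) hi1 hx h0 h1 with e | e
      · rwa [e]
      · rw [e]; exact hP.isBooleanSub.compl_mem _ hi'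
    rintro (k | k | k)
    exacts [aux 0 k, aux 1 k, aux 2 k]

/-- Disjoint elements need not be orthogonal in an orthomodular lattice; inside a Boolean
subalgebra, distributing `x ⊓ (y ⊔ yᶜ)` shows that they are. -/
theorem IsBooleanSub.le_compl_of_inf_eq_bot {S : Set A} (hS : IsBooleanSub S) {x y : A}
    (hx : x ∈ S) (hy : y ∈ S) (h : x ⊓ y = ⊥) : x ≤ yᶜ := by
  have := hS.distrib x hx y hy _ (hS.compl_mem y hy)
  rw [sup_compl', inf_top_eq, h, bot_sup_eq] at this
  rw [this]; exact inf_le_right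

theorem IsBooleanSub.eq_inf_sup_inf {S : Set A} (hS : IsBooleanSub S) {x y : A}
    (hx : x ∈ S) (hy : y ∈ S) : x = (x ⊓ y) ⊔ (x ⊓ yᶜ) := by
  rw [← hS.distrib x hx y hy _ (hS.compl_mem y hy), sup_compl', inf_top_eq]

/-- A Boolean subalgebra with at most eight elements, containing `x` and some `y` outside the
point of `x`, is generated by a partition into three elements. -/
theorem IsBooleanSub.exists_part3 {S : Set A} (hS : IsBooleanSub S) (hfin : S.Finite)
    (h8 : S.ncard ≤ 8) {x y : A} (hx : x ∈ S) (hy : y ∈ S) (h0 : x ≠ ⊥) (h1 : x ≠ ⊤)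
    (hy0 : y ≠ ⊥) (hy1 : y ≠ ⊤) (hyx : y ≠ x) (hyx' : y ≠ xᶜ) :
    ∃ a b c, Part3 a b c ∧ S = Set.range fun s : Finset (Fin 3) => s.sup ![a, b, c] := by
  -- Two disjoint nonzero elements that are not complementary give the partition `a`, `b`, `(a ⊔
  -- b)ᶜ`; its eight joins exhaust `S` by counting.
  have main : ∀ a ∈ S, ∀ b ∈ S, a ≠ ⊥ → b ≠ ⊥ → b ≠ aᶜ → a ⊓ b = ⊥ →
      ∃ a b c, Part3 a b c ∧ S = Set.range fun s : Finset (Fin 3) => s.sup ![a, b, c] := by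
    intro a ha b hb ha0 hb0 hab e
    have hle := hS.le_compl_of_inf_eq_bot ha hb e
    have hP : Part3 a b (a ⊔ b)ᶜ := .of_orthogonal ha0 hb0 hle fun e1 => by
      have := eq_compl_of_orthogonal hle e1
      rw [← this, compl_compl'] at hab; exact hab rfl
    refine ⟨_, _, _, hP,
      (Set.eq_of_subset_of_ncard_le (IsPartition.range_subset hS ?_) ?_ hfin).symm⟩
    · intro i
      fin_cases i
      exacts [ha, hb, hS.compl_mem _ (hS.sup_mem _ ha _ hb)]
    · rw [hP.isPartition.ncard_range hP.ne_bot]; omega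
  have hx' := hS.compl_mem x hx
  have hy' := hS.compl_mem y hy
  have hx0' := compl_ne_bot h1
  have hy0' := compl_ne_bot hy1
  -- If one of the four meets of `x`, `xᶜ` with `y`, `yᶜ` vanishes, `main` applies to that pair.
  -- Otherwise the four meets form a partition, and `S` would have at least sixteen elements.
  by_cases k1 : x ⊓ y = ⊥
  · exact main x hx y hy h0 hy0 hyx' k1
  by_cases k2 : x ⊓ yᶜ = ⊥
  · exact main x hx _ hy' h0 hy0' (fun e => hyx (compl_inj' e)) k2
  by_cases k3 : xᶜ ⊓ y = ⊥
  · exact main _ hx' y hy hx0' hy0 (by rwa [compl_compl']) k3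
  by_cases k4 : xᶜ ⊓ yᶜ = ⊥
  · exact main _ hx' _ hy' hx0' hy0' (fun e => hyx' (by rw [← compl_inj' e])) k4
  exfalso
  have hP : Part4 (x ⊓ y) (x ⊓ yᶜ) (xᶜ ⊓ y) (xᶜ ⊓ yᶜ) := by
    refine ⟨k1, k2, k3, k4, ?_, ?_, ?_, ?_, ?_, ?_, ?_⟩
    · rw [compl_inf', compl_compl']; exact inf_le_right.trans le_sup_right
    · rw [compl_inf', compl_compl']; exact inf_le_left.trans le_sup_left
    · rw [compl_inf', compl_compl']; exact inf_le_left.trans le_sup_left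
    · rw [compl_inf', compl_compl']; exact inf_le_left.trans le_sup_left
    · rw [compl_inf', compl_compl']; exact inf_le_left.trans le_sup_left
    · rw [compl_inf', compl_compl' y]; exact inf_le_right.trans le_sup_right
    · rw [sup_assoc, ← hS.eq_inf_sup_inf hx hy, ← hS.eq_inf_sup_inf hx' hy, sup_compl']
  have hle := Set.ncard_le_ncard (IsPartition.range_subset hS (e := ![_, _, _, _]) fun i => by
    fin_cases i
    exacts [hS.inf_mem _ hx _ hy, hS.inf_mem _ hx _ hy', hS.inf_mem _ hx' _ hy,
      hS.inf_mem _ hx' _ hy']) hfin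
  rw [hP.isPartition.ncard_range hP.ne_bot] at hle
  omega

theorem mem_lines_iff {l : Set (BoolPoint A)} :
    l ∈ (orthogeometryOf A).lines ↔ ∃ a b c, Part3 a b c ∧ l = tri a b c := by
  constructor
  · rintro ⟨T, hT, h8, rfl⟩
    have hfin : T.Finite := Set.finite_of_ncard_ne_zero (by omega)
    obtain ⟨p, q, r, hpq, -, -, hl⟩ := Set.ncard_eq_three.1 (ncard_boolLine hT h8)
    have hp : p ∈ boolLine T := by simp [hl]
    have hq : q ∈ boolLine T := by simp [hl]
    obtain ⟨x, hx, hx0, hx1⟩ := IsBooleanSub.exists_four p.2.2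
    obtain ⟨y, hy, hy0, hy1⟩ := IsBooleanSub.exists_four q.2.2
    have hyp : y ∉ p.1 := fun h => hpq (BoolPoint.eq h hy hy0 hy1)
    obtain ⟨a, b, c, h, rfl⟩ := hT.exists_part3 hfin h8.le (hp hx) (hq hy) hx0 hx1 hy0 hy1
      (fun e => hyp (e ▸ hx)) (fun e => hyp (e ▸ p.2.1.compl_mem _ hx))
    exact ⟨a, b, c, h, h.boolLine_eq⟩
  · rintro ⟨a, b, c, h, rfl⟩
    exact ⟨_, h.isPartition.isBooleanSub, h.isPartition.ncard_range h.ne_bot, h.boolLine_eq.symm⟩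

theorem Part3.mem_lines {a b c : A} (h : Part3 a b c) : tri a b c ∈ (orthogeometryOf A).lines :=
  mem_lines_iff.2 ⟨a, b, c, h, rfl⟩

/-- `x` is an atom of the Boolean subalgebra given by the line `l`. -/
def Down (x : A) (l : Set (BoolPoint A)) : Prop := ∃ b c, Part3 x b c ∧ l = tri x b c

theorem Down.ne_bot {x : A} {l : Set (BoolPoint A)} (h : Down x l) : x ≠ ⊥ := by
  obtain ⟨b, c, h, -⟩ := h; exact h.ha

theorem Down.ne_top {x : A} {l : Set (BoolPoint A)} (h : Down x l) : x ≠ ⊤ := by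
  obtain ⟨b, c, h, -⟩ := h; exact h.ne_top

theorem exists_down_of_mem {l : Set (BoolPoint A)} (hl : l ∈ (orthogeometryOf A).lines)
    {p : BoolPoint A} (hp : p ∈ l) : ∃ x ∈ p.1, Down x l := by
  obtain ⟨a, b, c, h, rfl⟩ := mem_lines_iff.1 hl
  rcases hp with k | k | k
  · exact ⟨a, k, b, c, h, rfl⟩
  · exact ⟨b, k, c, a, h.rotate, tri_rotate _ _ _⟩
  · exact ⟨c, k, a, b, h.rotate.rotate, by rw [tri_rotate, tri_rotate]⟩

theorem Part3.down_cases {a b c : A} (h : Part3 a b c) {x : A} (h0 : x ≠ ⊥) (h1 : x ≠ ⊤)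
    (hx : fourPoint x h0 h1 ∈ tri a b c) :
    (x = a ∨ x = b ∨ x = c) ∨ x = aᶜ ∨ x = bᶜ ∨ x = cᶜ := by
  have hm := mem_fourPoint x h0 h1
  rcases hx with k | k | k
  · rcases BoolPoint.mem_or k h.ha h.ne_top hm h0 h1 with e | e <;> simp [e]
  · rcases BoolPoint.mem_or k h.hb h.rotate.ne_top hm h0 h1 with e | e <;> simp [e]
  · rcases BoolPoint.mem_or k h.hc h.rotate.rotate.ne_top hm h0 h1 with e | e <;> simp [e]

theorem down_or_down_compl {l : Set (BoolPoint A)} (hl : l ∈ (orthogeometryOf A).lines)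
    {p : BoolPoint A} (hp : p ∈ l) {x : A} (hx : x ∈ p.1) (h0 : x ≠ ⊥) (h1 : x ≠ ⊤) :
    Down x l ∨ Down xᶜ l := by
  obtain ⟨y, hy, hd⟩ := exists_down_of_mem hl hp
  rcases BoolPoint.mem_or hx h0 h1 hy hd.ne_bot hd.ne_top with rfl | rfl
  exacts [Or.inl hd, Or.inr hd]

/-- If `xᶜ` were an atom too, its partition would provide an atom `d` with `⊥ < d < x` whose point
lies on the same line. But in the partition `x, b, c` the elements `b`, `c`, `xᶜ` are orthogonal to
`x`, and `bᶜ`, `cᶜ` are not below `x`. Hence the arrow of `x` at a line is unambiguous. -/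
theorem Down.not_compl {l : Set (BoolPoint A)} {x : A} (h : Down x l) : ¬ Down xᶜ l := by
  rintro ⟨d, e, h', hl⟩
  obtain ⟨b, c, h, rfl⟩ := h
  have hdx : d ≤ x := by have := le_compl_comm' h'.ab; rwa [compl_compl'] at this
  have hex : e ≤ x := by have := le_compl_comm' h'.ac; rwa [compl_compl'] at this
  have key : ∀ b : A, b ≠ ⊥ → x ≤ bᶜ → d ≠ b ∧ d ≠ x := fun b hb hxb =>
    ⟨fun k => hb (eq_bot_of_le_compl ((k.ge.trans hdx).trans hxb)), fun k => h'.hc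
      (eq_bot_of_le_of_le_compl hex (k ▸ le_compl_comm' h'.bc))⟩
  have hm : fourPoint d h'.hb h'.rotate.ne_top ∈ tri x b c := by
    rw [hl]; exact Or.inr (Or.inl (mem_fourPoint _ _ _))
  rcases h.down_cases _ _ hm with (k | k | k) | k | k | k
  · exact (key b h.hb h.ab).2 k
  · exact (key b h.hb h.ab).1 k
  · exact (key c h.hc h.ac).1 k
  · exact h'.hb (eq_bot_of_le_of_le_compl hdx (le_of_eq k))
  · have : c ≤ x := (le_compl_comm' h.bc).trans (k ▸ hdx)
    exact h.hc (eq_bot_of_le_of_le_compl this (le_compl_comm' h.ac))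
  · have : b ≤ x := h.bc.trans (k ▸ hdx)
    exact h.hb (eq_bot_of_le_of_le_compl this (le_compl_comm' h.ab))

/-- Distinct atoms of a line are orthogonal. -/
theorem Down.orthogonal {l : Set (BoolPoint A)} {x y : A} (hx : Down x l) (hy : Down y l)
    (hxy : x ≠ y) : x ≤ yᶜ := by
  have hy0 := hy.ne_bot
  have hy1 := hy.ne_top
  have hm : fourPoint y hy0 hy1 ∈ l := by
    obtain ⟨b, c, h, rfl⟩ := hy; exact Or.inl (mem_fourPoint _ _ _)
  have hyn := hy.not_compl
  obtain ⟨b, c, h, rfl⟩ := hx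
  rcases h.down_cases _ _ hm with (k | k | k) | k | k | k
  · exact absurd k.symm hxy
  · exact k ▸ h.ab
  · exact k ▸ h.ac
  · exact absurd ⟨b, c, by rwa [k, compl_compl'], by rw [k, compl_compl']⟩ hyn
  · exact absurd ⟨c, x, by rw [k, compl_compl']; exact h.rotate,
      by rw [k, compl_compl', tri_rotate]⟩ hyn
  · exact absurd ⟨x, b, by rw [k, compl_compl']; exact h.rotate.rotate,
      by rw [k, compl_compl', tri_rotate, tri_rotate]⟩ hyn

/-- Elements of two distinct points on a line are comparable up to complements. -/
theorem comparable_of_mem_line {l : Set (BoolPoint A)} (hl : l ∈ (orthogeometryOf A).lines)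
    {p q : BoolPoint A} (hp : p ∈ l) (hq : q ∈ l) (hpq : p ≠ q) {x y : A} (hx : x ∈ p.1)
    (hx0 : x ≠ ⊥) (hx1 : x ≠ ⊤) (hy : y ∈ q.1) (hy0 : y ≠ ⊥) (hy1 : y ≠ ⊤) :
    x ≤ y ∨ y ≤ x ∨ x ≤ yᶜ ∨ xᶜ ≤ y := by
  have hyp : y ∉ p.1 := fun h => hpq (BoolPoint.eq h hy hy0 hy1)
  have hne : ∀ z ∈ p.1, ∀ w, y = w ∨ y = wᶜ → z ≠ w := by
    rintro z hz w hw rfl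
    rcases hw with rfl | rfl
    exacts [hyp hz, hyp (p.2.1.compl_mem _ hz)]
  have hxc := p.2.1.compl_mem x hx
  rcases down_or_down_compl hl hp hx hx0 hx1 with h | h <;>
    rcases down_or_down_compl hl hq hy hy0 hy1 with k | k
  · exact Or.inr (Or.inr (Or.inl (h.orthogonal k (hne _ hx _ (Or.inl rfl)))))
  · have := h.orthogonal k (hne _ hx _ (Or.inr (compl_compl' y).symm))
    rw [compl_compl'] at this
    exact Or.inl this
  · have := le_compl_comm' (h.orthogonal k (hne _ hxc _ (Or.inl rfl)))
    rw [compl_compl'] at this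
    exact Or.inr (Or.inl this)
  · have := h.orthogonal k (hne _ hxc _ (Or.inr (compl_compl' y).symm))
    rw [compl_compl'] at this
    exact Or.inr (Or.inr (Or.inr this))

end Partitions

/-! ### Planes and opposite lines -/

namespace PreOrthogeometry

variable {G H : PreOrthogeometry.{u}}

theorem nodup_seven {α : Type*} {a b c d x y z : α} : [a, b, c, d, x, y, z].Nodup ↔
    (a ≠ b ∧ a ≠ c ∧ a ≠ d ∧ a ≠ x ∧ a ≠ y ∧ a ≠ z) ∧ (b ≠ c ∧ b ≠ d ∧ b ≠ x ∧ b ≠ y ∧ b ≠ z) ∧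
    (c ≠ d ∧ c ≠ x ∧ c ≠ y ∧ c ≠ z) ∧ (d ≠ x ∧ d ≠ y ∧ d ≠ z) ∧ (x ≠ y ∧ x ≠ z) ∧ y ≠ z := by
  simp only [List.nodup_cons, List.mem_cons, List.not_mem_nil, or_false, not_or,
    List.nodup_nil, not_false_eq_true, and_true, ne_eq]

/-- A plane is given by seven distinct points and six lines such that no line contains two of the
points `x, y, z`. -/
theorem isPlane_iff {a b c d x y z : G.Point} : G.IsPlane a b c d x y z ↔
    [a, b, c, d, x, y, z].Nodup ∧
    ({a, b, x} ∈ G.lines ∧ {c, d, x} ∈ G.lines ∧ {a, c, y} ∈ G.lines ∧ {b, d, y} ∈ G.lines ∧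
      {a, d, z} ∈ G.lines ∧ {b, c, z} ∈ G.lines) ∧
    (∀ l ∈ G.lines, ¬ (x ∈ l ∧ y ∈ l)) ∧ (∀ l ∈ G.lines, ¬ (x ∈ l ∧ z ∈ l)) ∧
      ∀ l ∈ G.lines, ¬ (y ∈ l ∧ z ∈ l) := by
  refine and_congr_right fun hnd => ?_
  obtain ⟨⟨nab, nac, nad, nax, nay, naz⟩, ⟨nbc, nbd, nbx, nby, nbz⟩, ⟨ncd, ncx, ncy, ncz⟩,
    ⟨ndx, ndy, ndz⟩, ⟨nxy, nxz⟩, nyz⟩ := nodup_seven.1 hnd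
  constructor
  · intro hl
    have mem : ∀ l ∈ ({{a, b, x}, {c, d, x}, {a, c, y}, {b, d, y}, {a, d, z}, {b, c, z}} :
        Set (Set G.Point)), l ∈ G.lines := fun l k => by rw [← hl] at k; exact k.1
    have no : ∀ p q : G.Point, p ∈ ({a, b, c, d, x, y, z} : Set G.Point) →
        q ∈ ({a, b, c, d, x, y, z} : Set G.Point) → p ≠ q → ∀ l ∈ G.lines, p ∈ l ∧ q ∈ l →
        l ∈ ({{a, b, x}, {c, d, x}, {a, c, y}, {b, d, y}, {a, d, z}, {b, c, z}} :
          Set (Set G.Point)) := fun p q hp hq hpq l k1 k2 => by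
      rw [← hl]; exact ⟨k1, p, ⟨k2.1, hp⟩, q, ⟨k2.2, hq⟩, hpq⟩
    refine ⟨⟨mem _ ?_, mem _ ?_, mem _ ?_, mem _ ?_, mem _ ?_, mem _ ?_⟩, fun l k1 k2 => ?_,
      fun l k1 k2 => ?_, fun l k1 k2 => ?_⟩
    iterate 6 simp
    · obtain ⟨k3, k4⟩ := k2
      have k5 := no x y (by simp) (by simp) nxy l k1 ⟨k3, k4⟩
      clear no mem hnd hl
      rcases k5 with rfl | rfl | rfl | rfl | rfl | rfl <;>
        simp only [Set.mem_insert_iff, Set.mem_singleton_iff] at k3 k4 <;> grind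
    · obtain ⟨k3, k4⟩ := k2
      have k5 := no x z (by simp) (by simp) nxz l k1 ⟨k3, k4⟩
      clear no mem hnd hl
      rcases k5 with rfl | rfl | rfl | rfl | rfl | rfl <;>
        simp only [Set.mem_insert_iff, Set.mem_singleton_iff] at k3 k4 <;> grind
    · obtain ⟨k3, k4⟩ := k2
      have k5 := no y z (by simp) (by simp) nyz l k1 ⟨k3, k4⟩
      clear no mem hnd hl
      rcases k5 with rfl | rfl | rfl | rfl | rfl | rfl <;>
        simp only [Set.mem_insert_iff, Set.mem_singleton_iff] at k3 k4 <;> grind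
  · rintro ⟨⟨l1, l2, l3, l4, l5, l6⟩, n1, n2, n3⟩
    ext l
    constructor
    · rintro ⟨hl, p, ⟨hp, hp'⟩, q, ⟨hq, hq'⟩, hpq⟩
      -- Any two of the seven points, unless both are among `x, y, z`, lie on one of the six lines;
      -- uniqueness of the line through two points then identifies `l` with it.
      have u : ∀ m ∈ G.lines, p ∈ m → q ∈ m → l = m := fun m hm h1 h2 =>
        G.line_unique p q hpq l hl m hm hp hq h1 h2
      have m1 := u _ l1
      have m2 := u _ l2
      have m3 := u _ l3
      have m4 := u _ l4
      have m5 := u _ l5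
      have m6 := u _ l6
      have n1 := n1 l hl
      have n2 := n2 l hl
      have n3 := n3 l hl
      clear u hnd l1 l2 l3 l4 l5 l6
      simp only [Set.mem_insert_iff, Set.mem_singleton_iff] at hp' hq' m1 m2 m3 m4 m5 m6 ⊢
      rcases hp' with rfl | rfl | rfl | rfl | rfl | rfl | rfl <;>
        rcases hq' with rfl | rfl | rfl | rfl | rfl | rfl | rfl <;>
        grind
    · have nt : ∀ p q : G.Point, p ∈ ({a, b, c, d, x, y, z} : Set G.Point) →
          q ∈ ({a, b, c, d, x, y, z} : Set G.Point) → p ≠ q → ∀ l, p ∈ l → q ∈ l →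
          (l ∩ {a, b, c, d, x, y, z} : Set G.Point).Nontrivial := fun p q hp hq hpq l k1 k2 =>
        ⟨p, ⟨k1, hp⟩, q, ⟨k2, hq⟩, hpq⟩
      rintro (rfl | rfl | rfl | rfl | rfl | rfl)
      · exact ⟨l1, nt a b (by simp) (by simp) nab _ (by simp) (by simp)⟩
      · exact ⟨l2, nt c d (by simp) (by simp) ncd _ (by simp) (by simp)⟩
      · exact ⟨l3, nt a c (by simp) (by simp) nac _ (by simp) (by simp)⟩
      · exact ⟨l4, nt b d (by simp) (by simp) nbd _ (by simp) (by simp)⟩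
      · exact ⟨l5, nt a d (by simp) (by simp) nad _ (by simp) (by simp)⟩
      · exact ⟨l6, nt b c (by simp) (by simp) nbc _ (by simp) (by simp)⟩

end PreOrthogeometry

section Planes

variable {A B : Type u} [CompleteOML A] [CompleteOML B]

open CompleteOML

theorem exists_part3_of_mem_lines {p q r : BoolPoint A} (hpq : p ≠ q) (hpr : p ≠ r) (hqr : q ≠ r)
    (h : {p, q, r} ∈ (orthogeometryOf A).lines) :
    ∃ a b c, Part3 a b c ∧ a ∈ p.1 ∧ b ∈ q.1 ∧ c ∈ r.1 := by
  obtain ⟨a, b, c, h, hl⟩ := mem_lines_iff.1 h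
  have hp : p ∈ tri a b c := hl ▸ Or.inl rfl
  have hq : q ∈ tri a b c := hl ▸ Or.inr (Or.inl rfl)
  have hr : r ∈ tri a b c := hl ▸ Or.inr (Or.inr rfl)
  have ha : ∀ {s t : BoolPoint A}, a ∈ s.1 → a ∈ t.1 → s = t := fun hs ht =>
    BoolPoint.eq hs ht h.ha h.ne_top
  have hb : ∀ {s t : BoolPoint A}, b ∈ s.1 → b ∈ t.1 → s = t := fun hs ht =>
    BoolPoint.eq hs ht h.hb h.rotate.ne_top
  have hc : ∀ {s t : BoolPoint A}, c ∈ s.1 → c ∈ t.1 → s = t := fun hs ht =>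
    BoolPoint.eq hs ht h.hc h.rotate.rotate.ne_top
  rcases hp with hp | hp | hp <;> rcases hq with hq | hq | hq <;> rcases hr with hr | hr | hr <;>
    first
    | exact absurd (ha hp hq) hpq
    | exact absurd (hb hp hq) hpq
    | exact absurd (hc hp hq) hpq
    | exact absurd (ha hp hr) hpr
    | exact absurd (hb hp hr) hpr
    | exact absurd (hc hp hr) hpr
    | exact absurd (ha hq hr) hqr
    | exact absurd (hb hq hr) hqr
    | exact absurd (hc hq hr) hqr
    | exact ⟨_, _, _, h, hp, hq, hr⟩
    | exact ⟨_, _, _, h.swap, hp, hq, hr⟩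
    | exact ⟨_, _, _, h.rotate, hp, hq, hr⟩
    | exact ⟨_, _, _, h.rotate.swap, hp, hq, hr⟩
    | exact ⟨_, _, _, h.rotate.rotate, hp, hq, hr⟩
    | exact ⟨_, _, _, h.rotate.rotate.swap, hp, hq, hr⟩

theorem Part3.mem_third {a b c : A} (h : Part3 a b c) {p q r : BoolPoint A} (hp : a ∈ p.1)
    (hq : b ∈ q.1) (hpq : p ≠ q) (hpr : p ≠ r) (hqr : q ≠ r)
    (hl : {p, q, r} ∈ (orthogeometryOf A).lines) : c ∈ r.1 := by
  have e := (orthogeometryOf A).line_unique p q hpq _ hl _ h.mem_lines (Or.inl rfl)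
    (Or.inr (Or.inl rfl)) (Or.inl hp) (Or.inr (Or.inl hq))
  have hr : r ∈ tri a b c := e ▸ (Or.inr (Or.inr rfl) : r ∈ ({p, q, r} : Set (BoolPoint A)))
  rcases hr with k | k | k
  · exact absurd (BoolPoint.eq hp k h.ha h.ne_top) hpr
  · exact absurd (BoolPoint.eq hq k h.hb h.rotate.ne_top) hqr
  · exact k

theorem Part3.compl_eq' {a b c : A} (h : Part3 a b c) : (b ⊔ c)ᶜ = a := by
  rw [← h.compl_eq, compl_compl']

/-- Both partitions split the same element: `a ⊔ b = c ⊔ d = xᶜ`. If `a < c`, every relation of `b`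
to `c` fails: `b ≤ c` gives `d ≤ c`, `c ≤ b` gives `a ≤ b`, and orthogonality of `b` and `c` gives
`c ≤ a`. -/
theorem Part3.false_of_lt {a b c d x : A} (h : Part3 a b x) (k : Part3 c d x) (hac : a ≤ c)
    (hne : a ≠ c) (hbc : b ≤ c ∨ c ≤ b ∨ b ≤ cᶜ) : False := by
  rcases hbc with e | e | e
  · have h1 : d ≤ c := k.bc.trans (h.rotate.rotate.compl_eq.trans_le (sup_le hac e))
    exact k.hb (eq_bot_of_le_of_le_compl h1 (le_compl_comm' k.ab))
  · exact h.ha (eq_bot_of_le_of_le_compl (hac.trans e) h.ab)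
  · have h1 : c ≤ a := by
      rw [← h.compl_eq', compl_sup']
      exact le_inf (le_compl_comm' e) k.ac
    exact hne (le_antisymm hac h1)

/-- If `a` is orthogonal to `c`, then `a ≤ (x ⊔ c)ᶜ = d`; thus every case comes down to a strict
inequality between members of the two decompositions of `xᶜ`. -/
theorem Part3.false_of_comparable {a b c d x : A} (h : Part3 a b x) (k : Part3 c d x)
    (ne_ac : a ≠ c) (ne_ad : a ≠ d)
    (hac : a ≤ c ∨ c ≤ a ∨ a ≤ cᶜ) (had : a ≤ d ∨ d ≤ a ∨ a ≤ dᶜ)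
    (hbc : b ≤ c ∨ c ≤ b ∨ b ≤ cᶜ) (hbd : b ≤ d ∨ d ≤ b ∨ b ≤ dᶜ) : False := by
  rcases hac with e | e | e
  · exact h.false_of_lt k e ne_ac hbc
  · exact k.false_of_lt h e ne_ac.symm
      (had.elim (fun w => Or.inr (Or.inl w)) fun w => w.elim Or.inl
        fun w => Or.inr (Or.inr (le_compl_comm' w)))
  · have h1 : a ≤ d := by
      rw [← k.rotate.compl_eq', compl_sup']
      exact le_inf h.ac e
    exact h.false_of_lt (k.swap.rotate.rotate) h1 ne_ad hbd

/-- Two lines of the plane meet at `px`, and their atoms there are equal or complementary. Equality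
would give two decompositions of one element, whose members the other four lines of the plane make
comparable or orthogonal; this is impossible. Complementary atoms glue to a partition into four. -/
theorem exists_part4_of_isPlane {pa pb pc pd px py pz : BoolPoint A}
    (h : (orthogeometryOf A).IsPlane pa pb pc pd px py pz) :
    ∃ a b c d, Part4 a b c d ∧ a ∈ pa.1 ∧ b ∈ pb.1 ∧ c ∈ pc.1 ∧ d ∈ pd.1 ∧
      a ⊔ b ∈ px.1 ∧ a ⊔ c ∈ py.1 ∧ a ⊔ d ∈ pz.1 := by
  obtain ⟨⟨nab, nac, nad, nax, nay, naz⟩, ⟨nbc, nbd, nbx, nby, nbz⟩, ⟨ncd, ncx, ncy, ncz⟩,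
    ⟨ndx, ndy, ndz⟩, -, -⟩ :=
    PreOrthogeometry.nodup_seven.1 h.1
  obtain ⟨⟨l1, l2, l3, l4, l5, l6⟩, -⟩ := (PreOrthogeometry.isPlane_iff.1 h).2
  obtain ⟨a, b, x, h, ha, hb, hx⟩ := exists_part3_of_mem_lines nab nax nbx l1
  obtain ⟨c, d, x', k, hc, hd, hx'⟩ := exists_part3_of_mem_lines ncd ncx ndx l2
  rcases BoolPoint.mem_or hx h.hc h.rotate.rotate.ne_top hx' k.hc k.rotate.rotate.ne_top
    with rfl | rfl
  · exfalso
    -- The remaining alternative `uᶜ ≤ v` of `comparable_of_mem_line` is excluded by `x' ≤ uᶜ ≤ v ≤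
    -- x'ᶜ`.
    have comp : ∀ {l : Set (BoolPoint A)} {p q : BoolPoint A} {u v w y : A},
        l ∈ (orthogeometryOf A).lines → p ∈ l → q ∈ l → p ≠ q → u ∈ p.1 → v ∈ q.1 →
        Part3 u w x' → Part3 v y x' → u ≤ v ∨ v ≤ u ∨ u ≤ vᶜ := by
      intro l p q u v w y hl hp hq hpq hu hv h1 h2
      rcases comparable_of_mem_line hl hp hq hpq hu h1.ha h1.ne_top hv h2.ha h2.ne_top
        with e | e | e | e
      · exact Or.inl e
      · exact Or.inr (Or.inl e)
      · exact Or.inr (Or.inr e)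
      · exact absurd (eq_bot_of_le_compl (((le_compl_comm' h1.ac).trans e).trans h2.ac)) h1.hc
    have h' : Part3 b a x' := h.swap.rotate.rotate
    have k' : Part3 d c x' := k.swap.rotate.rotate
    have ne : ∀ {p q : BoolPoint A} {u v : A}, p ≠ q → u ∈ p.1 → v ∈ q.1 → u ≠ ⊥ → u ≠ ⊤ →
        u ≠ v := fun hpq hu hv h0 h1 e => hpq (BoolPoint.eq hu (e ▸ hv) h0 h1)
    exact h.false_of_comparable k (ne nac ha hc h.ha h.ne_top) (ne nad ha hd h.ha h.ne_top)
      (comp l3 (Or.inl rfl) (Or.inr (Or.inl rfl)) nac ha hc h k)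
      (comp l5 (Or.inl rfl) (Or.inr (Or.inl rfl)) nad ha hd h k')
      (comp l6 (Or.inl rfl) (Or.inr (Or.inl rfl)) nbc hb hc h' k)
      (comp l4 (Or.inl rfl) (Or.inr (Or.inl rfl)) nbd hb hd h' k')
  · have hP : Part4 a b c d := .of_part3 h.rotate.rotate k.rotate.rotate
    refine ⟨a, b, c, d, hP, ha, hb, hc, hd, ?_, ?_, ?_⟩
    · rw [← h.rotate.rotate.compl_eq]; exact px.2.1.compl_mem _ hx
    · have h3 := hP.swap.rotate.part3
      rw [← h3.rotate.rotate.compl_eq]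
      exact py.2.1.compl_mem _ (h3.mem_third ha hc nac nay ncy l3)
    · have h3 := hP.rotate.rotate.rotate.part3.swap.rotate.rotate
      rw [← h3.rotate.rotate.compl_eq]
      exact pz.2.1.compl_mem _ (h3.mem_third ha hd nad naz ndz l5)

/-- The planes are the Boolean subalgebras with sixteen elements. -/
theorem isPlane_iff_part4 {pa pb pc pd px py pz : BoolPoint A} :
    (orthogeometryOf A).IsPlane pa pb pc pd px py pz ↔
    ∃ a b c d, Part4 a b c d ∧ a ∈ pa.1 ∧ b ∈ pb.1 ∧ c ∈ pc.1 ∧ d ∈ pd.1 ∧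
      a ⊔ b ∈ px.1 ∧ a ⊔ c ∈ py.1 ∧ a ⊔ d ∈ pz.1 := by
  refine ⟨exists_part4_of_isPlane, ?_⟩
  rintro ⟨a, b, c, d, h, ha, hb, hc, hd, hx, hy, hz⟩
  have hP := h.isPartition
  have h0 := h.ne_bot
  -- Each point is encoded by a subset of `Fin 4`, so that distinctness and incidence become
  -- statements about finsets settled by `decide`.
  generalize he : ![a, b, c, d] = e at hP h0
  replace ha : ({0} : Finset (Fin 4)).sup e ∈ pa.1 := by simpa [← he] using ha
  replace hb : ({1} : Finset (Fin 4)).sup e ∈ pb.1 := by simpa [← he] using hb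
  replace hc : ({2} : Finset (Fin 4)).sup e ∈ pc.1 := by simpa [← he] using hc
  replace hd : ({3} : Finset (Fin 4)).sup e ∈ pd.1 := by simpa [← he] using hd
  replace hx : ({0, 1} : Finset (Fin 4)).sup e ∈ px.1 := by simpa [← he] using hx
  replace hy : ({0, 2} : Finset (Fin 4)).sup e ∈ py.1 := by simpa [← he] using hy
  replace hz : ({0, 3} : Finset (Fin 4)).sup e ∈ pz.1 := by simpa [← he] using hz
  have nbot : ∀ s : Finset (Fin 4), s ≠ ∅ → s.sup e ≠ ⊥ := fun s hs k =>
    hs (hP.sup_injective h0 (by simpa using k))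
  have ntop : ∀ s : Finset (Fin 4), s ≠ Finset.univ → s.sup e ≠ ⊤ := fun s hs k =>
    hs (hP.sup_injective h0 (by simpa [hP.sup_eq] using k))
  have ne : ∀ {s t : Finset (Fin 4)} {p q : BoolPoint A}, s.sup e ∈ p.1 → t.sup e ∈ q.1 →
      (s ≠ ∅ ∧ s ≠ Finset.univ ∧ t ≠ ∅ ∧ t ≠ Finset.univ ∧ t ≠ s ∧ t ≠ sᶜ) → p ≠ q := by
    rintro s t p _ hs ht ⟨s0, s1, t0, t1, h1, h2⟩ rfl
    rcases BoolPoint.mem_or hs (nbot s s0) (ntop s s1) ht (nbot t t0) (ntop t t1) with k | k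
    · exact h1 (hP.sup_injective h0 k)
    · exact h2 (hP.sup_injective h0 (k.trans (hP.compl_sup s)))
  have line : ∀ (s t r : Finset (Fin 4)) {p q o : BoolPoint A}, s.sup e ∈ p.1 → t.sup e ∈ q.1 →
      rᶜ.sup e ∈ o.1 → (s ≠ ∅ ∧ t ≠ ∅ ∧ r ≠ ∅ ∧ Disjoint s t ∧ Disjoint s r ∧ Disjoint t r ∧
        s ∪ t ∪ r = Finset.univ) → {p, q, o} ∈ (orthogeometryOf A).lines := by
    rintro s t r p q o hs ht hr ⟨s0, t0, r0, h1, h2, h3, h4⟩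
    have hr' : r.sup e ∈ o.1 := by
      rw [← compl_compl r, ← hP.compl_sup]; exact o.2.1.compl_mem _ hr
    have k : Part3 (s.sup e) (t.sup e) (r.sup e) := ⟨nbot s s0, nbot t t0, nbot r r0,
      hP.sup_orth h1, hP.sup_orth h2, hP.sup_orth h3,
      by rw [← Finset.sup_union, ← Finset.sup_union, h4, hP.sup_eq]⟩
    have hl := k.mem_lines
    rw [k.tri_eq hs ht hr'] at hl
    exact hl
  -- Crossing pairs such as `{0, 1}` and `{0, 2}` are incomparable even up to complements, which
  -- cannot happen for two points of a line.
  have noline : ∀ {s t : Finset (Fin 4)} {p q : BoolPoint A}, s.sup e ∈ p.1 → t.sup e ∈ q.1 →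
      (s ≠ ∅ ∧ s ≠ Finset.univ ∧ t ≠ ∅ ∧ t ≠ Finset.univ ∧ t ≠ s ∧ t ≠ sᶜ) →
      (¬ s ⊆ t ∧ ¬ t ⊆ s ∧ ¬ s ⊆ tᶜ ∧ ¬ sᶜ ⊆ t) →
      ∀ l ∈ (orthogeometryOf A).lines, ¬ (p ∈ l ∧ q ∈ l) := by
    rintro s t p q hs ht hd ⟨h1, h2, h3, h4⟩ l hl ⟨hp, hq⟩
    have hne := ne hs ht hd
    obtain ⟨s0, s1, t0, t1, -, -⟩ := hd
    rcases comparable_of_mem_line hl hp hq hne hs (nbot s s0) (ntop s s1) ht (nbot t t0)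
      (ntop t t1) with k | k | k | k
    · exact h1 ((hP.sup_le_sup_iff h0).1 k)
    · exact h2 ((hP.sup_le_sup_iff h0).1 k)
    · rw [hP.compl_sup] at k; exact h3 ((hP.sup_le_sup_iff h0).1 k)
    · rw [hP.compl_sup] at k; exact h4 ((hP.sup_le_sup_iff h0).1 k)
  refine PreOrthogeometry.isPlane_iff.2 ⟨PreOrthogeometry.nodup_seven.2
    ⟨⟨ne ha hb ?_, ne ha hc ?_, ne ha hd ?_, ne ha hx ?_, ne ha hy ?_, ne ha hz ?_⟩,
    ⟨ne hb hc ?_, ne hb hd ?_, ne hb hx ?_, ne hb hy ?_, ne hb hz ?_⟩,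
    ⟨ne hc hd ?_, ne hc hx ?_, ne hc hy ?_, ne hc hz ?_⟩, ⟨ne hd hx ?_, ne hd hy ?_, ne hd hz ?_⟩,
    ⟨ne hx hy ?_, ne hx hz ?_⟩, ne hy hz ?_⟩,
    ⟨line {0} {1} {2, 3} ha hb ?_ ?_, line {2} {3} {0, 1} hc hd ?_ ?_,
      line {0} {2} {1, 3} ha hc ?_ ?_, line {1} {3} {0, 2} hb hd ?_ ?_,
      line {0} {3} {1, 2} ha hd ?_ ?_, line {1} {2} {0, 3} hb hc ?_ ?_⟩,
    noline hx hy ?_ ?_, noline hx hz ?_ ?_, noline hy hz ?_ ?_⟩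
  all_goals first
    | decide
    | exact hx
    | exact hy
    | exact hz
    | exact hP.compl_sup _ ▸ px.2.1.compl_mem _ hx
    | exact hP.compl_sup _ ▸ py.2.1.compl_mem _ hy
    | exact hP.compl_sup _ ▸ pz.2.1.compl_mem _ hz

/-- In the plane with atoms `a, b, c, d`, the two lines through the point of `a ⊔ b` have there the
complementary atoms `c ⊔ d` and `a ⊔ b`. Conversely, lines with complementary atoms lie in the plane
given by `Part4.of_part3`. -/
theorem opposite_iff {p : BoolPoint A} {l m : Set (BoolPoint A)} :
    (orthogeometryOf A).Opposite p l m ↔ ∃ x ∈ p.1, Down x l ∧ Down xᶜ m := by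
  constructor
  · rintro ⟨pa, pb, pc, pd, py, pz, h, rfl, rfl⟩
    obtain ⟨a, b, c, d, k, ha, hb, hc, hd, hx, -, -⟩ := isPlane_iff_part4.1 h
    have h1 := k.part3
    have h2 := k.rotate.rotate.part3
    have h3 := h1.rotate.rotate
    have hx' := p.2.1.compl_mem _ hx
    rw [h3.compl_eq'] at hx'
    refine ⟨c ⊔ d, hx', ⟨a, b, h3, ?_⟩, c, d, ?_, ?_⟩
    · rw [tri_rotate, h1.tri_eq ha hb hx']; rfl
    · rw [h3.compl_eq]; exact h2.rotate.rotate
    · rw [h3.compl_eq, tri_rotate, h2.tri_eq hc hd hx]; rfl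
  · rintro ⟨x, hx, ⟨a, b, h, rfl⟩, ⟨c, d, h', rfl⟩⟩
    have k : Part4 a b c d := .of_part3 h h'
    have hxc := p.2.1.compl_mem x hx
    refine ⟨fourPoint a h.hb h.rotate.ne_top, fourPoint b h.hc h.rotate.rotate.ne_top,
      fourPoint c h'.hb h'.rotate.ne_top, fourPoint d h'.hc h'.rotate.rotate.ne_top,
      fourPoint (a ⊔ c) (fun e => h.hb (sup_eq_bot_iff.1 e).1) ?_,
      fourPoint (a ⊔ d) (fun e => h.hb (sup_eq_bot_iff.1 e).1) ?_,
      isPlane_iff_part4.2 ⟨a, b, c, d, k, ?_⟩, ?_, ?_⟩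
    · have h3 := k.swap.rotate.part3.rotate.rotate
      exact fun e => h3.ha (by rw [← h3.compl_eq', e, compl_top'])
    · have h3 := k.rotate.rotate.rotate.part3.swap.rotate
      exact fun e => h3.swap.ha (by rw [← h3.swap.compl_eq', sup_comm, e, compl_top'])
    · refine ⟨mem_fourPoint _ _ _, mem_fourPoint _ _ _, mem_fourPoint _ _ _, mem_fourPoint _ _ _,
        ?_, mem_fourPoint _ _ _, mem_fourPoint _ _ _⟩
      rwa [← h.compl_eq]
    · rw [tri_rotate]
      exact h.rotate.tri_eq (mem_fourPoint _ _ _) (mem_fourPoint _ _ _) hx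
    · rw [tri_rotate]
      exact h'.rotate.tri_eq (mem_fourPoint _ _ _) (mem_fourPoint _ _ _) hxc

end Planes

/-! ### Directions -/

namespace PreOrthogeometry

variable {G H : PreOrthogeometry.{u}}

theorem Direction.ext_of_val {d e : G.Direction} (h : d.point = e.point)
    (hv : ∀ l hl hd he, d.val ⟨l, hl, hd⟩ = e.val ⟨l, hl, he⟩)
    (hs : ∀ h h', d.sign h = e.sign h') : d = e := by
  obtain ⟨p, v, s, hvs⟩ := d
  obtain ⟨p', v', s', hvs'⟩ := e
  obtain rfl : p = p' := h
  obtain rfl : v = v' := funext fun ⟨l, hl, hp⟩ => hv l hl hp hp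
  obtain rfl : s = s' := funext fun h => hs h h
  rfl

theorem Direction.val_congr {d e : G.Direction} (h : d = e) {l : Set G.Point} (hd he) :
    d.val ⟨l, hd⟩ = e.val ⟨l, he⟩ := by
  subst h; rfl

theorem Direction.sign_congr {d e : G.Direction} (h : d = e) (hd he) :
    d.sign hd = e.sign he := by
  subst h; rfl

/-- As there are only two arrows, a value at one line together with the opposition relation
determines the values at all lines through the point. -/
theorem Arrow.eq_of_ne_iff {a b c d : Arrow} (h : a = c) (k : a ≠ b ↔ c ≠ d) : b = d := by
  cases a <;> cases b <;> cases c <;> cases d <;> simp_all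

/-- A direction for a point on some line is determined by its value at this line. -/
theorem Direction.ext_of_line {d e : G.Direction} (h : d.point = e.point) {l : Set G.Point} (hd he)
    (hv : d.val ⟨l, hd⟩ = e.val ⟨l, he⟩) : d = e := by
  refine ext_of_val h (fun m hm hmd hme => Arrow.eq_of_ne_iff hv ?_)
    fun hs => absurd hd.2 (hs l hd.1)
  have : G.Opposite d.point l m ↔ G.Opposite e.point l m := by rw [h]
  exact (d.val_ne_iff ⟨l, hd⟩ ⟨m, hm, hmd⟩).trans
    (this.trans (e.val_ne_iff ⟨l, he⟩ ⟨m, hm, hme⟩).symm)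

theorem Arrow.ite_eq_iff {P Q : Prop} [Decidable P] [Decidable Q] :
    (if P then Arrow.down else .up) = (if Q then Arrow.down else .up) ↔ (P ↔ Q) := by
  split_ifs <;> simp_all

/-! ### Isomorphisms -/

namespace Iso

/-- The inverse isomorphism. -/
def symm (e : G.Iso H) : H.Iso G where
  equiv := e.equiv.symm
  mem_lines_iff l := by rw [e.mem_lines_iff, Equiv.image_symm_image]

theorem isPlane (e : G.Iso H) {a b c d x y z : G.Point} (h : G.IsPlane a b c d x y z) :
    H.IsPlane (e.equiv a) (e.equiv b) (e.equiv c) (e.equiv d) (e.equiv x) (e.equiv y)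
      (e.equiv z) := by
  obtain ⟨h1, ⟨l1, l2, l3, l4, l5, l6⟩, n1, n2, n3⟩ := isPlane_iff.1 h
  have line : ∀ {p q r : G.Point}, {p, q, r} ∈ G.lines →
      {e.equiv p, e.equiv q, e.equiv r} ∈ H.lines := fun hl => by
    rw [e.mem_lines_iff] at hl
    simpa [Set.image_insert_eq] using hl
  have no : ∀ {p q : G.Point}, (∀ l ∈ G.lines, ¬ (p ∈ l ∧ q ∈ l)) →
      ∀ l ∈ H.lines, ¬ (e.equiv p ∈ l ∧ e.equiv q ∈ l) := fun h l hl k =>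
    h (e.symm.equiv '' l) ((e.symm.mem_lines_iff l).1 hl)
      ⟨⟨_, k.1, e.equiv.symm_apply_apply _⟩, ⟨_, k.2, e.equiv.symm_apply_apply _⟩⟩
  exact isPlane_iff.2 ⟨(List.nodup_map_iff e.equiv.injective).2 h1,
    ⟨line l1, line l2, line l3, line l4, line l5, line l6⟩, no n1, no n2, no n3⟩

theorem opposite (e : G.Iso H) {p : G.Point} {l m : Set G.Point} (h : G.Opposite p l m) :
    H.Opposite (e.equiv p) (e.equiv '' l) (e.equiv '' m) := by
  obtain ⟨a, b, c, d, y, z, h, rfl, rfl⟩ := h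
  exact ⟨_, _, _, _, _, _, e.isPlane h, by simp [Set.image_insert_eq],
    by simp [Set.image_insert_eq]⟩

theorem opposite_iff (e : G.Iso H) {p : G.Point} {l m : Set G.Point} :
    H.Opposite (e.equiv p) (e.equiv '' l) (e.equiv '' m) ↔ G.Opposite p l m := by
  refine ⟨fun h => ?_, e.opposite⟩
  have := e.symm.opposite h
  simpa [symm, Set.image_image] using this

theorem img_eq (e : G.Iso H) (l : Set G.Point) :
    img (fun p => some (e.equiv p)) l = e.equiv '' l := by
  ext q
  exact ⟨fun ⟨p, hp, h⟩ => ⟨p, hp, Option.some.inj h⟩, fun ⟨p, hp, h⟩ => ⟨p, hp, congrArg some h⟩⟩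

theorem isMorphism (e : G.Iso H) : IsMorphism fun p => some (e.equiv p) where
  line l hl := Or.inr (Or.inr ⟨fun p _ => ⟨_, rfl⟩, by rw [img_eq]; exact (e.mem_lines_iff l).1 hl⟩)
  plane := by
    rintro a b c d x y z h a' b' c' d' ⟨⟩ ⟨⟩ ⟨⟩ ⟨⟩
    exact ⟨_, _, _, rfl, rfl, rfl, e.isPlane h⟩
  opposite := by
    rintro p p' ⟨⟩ l _ m _ _ _ h
    rw [img_eq, img_eq] at h
    exact e.opposite_iff.1 h

/-- The image of a direction under an isomorphism. -/
def mapDirection (e : G.Iso H) (d : G.Direction) : H.Direction where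
  point := e.equiv d.point
  val l := d.val ⟨e.symm.equiv '' l.1, (e.symm.mem_lines_iff _).1 l.2.1,
    ⟨_, l.2.2, e.equiv.symm_apply_apply _⟩⟩
  sign h := d.sign fun l hl hd => h _ ((e.mem_lines_iff l).1 hl) ⟨_, hd, rfl⟩
  val_ne_iff l m := by
    rw [d.val_ne_iff, ← e.opposite_iff]
    simp [symm, Set.image_image]

/-- The map of directions given by an isomorphism. -/
def mapDir (e : G.Iso H) : G.Dir → H.Dir
  | .zero => .zero
  | .one => .one
  | .of d => .of (e.mapDirection d)

theorem mapDirection_symm (e : G.Iso H) (d : G.Direction) :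
    e.symm.mapDirection (e.mapDirection d) = d := by
  refine Direction.ext_of_val (e.equiv.symm_apply_apply _) (fun l hl hd he => ?_) fun _ _ => rfl
  refine congrArg d.val (Subtype.ext ?_)
  simp [symm, Set.image_image]

theorem mapDir_symm (e : G.Iso H) (d : G.Dir) : e.symm.mapDir (e.mapDir d) = d := by
  cases d with
  | zero => rfl
  | one => rfl
  | of d => exact congrArg Dir.of (e.mapDirection_symm d)

theorem mapDir_mono (e : G.Iso H) {d d' : G.Dir} (h : d ≤ d') : e.mapDir d ≤ e.mapDir d' := by
  cases d with
  | zero => trivial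
  | one => cases d' with
    | zero => exact h
    | one => trivial
    | of d => exact h
  | of d => cases d' with
    | zero => exact h
    | one => trivial
    | of d' =>
      rcases h with rfl | ⟨l, hl, hd, he, hne, h1, h2⟩
      · exact Or.inl rfl
      · refine Or.inr ⟨e.equiv '' l, (e.mem_lines_iff l).1 hl, ⟨_, hd, rfl⟩, ⟨_, he, rfl⟩,
          fun k => hne (e.equiv.injective k), ?_, ?_⟩
        · rw [← h1]
          refine congrArg d.val (Subtype.ext ?_)
          simp [symm, Set.image_image]
        · rw [← h2]
          refine congrArg d'.val (Subtype.ext ?_)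
          simp [symm, Set.image_image]

/-- The order isomorphism of directions given by an isomorphism. -/
def dirIso (e : G.Iso H) : G.Dir ≃o H.Dir where
  toFun := e.mapDir
  invFun := e.symm.mapDir
  left_inv := e.mapDir_symm
  right_inv := e.symm.mapDir_symm
  map_rel_iff' := by
    intro a b
    refine ⟨fun h => ?_, e.mapDir_mono⟩
    have : e.symm.mapDir (e.mapDir a) ≤ e.symm.mapDir (e.mapDir b) := e.symm.mapDir_mono h
    rwa [e.mapDir_symm, e.mapDir_symm] at this

end Iso

/-- Stated for a bare `LE`, because the relation on the directions of an arbitrary pre-orthogeometry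
is not known to be a preorder. -/
theorem isLUB_image_orderIso {α β : Type*} [LE α] [LE β] (e : α ≃o β) {s : Set α} {a : α} :
    IsLUB (e '' s) (e a) ↔ IsLUB s a := by
  constructor
  · refine fun h => ⟨fun x hx => e.le_iff_le.1 (h.1 ⟨x, hx, rfl⟩), fun x hx => ?_⟩
    refine e.le_iff_le.1 (h.2 ?_)
    rintro _ ⟨y, hy, rfl⟩
    exact e.le_iff_le.2 (hx hy)
  · refine fun h => ⟨?_, fun x hx => ?_⟩
    · rintro _ ⟨y, hy, rfl⟩
      exact e.le_iff_le.2 (h.1 hy)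
    · rw [← e.apply_symm_apply x, e.le_iff_le]
      refine h.2 fun y hy => ?_
      rw [← e.le_iff_le, e.apply_symm_apply]
      exact hx ⟨y, hy, rfl⟩

theorem Iso.preservesJoins (e : G.Iso H) : PreservesJoins fun p => some (e.equiv p) := by
  refine ⟨e.dirIso, ⟨rfl, rfl, ?_, ?_⟩, fun D d h => (isLUB_image_orderIso e.dirIso).2 h⟩
  · rintro d q ⟨⟩
    refine ⟨e.mapDirection d, rfl, rfl, fun l h h' => ?_⟩
    refine congrArg d.val (Subtype.ext ?_)
    simp [img_eq, symm, Set.image_image]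
  · rintro d ⟨⟩

end PreOrthogeometry

/-! ### Recovering the order of a lattice from its directions -/

section DirectionsOfOML

variable {A B : Type u} [CompleteOML A] [CompleteOML B]

open CompleteOML PreOrthogeometry

/-- A chosen nontrivial element of a point. -/
noncomputable def BoolPoint.rep (p : BoolPoint A) : A :=
  (IsBooleanSub.exists_four p.2.2).choose

theorem BoolPoint.rep_mem (p : BoolPoint A) : p.rep ∈ p.1 :=
  (IsBooleanSub.exists_four p.2.2).choose_spec.1

theorem BoolPoint.rep_ne_bot (p : BoolPoint A) : p.rep ≠ ⊥ :=
  (IsBooleanSub.exists_four p.2.2).choose_spec.2.1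

theorem BoolPoint.rep_ne_top (p : BoolPoint A) : p.rep ≠ ⊤ :=
  (IsBooleanSub.exists_four p.2.2).choose_spec.2.2

open Classical in
/-- The direction given by a nontrivial element: it is `↓` at the lines of which this element is an
atom. -/
noncomputable def dirOf (x : A) (h0 : x ≠ ⊥) (h1 : x ≠ ⊤) : (orthogeometryOf A).Direction where
  point := fourPoint x h0 h1
  val l := if Down x l.1 then .down else .up
  -- At a point on no line only the sign separates `x` from `xᶜ`; the chosen representative of the
  -- point decides arbitrarily which of them is `↓`.
  sign _ := if x = (fourPoint x h0 h1).rep then .down else .up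
  val_ne_iff := by
    rintro ⟨l, hl, hp⟩ ⟨m, hm, hq⟩
    have hx := mem_fourPoint x h0 h1
    have hl' := down_or_down_compl hl hp hx h0 h1
    have hm' := down_or_down_compl hm hq hx h0 h1
    have key : (∃ y ∈ (fourPoint x h0 h1).1, Down y l ∧ Down yᶜ m) ↔
        (Down x l ∧ Down xᶜ m) ∨ (Down xᶜ l ∧ Down x m) := by
      constructor
      · rintro ⟨y, hy, k1, k2⟩
        rcases BoolPoint.mem_or hx h0 h1 hy k1.ne_bot k1.ne_top with rfl | rfl
        · exact Or.inl ⟨k1, k2⟩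
        · rw [compl_compl'] at k2; exact Or.inr ⟨k1, k2⟩
      · rintro (⟨k1, k2⟩ | ⟨k1, k2⟩)
        · exact ⟨x, hx, k1, k2⟩
        · exact ⟨xᶜ, (fourPoint x h0 h1).2.1.compl_mem _ hx, k1, by rwa [compl_compl']⟩
    refine Arrow.ite_eq_iff.not.trans (Iff.trans ?_ (key.symm.trans opposite_iff.symm))
    have n1 : Down x l → ¬ Down xᶜ l := Down.not_compl
    have n2 : Down x m → ¬ Down xᶜ m := Down.not_compl
    change ¬ (Down x l ↔ Down x m) ↔ _
    tauto

theorem dirOf_val_eq_down {x : A} {h0 : x ≠ ⊥} {h1 : x ≠ ⊤} {l : Set (BoolPoint A)} (h) :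
    (dirOf x h0 h1).val ⟨l, h⟩ = .down ↔ Down x l := by
  classical
  change (if Down x l then Arrow.down else Arrow.up) = _ ↔ _
  split_ifs with k <;> simp [k]

theorem dirOf_val_eq_up {x : A} {h0 : x ≠ ⊥} {h1 : x ≠ ⊤} {l : Set (BoolPoint A)} (h) :
    (dirOf x h0 h1).val ⟨l, h⟩ = .up ↔ Down xᶜ l := by
  have h2 := down_or_down_compl h.1 h.2 (mem_fourPoint x h0 h1) h0 h1
  have h3 : Down x l → ¬ Down xᶜ l := Down.not_compl
  classical
  change (if Down x l then Arrow.down else Arrow.up) = _ ↔ _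
  split_ifs with k <;> simp <;> tauto

open Classical in
-- Equal directions have the same point, which leaves only `y = xᶜ` to exclude. The values at a line
-- through the point do so and, if there is no such line, the signs do, since exactly one of `x`,
-- `xᶜ` is the representative.
theorem eq_of_dirOf_eq {x y : A} {h0 : x ≠ ⊥} {h1 : x ≠ ⊤} {k0 : y ≠ ⊥} {k1 : y ≠ ⊤}
    (h : dirOf x h0 h1 = dirOf y k0 k1) : x = y := by
  have hp : fourPoint x h0 h1 = fourPoint y k0 k1 := congrArg Direction.point h
  have hy : y ∈ (fourPoint x h0 h1).1 := hp ▸ mem_fourPoint y k0 k1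
  rcases BoolPoint.mem_or (mem_fourPoint x h0 h1) h0 h1 hy k0 k1 with e | e
  · exact e.symm
  exfalso
  by_cases hl : ∃ l ∈ (orthogeometryOf A).lines, fourPoint x h0 h1 ∈ l
  · obtain ⟨l, hl, hx⟩ := hl
    have hv := Direction.val_congr h ⟨hl, hx⟩ ⟨hl, Set.mem_of_eq_of_mem hp.symm hx⟩
    rcases down_or_down_compl hl hx (mem_fourPoint x h0 h1) h0 h1 with k | k
    · exact k.not_compl (e ▸ (dirOf_val_eq_down _).1 (hv.symm.trans ((dirOf_val_eq_down _).2 k)))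
    · exact k.not_compl (e ▸ (dirOf_val_eq_up _).1 (hv.symm.trans ((dirOf_val_eq_up _).2 k)))
  · push Not at hl
    have hs := Direction.sign_congr h hl
      fun l hl' w => hl l hl' (Set.mem_of_eq_of_mem hp w)
    have hr : x = (fourPoint x h0 h1).rep ↔ y = (fourPoint y k0 k1).rep := Arrow.ite_eq_iff.1 hs
    rw [← hp] at hr
    have hne : y ≠ x := e ▸ compl_ne_self h0
    rcases BoolPoint.mem_or (mem_fourPoint x h0 h1) h0 h1 (fourPoint x h0 h1).rep_mem
      (BoolPoint.rep_ne_bot _) (BoolPoint.rep_ne_top _) with w | w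
    · exact hne ((hr.1 w.symm).trans w)
    · rw [← e] at w
      exact hne (w.symm.trans (hr.2 w.symm).symm)

/-- A direction is fixed by a single arrow, its value at any one line or its sign if there is no
line; the two nontrivial elements of the point realise both arrows. -/
theorem exists_dirOf_eq (d : (orthogeometryOf A).Direction) : ∃ x h0 h1, dirOf x h0 h1 = d := by
  obtain ⟨p, hp⟩ : ∃ p : BoolPoint A, p = d.point := ⟨_, rfl⟩
  have h0 := p.rep_ne_bot
  have h1 := p.rep_ne_top
  have k0 := compl_ne_bot h1
  have k1 := compl_ne_top h0
  have e1 : fourPoint p.rep h0 h1 = p := BoolPoint.eq (mem_fourPoint _ _ _) p.rep_mem h0 h1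
  have e2 : fourPoint p.repᶜ k0 k1 = p :=
    BoolPoint.eq (mem_fourPoint _ _ _) (p.2.1.compl_mem _ p.rep_mem) k0 k1
  by_cases hl : ∃ l ∈ (orthogeometryOf A).lines, d.point ∈ l
  · obtain ⟨l, hl, hx⟩ := hl
    have m0 : p ∈ l := Set.mem_of_eq_of_mem hp hx
    have m1 : fourPoint p.rep h0 h1 ∈ l := Set.mem_of_eq_of_mem e1 m0
    have m2 : fourPoint p.repᶜ k0 k1 ∈ l := Set.mem_of_eq_of_mem e2 m0
    have hd := down_or_down_compl hl m0 p.rep_mem h0 h1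
    cases hv : d.val ⟨l, hl, hx⟩ with
    | down =>
      rcases hd with k | k
      · exact ⟨_, h0, h1, Direction.ext_of_line (e1.trans hp) ⟨hl, m1⟩ ⟨hl, hx⟩
          (((dirOf_val_eq_down _).2 k).trans hv.symm)⟩
      · exact ⟨_, k0, k1, Direction.ext_of_line (e2.trans hp) ⟨hl, m2⟩ ⟨hl, hx⟩
          (((dirOf_val_eq_down _).2 k).trans hv.symm)⟩
    | up =>
      rcases hd with k | k
      · exact ⟨_, k0, k1, Direction.ext_of_line (e2.trans hp) ⟨hl, m2⟩ ⟨hl, hx⟩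
          (((dirOf_val_eq_up _).2 (by rwa [compl_compl'])).trans hv.symm)⟩
      · exact ⟨_, h0, h1, Direction.ext_of_line (e1.trans hp) ⟨hl, m1⟩ ⟨hl, hx⟩
          (((dirOf_val_eq_up _).2 k).trans hv.symm)⟩
  · push Not at hl
    cases hv : d.sign hl with
    | down =>
      refine ⟨_, h0, h1, Direction.ext_of_val (e1.trans hp) (fun l k _ w => absurd w (hl l k))
        fun w w' => ?_⟩
      exact (if_pos (congrArg BoolPoint.rep e1).symm).trans hv.symm
    | up =>
      refine ⟨_, k0, k1, Direction.ext_of_val (e2.trans hp) (fun l k _ w => absurd w (hl l k))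
        fun w w' => ?_⟩
      exact (if_neg fun e => compl_ne_self h0 (e.trans (congrArg BoolPoint.rep e2))).trans hv.symm

open Classical in
/-- The direction or constant given by an element. -/
noncomputable def toDir (x : A) : (orthogeometryOf A).Dir :=
  if h0 : x = ⊥ then .zero else if h1 : x = ⊤ then .one else .of (dirOf x h0 h1)

theorem toDir_bot : toDir (⊥ : A) = .zero := by simp [toDir]

theorem toDir_top (h : (⊥ : A) ≠ ⊤) : toDir (⊤ : A) = .one := by simp [toDir, h.symm]

theorem toDir_of {x : A} (h0 : x ≠ ⊥) (h1 : x ≠ ⊤) : toDir x = .of (dirOf x h0 h1) := by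
  simp [toDir, h0, h1]

/-- The arrows `↓` for `x` and `↑` for `y` at a common line say that `x` and `yᶜ` are atoms of it,
and distinct atoms are orthogonal. Conversely, `x < y` produces the line with atoms `x`, `yᶜ`, `xᶜ ⊓
y`. -/
theorem dirOf_le_iff {x y : A} {h0 : x ≠ ⊥} {h1 : x ≠ ⊤} {k0 : y ≠ ⊥} {k1 : y ≠ ⊤} :
    (Dir.of (dirOf x h0 h1) : (orthogeometryOf A).Dir) ≤ .of (dirOf y k0 k1) ↔ x ≤ y := by
  constructor
  · rintro (h | ⟨l, hl, hd, he, hne, k, k'⟩)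
    · exact (eq_of_dirOf_eq h).le
    · replace k := (dirOf_val_eq_down _).1 k
      replace k' := (dirOf_val_eq_up _).1 k'
      have := k.orthogonal k' fun e => hne (BoolPoint.eq (mem_fourPoint x h0 h1)
        (e ▸ (fourPoint y k0 k1).2.1.compl_mem _ (mem_fourPoint y k0 k1)) h0 h1)
      rwa [compl_compl'] at this
  · intro h
    rcases h.eq_or_lt with rfl | h
    · exact Or.inl rfl
    · have hP := Part3.of_lt h0 k1 h
      have hy : yᶜ ∈ (fourPoint y k0 k1).1 :=
        (fourPoint y k0 k1).2.1.compl_mem _ (mem_fourPoint y k0 k1)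
      refine Or.inr ⟨tri x yᶜ (xᶜ ⊓ y), hP.mem_lines, Or.inl (mem_fourPoint x h0 h1),
        Or.inr (Or.inl hy), fun e => ?_, (dirOf_val_eq_down _).2 ⟨_, _, hP, rfl⟩,
        (dirOf_val_eq_up _).2 ⟨_, _, hP.rotate, tri_rotate _ _ _⟩⟩
      have e' : fourPoint x h0 h1 = fourPoint y k0 k1 := e
      rcases BoolPoint.mem_or (mem_fourPoint x h0 h1) h0 h1 (e' ▸ mem_fourPoint y k0 k1) k0 k1
        with w | w
      · exact h.ne' w
      · exact h0 (eq_bot_of_le_compl (h.le.trans_eq w))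

theorem toDir_le_iff (h : (⊥ : A) ≠ ⊤) {x y : A} : toDir x ≤ toDir y ↔ x ≤ y := by
  by_cases x0 : x = ⊥
  · subst x0; rw [toDir_bot]; exact iff_of_true trivial bot_le
  by_cases y1 : y = ⊤
  · subst y1
    refine iff_of_true ?_ le_top
    rw [toDir_top h]
    cases toDir x <;> trivial
  by_cases x1 : x = ⊤
  · subst x1
    refine iff_of_false (fun k => ?_) fun k => y1 (top_le_iff.1 k)
    rw [toDir_top h] at k
    by_cases y0 : y = ⊥
    · rw [y0, toDir_bot] at k; exact k
    · rw [toDir_of y0 y1] at k; exact k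
  by_cases y0 : y = ⊥
  · subst y0
    refine iff_of_false (fun k => ?_) fun k => x0 (le_bot_iff.1 k)
    rw [toDir_bot, toDir_of x0 x1] at k; exact k
  rw [toDir_of x0 x1, toDir_of y0 y1, dirOf_le_iff]

theorem toDir_surjective (h : (⊥ : A) ≠ ⊤) : Function.Surjective (toDir (A := A)) := by
  intro d
  cases d with
  | zero => exact ⟨⊥, toDir_bot⟩
  | one => exact ⟨⊤, toDir_top h⟩
  | of d =>
    obtain ⟨x, h0, h1, rfl⟩ := exists_dirOf_eq d
    exact ⟨x, toDir_of h0 h1⟩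

/-- A nontrivial complete orthomodular lattice is isomorphic to the poset of the directions of its
orthogeometry. -/
noncomputable def toDirIso (h : (⊥ : A) ≠ ⊤) : A ≃o (orthogeometryOf A).Dir where
  toEquiv := Equiv.ofBijective toDir ⟨fun _ _ e => le_antisymm ((toDir_le_iff h).1 (by
    rw [e]; exact (toDir_le_iff h).2 le_rfl)) ((toDir_le_iff h).1 (by
    rw [e]; exact (toDir_le_iff h).2 le_rfl)), toDir_surjective h⟩
  map_rel_iff' := toDir_le_iff h

theorem exists_direction (p : BoolPoint A) :
    ∃ d : (orthogeometryOf A).Direction, d.point = p :=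
  ⟨dirOf p.rep p.rep_ne_bot p.rep_ne_top, BoolPoint.eq (mem_fourPoint _ p.rep_ne_bot p.rep_ne_top)
    p.rep_mem p.rep_ne_bot p.rep_ne_top⟩

end DirectionsOfOML

/-! ### Morphisms of orthogeometries and maps of directions -/

namespace PreOrthogeometry

variable {G H : PreOrthogeometry.{u}} {α : G.Point → Option H.Point}

theorem IsMorphism.defined (hα : IsMorphism α) {l : Set G.Point} (hl : l ∈ G.lines)
    (h : img α l ∈ H.lines) : ∀ p ∈ l, ∃ s, α p = some s :=
  (hα.line_of_nontrivial (fun q => some q) hl (by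
    rw [img_some]; exact nontrivial_line h)).1

/-- Of the three ways to map a line, a definite value at `p` rules out the first, and in the second
that value would be the whole image. -/
theorem IsMorphism.img_mem_lines (hα : IsMorphism α) {l : Set G.Point} (hl : l ∈ G.lines)
    {p : G.Point} {q : H.Point} (hp : p ∈ l) (hq : α p = some q) (h : img α {p} ⊂ img α l) :
    img α l ∈ H.lines := by
  rcases hα.line l hl with k | ⟨t, ht, s, hts, k⟩ | k
  · rw [k p hp] at hq; cases hq
  · exfalso
    have hpt : p ≠ t := fun e => by rw [e, hts] at hq; cases hq
    have hqs : some q = some s := by rw [← hq, k p hp hpt]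
    refine h.2 ?_
    rintro r ⟨o, ho, hor⟩
    have hot : o ≠ t := fun e => by rw [e, hts] at hor; cases hor
    exact ⟨p, rfl, by rw [hq, hqs, ← k o ho hot, hor]⟩
  · exact k.2

/-- Reflection of opposition is part of the definition. For preservation, both lines are mapped onto
lines, so `α` is defined at the four vertices of the plane they span, and the plane condition
applies. -/
theorem IsMorphism.opposite_img_iff (hα : IsMorphism α) {p : G.Point} {q : H.Point}
    (hq : α p = some q) {l m : Set G.Point} (hl : l ∈ G.lines) (hm : m ∈ G.lines) (hpl : p ∈ l)
    (hpm : p ∈ m) (hl' : img α l ∈ H.lines) (hm' : img α m ∈ H.lines) :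
    H.Opposite q (img α l) (img α m) ↔ G.Opposite p l m := by
  refine ⟨hα.opposite p q hq l hl m hm hpl hpm, ?_⟩
  rintro ⟨a, b, c, d, y, z, hw, rfl, rfl⟩
  obtain ⟨a', ha⟩ := hα.defined hl hl' a (by simp)
  obtain ⟨b', hb⟩ := hα.defined hl hl' b (by simp)
  obtain ⟨c', hc⟩ := hα.defined hm hm' c (by simp)
  obtain ⟨d', hd⟩ := hα.defined hm hm' d (by simp)
  obtain ⟨x', y', z', hx, -, -, hw'⟩ := hα.plane _ _ _ _ _ _ _ hw _ _ _ _ ha hb hc hd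
  obtain rfl : q = x' := Option.some.inj (hq.symm.trans hx)
  refine ⟨a', b', c', d', y', z', hw', ?_, ?_⟩
  · ext r; simp [img, ha, hb, hq, eq_comm]
  · ext r; simp [img, hc, hd, hq, eq_comm]

/-- With `α` undefined at `p`, a line through `p` with nonempty image has `α` defined at its other
points. Two opposite lines of this kind would supply the four vertices of a plane, forcing `α p` to
be defined. This makes the choice between `0` and `1` for an induced map consistent. -/
theorem IsMorphism.not_opposite (hα : IsMorphism α) {p : G.Point} (hp : α p = none)
    {l m : Set G.Point} (hl' : (img α l).Nonempty) (hm' : (img α m).Nonempty) :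
    ¬ G.Opposite p l m := by
  intro h
  have hlm := h.mem_lines
  have key : ∀ l ∈ G.lines, p ∈ l → (img α l).Nonempty → ∀ q ∈ l, q ≠ p → ∃ s, α q = some s := by
    rintro l hl hpl ⟨r, o, ho, hr⟩ q hq hqp
    rcases hα.line l hl with k | ⟨t, ht, s, hts, k⟩ | k
    · rw [k o ho] at hr; cases hr
    · by_cases e : p = t
      · exact ⟨s, k q hq (e ▸ hqp)⟩
      · rw [k p hpl e] at hp; cases hp
    · exact k.1 q hq
  obtain ⟨a, b, c, d, y, z, hw, rfl, rfl⟩ := h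
  obtain ⟨⟨-, -, -, nap, -, -⟩, ⟨-, -, nbp, -, -⟩, ⟨-, ncp, -, -⟩, ⟨ndp, -, -⟩, -, -⟩ :=
    nodup_seven.1 hw.1
  obtain ⟨a', ha⟩ := key _ hlm.1 (by simp) hl' a (by simp) nap
  obtain ⟨b', hb⟩ := key _ hlm.1 (by simp) hl' b (by simp) nbp
  obtain ⟨c', hc⟩ := key _ hlm.2 (by simp) hm' c (by simp) ncp
  obtain ⟨d', hd⟩ := key _ hlm.2 (by simp) hm' d (by simp) ndp
  obtain ⟨x', y', z', hx, -⟩ := hα.plane _ _ _ _ _ _ _ hw _ _ _ _ ha hb hc hd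
  rw [hp] at hx; cases hx

/-- Properness provides a line through the point of `d` with larger image. The arrow of `d` at it
prescribes one value of the image direction, hence all of it, or selects `0` or `1`. -/
theorem IsDirMap.unique (hα : IsMorphism α) (hp : IsProper α) {F F' : G.Dir → H.Dir}
    (hF : IsDirMap α F) (hF' : IsDirMap α F') : F = F' := by
  funext d
  cases d with
  | zero => rw [hF.zero, hF'.zero]
  | one => rw [hF.one, hF'.one]
  | of d =>
    obtain ⟨l, hl, hdl, hlt⟩ := hp.point d.point
    cases hq : α d.point with
    | some q =>
      obtain ⟨e, he, rfl, hev⟩ := hF.of_some d q hq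
      obtain ⟨e', he', hpt, hev'⟩ := hF'.of_some d _ hq
      rw [he, he']
      have hl' := hα.img_mem_lines hl hdl hq hlt
      have hm : e.point ∈ img α l := ⟨_, hdl, hq⟩
      have hm' : e'.point ∈ img α l := hpt ▸ hm
      exact congrArg Dir.of (Direction.ext_of_line hpt.symm ⟨hl', hm⟩ ⟨hl', hm'⟩
        ((hev l ⟨hl, hdl⟩ ⟨hl', hm⟩).trans (hev' l ⟨hl, hdl⟩ ⟨hl', hm'⟩).symm))
    | none =>
      obtain ⟨q, hql, -⟩ := Set.exists_of_ssubset hlt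
      obtain ⟨h1, h2⟩ := (hF.of_none d hq).2 l ⟨hl, hdl⟩ ⟨q, hql⟩
      obtain ⟨h3, h4⟩ := (hF'.of_none d hq).2 l ⟨hl, hdl⟩ ⟨q, hql⟩
      cases hv : d.val ⟨l, hl, hdl⟩ with
      | down => rw [h1 hv, h3 hv]
      | up => rw [h2 hv, h4 hv]

/-- The opposite arrow. -/
def Arrow.flip : Arrow → Arrow
  | .up => .down
  | .down => .up

/-- The opposite direction for the same point. -/
def Direction.flip (d : G.Direction) : G.Direction where
  point := d.point
  val l := (d.val l).flip
  sign h := (d.sign h).flip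
  val_ne_iff l m := by
    rw [← d.val_ne_iff]
    cases d.val l <;> cases d.val m <;> simp [Arrow.flip]

/-- The image direction is read off from one line with larger image: take any direction of the image
point and flip it if its arrow there is wrong. Preservation and reflection of opposition give
agreement at all other lines mapped to lines. If `α` is undefined at the point, all lines with
nonempty image carry the same arrow. -/
theorem exists_isDirMap (hα : IsMorphism α) (hp : IsProper α)
    (hH : ∀ q : H.Point, ∃ e : H.Direction, e.point = q) : ∃ F, IsDirMap α F := by
  have key : ∀ d : G.Direction, ∃ D : H.Dir,
      (∀ q, α d.point = some q → ∃ e : H.Direction, D = .of e ∧ e.point = q ∧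
        ∀ l h (h' : img α l ∈ H.lines ∧ e.point ∈ img α l), e.val ⟨img α l, h'⟩ = d.val ⟨l, h⟩) ∧
      (α d.point = none → (D = .zero ∨ D = .one) ∧
        ∀ l h, (img α l).Nonempty → (d.val ⟨l, h⟩ = Arrow.down → D = .zero) ∧
          (d.val ⟨l, h⟩ = Arrow.up → D = .one)) := by
    intro d
    obtain ⟨l, hl, hdl, hlt⟩ := hp.point d.point
    cases hq : α d.point with
    | some q =>
      have hl' := hα.img_mem_lines hl hdl hq hlt
      have hm : q ∈ img α l := ⟨_, hdl, hq⟩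
      obtain ⟨e, hpt, hv⟩ : ∃ e : H.Direction, ∃ hpt : e.point = q,
          e.val ⟨img α l, hl', hpt ▸ hm⟩ = d.val ⟨l, hl, hdl⟩ := by
        obtain ⟨e, rfl⟩ := hH q
        by_cases hv : e.val ⟨img α l, hl', hm⟩ = d.val ⟨l, hl, hdl⟩
        · exact ⟨e, rfl, hv⟩
        · refine ⟨e.flip, rfl, ?_⟩
          change (e.val ⟨img α l, hl', hm⟩).flip = _
          cases h1 : e.val ⟨img α l, hl', hm⟩ <;> cases h2 : d.val ⟨l, hl, hdl⟩ <;>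
            simp_all [Arrow.flip]
      subst hpt
      refine ⟨.of e, ?_, fun h => by cases h⟩
      rintro _ ⟨⟩
      refine ⟨e, rfl, rfl, fun m h h' => Arrow.eq_of_ne_iff hv ?_⟩
      rw [e.val_ne_iff, d.val_ne_iff]
      exact hα.opposite_img_iff hq hl h.1 hdl h.2 hl' h'.1
    | none =>
      obtain ⟨q, hql, -⟩ := Set.exists_of_ssubset hlt
      have hv : ∀ m h, (img α m).Nonempty → d.val ⟨m, h⟩ = d.val ⟨l, hl, hdl⟩ := by
        intro m h hm
        by_contra hne
        exact hα.not_opposite hq hm ⟨q, hql⟩ ((d.val_ne_iff _ _).1 hne)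
      cases hd : d.val ⟨l, hl, hdl⟩ with
      | down =>
        refine ⟨.zero, fun q h => by (cases h), fun _ =>
          ⟨Or.inl rfl, fun m h hm => ⟨fun _ => rfl, ?_⟩⟩⟩
        rw [hv m h hm, hd]; exact fun k => by cases k
      | up =>
        refine ⟨.one, fun q h => by (cases h), fun _ =>
          ⟨Or.inr rfl, fun m h hm => ⟨?_, fun _ => rfl⟩⟩⟩
        rw [hv m h hm, hd]; exact fun k => by cases k
  choose D h1 h2 using key
  refine ⟨fun d => match d with
    | .zero => .zero
    | .one => .one
    | .of d => D d, rfl, rfl, h1, h2⟩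

/-- The map of directions to `0` and `1` that maps only `0` to `0`. -/
def Dir.collapse : G.Dir → H.Dir
  | .zero => .zero
  | _ => .one

theorem Dir.collapse_eq {d : G.Dir} (h : d ≠ .zero) : (d.collapse : H.Dir) = .one := by
  cases d with
  | zero => exact absurd rfl h
  | one => rfl
  | of d => rfl

end PreOrthogeometry

/-! ### The morphism of orthogeometries given by a morphism of lattices -/

section PointMap

variable {A B C : COML.{u}}

open CompleteOML PreOrthogeometry

theorem CompleteOMLHom.mono (f : CompleteOMLHom A.carrier B.carrier) {x y : A.carrier}
    (h : x ≤ y) : f.toFun x ≤ f.toFun y := by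
  rw [← sup_eq_right, ← f.map_sup, sup_eq_right.2 h]

theorem CompleteOMLHom.orth (f : CompleteOMLHom A.carrier B.carrier) {x y : A.carrier}
    (h : x ≤ yᶜ) : f.toFun x ≤ (f.toFun y)ᶜ := by
  rw [← f.map_compl']; exact f.mono h

theorem CompleteOMLHom.ne_bot_of (f : CompleteOMLHom A.carrier B.carrier) {x : A.carrier}
    (h : f.toFun x ≠ ⊥) : x ≠ ⊥ := fun e => h (by rw [e, f.map_bot])

theorem CompleteOMLHom.ne_top_of (f : CompleteOMLHom A.carrier B.carrier) {x : A.carrier}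
    (h : f.toFun x ≠ ⊤) : x ≠ ⊤ := fun e => h (by rw [e, f.map_top])

/-- The partial function between points given by a morphism of lattices, as a function between
the Boolean subalgebras. -/
noncomputable abbrev boolMap (f : CompleteOMLHom A.carrier B.carrier) :
    BoolPoint A.carrier → Option (BoolPoint B.carrier) := pointMap (A := A) (B := B) f

variable (f : CompleteOMLHom A.carrier B.carrier) {p : BoolPoint A.carrier}
  {q : BoolPoint B.carrier} {x : A.carrier}

theorem image_boolPoint (hx : x ∈ p.1) (h0 : x ≠ ⊥) (h1 : x ≠ ⊤) :
    f.toFun '' p.1 = {⊥, ⊤, f.toFun x, (f.toFun x)ᶜ} := by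
  rw [p.2.1.eq_four p.2.2 hx h0 h1]
  simp [Set.image_insert_eq, f.map_bot, f.map_top, f.map_compl']

theorem ncard_image_boolPoint (hx : x ∈ p.1) (h0 : x ≠ ⊥) (h1 : x ≠ ⊤) :
    (f.toFun '' p.1).ncard = 4 ↔ f.toFun x ≠ ⊥ ∧ f.toFun x ≠ ⊤ := by
  rw [image_boolPoint f hx h0 h1]
  constructor
  · intro h
    by_contra hn
    have hsub : ({⊥, ⊤, f.toFun x, (f.toFun x)ᶜ} : Set B.carrier) ⊆ {⊥, ⊤} := by
      rw [not_and_or, not_not, not_not] at hn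
      rcases hn with e | e <;> simp [e, compl_bot', compl_top', Set.insert_subset_iff]
    have h1 := Set.ncard_le_ncard hsub (by simp)
    have h2 := Set.ncard_insert_le (⊥ : B.carrier) {⊤}
    rw [Set.ncard_singleton] at h2
    omega
  · exact fun h => ncard_four h.1 h.2

theorem boolMap_eq_some_iff (hx : x ∈ p.1) (h0 : x ≠ ⊥) (h1 : x ≠ ⊤) :
    boolMap f p = some q ↔ f.toFun x ∈ q.1 ∧ f.toFun x ≠ ⊥ ∧ f.toFun x ≠ ⊤ := by
  have hn := ncard_image_boolPoint f hx h0 h1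
  have hm : f.toFun x ∈ f.toFun '' p.1 := ⟨x, hx, rfl⟩
  by_cases h : (f.toFun '' p.1).ncard = 4
  · have e : boolMap f p = some ⟨f.toFun '' p.1, p.2.1.image f, h⟩ := dif_pos h
    rw [e]
    constructor
    · intro k
      have k' := Option.some.inj k
      exact ⟨k' ▸ hm, hn.1 h⟩
    · rintro ⟨k, k0, k1⟩
      exact congrArg some (BoolPoint.eq hm k k0 k1)
  · have e : boolMap f p = none := dif_neg h
    rw [e]
    exact iff_of_false (fun k => by cases k) fun k => h (hn.2 k.2)

theorem boolMap_fourPoint (k0 : f.toFun x ≠ ⊥) (k1 : f.toFun x ≠ ⊤) (hx : x ∈ p.1) :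
    boolMap f p = some (fourPoint (f.toFun x) k0 k1) :=
  (boolMap_eq_some_iff f hx (f.ne_bot_of k0) (f.ne_top_of k1)).2 ⟨mem_fourPoint _ _ _, k0, k1⟩

theorem boolMap_eq_none_iff (hx : x ∈ p.1) (h0 : x ≠ ⊥) (h1 : x ≠ ⊤) :
    boolMap f p = none ↔ f.toFun x = ⊥ ∨ f.toFun x = ⊤ := by
  constructor
  · intro h
    by_contra! hn
    rw [boolMap_fourPoint f hn.1 hn.2 hx] at h
    cases h
  · intro h
    cases hq : boolMap f p with
    | none => rfl
    | some q =>
      have := ((boolMap_eq_some_iff f hx h0 h1).1 hq).2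
      tauto

theorem mem_of_boolMap (hx : x ∈ p.1) (hq : boolMap f p = some q) : f.toFun x ∈ q.1 := by
  obtain ⟨h1, h2, h3⟩ := (boolMap_eq_some_iff f p.rep_mem p.rep_ne_bot p.rep_ne_top).1 hq
  have : f.toFun x ∈ f.toFun '' p.1 := ⟨x, hx, rfl⟩
  rw [image_boolPoint f p.rep_mem p.rep_ne_bot p.rep_ne_top] at this
  rwa [q.2.1.eq_four q.2.2 h1 h2 h3]

theorem Part3.map {a b c : A.carrier} (h : Part3 a b c) (ha : f.toFun a ≠ ⊥)
    (hb : f.toFun b ≠ ⊥) (hc : f.toFun c ≠ ⊥) : Part3 (f.toFun a) (f.toFun b) (f.toFun c) :=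
  ⟨ha, hb, hc, f.orth h.ab, f.orth h.ac, f.orth h.bc, by
    rw [← f.map_sup, ← f.map_sup, h.sup, f.map_top]⟩

theorem Part4.map {a b c d : A.carrier} (h : Part4 a b c d) (ha : f.toFun a ≠ ⊥)
    (hb : f.toFun b ≠ ⊥) (hc : f.toFun c ≠ ⊥) (hd : f.toFun d ≠ ⊥) :
    Part4 (f.toFun a) (f.toFun b) (f.toFun c) (f.toFun d) :=
  ⟨ha, hb, hc, hd, f.orth h.ab, f.orth h.ac, f.orth h.ad, f.orth h.bc, f.orth h.bd, f.orth h.cd, by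
    rw [← f.map_sup, ← f.map_sup, ← f.map_sup, h.sup, f.map_top]⟩

theorem Part3.map_eq_compl {a b c : A.carrier} (h : Part3 a b c) (ha : f.toFun a = ⊥) :
    f.toFun c = (f.toFun b)ᶜ := by
  rw [← f.map_compl', h.rotate.compl_eq, f.map_sup, ha, sup_bot_eq]

theorem img_tri {a b c : A.carrier}
    (h' : Part3 (f.toFun a) (f.toFun b) (f.toFun c)) :
    img (G := orthogeometryOf A.carrier) (H := orthogeometryOf B.carrier) (boolMap f) (tri a b c) =
      tri (f.toFun a) (f.toFun b) (f.toFun c) := by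
  ext s
  constructor
  · rintro ⟨p, hp | hp | hp, hs⟩
    · exact Or.inl (mem_of_boolMap f hp hs)
    · exact Or.inr (Or.inl (mem_of_boolMap f hp hs))
    · exact Or.inr (Or.inr (mem_of_boolMap f hp hs))
  · have aux : ∀ y : A.carrier, f.toFun y ≠ ⊥ → f.toFun y ≠ ⊤ → f.toFun y ∈ s.1 →
        ∃ p : BoolPoint A.carrier, y ∈ p.1 ∧ boolMap f p = some s := fun y k0 k1 hs =>
      ⟨_, mem_fourPoint y (f.ne_bot_of k0) (f.ne_top_of k1),
        (boolMap_eq_some_iff f (mem_fourPoint _ _ _) (f.ne_bot_of k0) (f.ne_top_of k1)).2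
          ⟨hs, k0, k1⟩⟩
    rintro (hs | hs | hs)
    · obtain ⟨p, hp, hps⟩ := aux a h'.ha h'.ne_top hs
      exact ⟨p, Or.inl hp, hps⟩
    · obtain ⟨p, hp, hps⟩ := aux b h'.hb h'.rotate.ne_top hs
      exact ⟨p, Or.inr (Or.inl hp), hps⟩
    · obtain ⟨p, hp, hps⟩ := aux c h'.hc h'.rotate.rotate.ne_top hs
      exact ⟨p, Or.inr (Or.inr hp), hps⟩

/-- The behaviour of a morphism at a line one of whose atoms is mapped to `⊥`. -/
theorem Part3.line_of_bot {a b c : A.carrier} (h : Part3 a b c) (ha : f.toFun a = ⊥) :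
    (∀ p ∈ tri a b c, boolMap f p = none) ∨
      ∃ p ∈ tri a b c, ∃ s, boolMap f p = none ∧ ∀ q ∈ tri a b c, q ≠ p → boolMap f q = some s := by
  have hc := h.map_eq_compl f ha
  by_cases hb : f.toFun b = ⊥ ∨ f.toFun b = ⊤
  · refine Or.inl ?_
    rintro p (hp | hp | hp)
    · exact (boolMap_eq_none_iff f hp h.ha h.ne_top).2 (Or.inl ha)
    · exact (boolMap_eq_none_iff f hp h.hb h.rotate.ne_top).2 hb
    · refine (boolMap_eq_none_iff f hp h.hc h.rotate.rotate.ne_top).2 ?_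
      rcases hb with e | e
      · right; rw [hc, e, compl_bot']
      · left; rw [hc, e, compl_top']
  · push Not at hb
    refine Or.inr ⟨fourPoint a h.ha h.ne_top, Or.inl (mem_fourPoint _ _ _), fourPoint _ hb.1 hb.2,
      (boolMap_eq_none_iff f (mem_fourPoint _ _ _) h.ha h.ne_top).2 (Or.inl ha), ?_⟩
    rintro p (hp | hp | hp) hne
    · exact absurd (BoolPoint.eq hp (mem_fourPoint _ _ _) h.ha h.ne_top) hne
    · exact boolMap_fourPoint f hb.1 hb.2 hp
    · refine (boolMap_eq_some_iff f hp h.hc h.rotate.rotate.ne_top).2 ?_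
      rw [hc]
      exact ⟨(fourPoint _ hb.1 hb.2).2.1.compl_mem _ (mem_fourPoint _ _ _), compl_ne_bot hb.2,
        compl_ne_top hb.1⟩

theorem Part3.img_subsingleton_of_bot {a b c : A.carrier} (h : Part3 a b c)
    (ha : f.toFun a = ⊥) :
    (img (G := orthogeometryOf A.carrier) (H := orthogeometryOf B.carrier)
      (boolMap f) (tri a b c)).Subsingleton := by
  rintro s ⟨p, hp, hps⟩ t ⟨r, hr, hrt⟩
  rcases h.line_of_bot f ha with k | ⟨o, ho, w, how, k⟩
  · rw [k p hp] at hps; cases hps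
  · have h1 : p ≠ o := fun e => by rw [e, how] at hps; cases hps
    have h2 : r ≠ o := fun e => by rw [e, how] at hrt; cases hrt
    rw [k p hp h1] at hps
    rw [k r hr h2] at hrt
    exact Option.some.inj (hps.symm.trans hrt)

theorem Part3.map_or {a b c : A.carrier} (h : Part3 a b c) :
    Part3 (f.toFun a) (f.toFun b) (f.toFun c) ∨ f.toFun a = ⊥ ∨ f.toFun b = ⊥ ∨ f.toFun c = ⊥ := by
  by_cases ha : f.toFun a = ⊥
  · exact Or.inr (Or.inl ha)
  by_cases hb : f.toFun b = ⊥
  · exact Or.inr (Or.inr (Or.inl hb))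
  by_cases hc : f.toFun c = ⊥
  · exact Or.inr (Or.inr (Or.inr hc))
  exact Or.inl (h.map f ha hb hc)

theorem Part3.img_subsingleton {a b c : A.carrier} (h : Part3 a b c)
    (h' : f.toFun a = ⊥ ∨ f.toFun b = ⊥ ∨ f.toFun c = ⊥) :
    (img (G := orthogeometryOf A.carrier) (H := orthogeometryOf B.carrier)
      (boolMap f) (tri a b c)).Subsingleton := by
  rcases h' with k | k | k
  · exact h.img_subsingleton_of_bot f k
  · rw [tri_rotate]; exact h.rotate.img_subsingleton_of_bot f k
  · rw [tri_rotate, tri_rotate]; exact h.rotate.rotate.img_subsingleton_of_bot f k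

theorem Down.map {l : Set (BoolPoint A.carrier)} (h : Down x l)
    (hl : img (G := orthogeometryOf A.carrier) (H := orthogeometryOf B.carrier) (boolMap f) l ∈
      (orthogeometryOf B.carrier).lines) :
    Down (f.toFun x)
      (img (G := orthogeometryOf A.carrier) (H := orthogeometryOf B.carrier) (boolMap f) l) := by
  obtain ⟨b, c, h, rfl⟩ := h
  rcases h.map_or f with k | k
  · exact ⟨_, _, k, img_tri f k⟩
  · exact absurd (nontrivial_line hl) (Set.not_nontrivial_iff.2 (h.img_subsingleton f k))

/-- If the atom `x` went to `⊤`, the other two atoms would go to `⊥` and nothing on the line would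
have an image. So, where the point map is undefined, an arrow `↓` at a line with nonempty image
forces the value `⊥`. -/
theorem Down.map_ne_top {l : Set (BoolPoint A.carrier)} (h : Down x l)
    (hl : (img (G := orthogeometryOf A.carrier) (H := orthogeometryOf B.carrier)
      (boolMap f) l).Nonempty) : f.toFun x ≠ ⊤ := by
  intro e
  obtain ⟨b, c, h, rfl⟩ := h
  obtain ⟨s, p, hp, hs⟩ := hl
  have aux : ∀ y : A.carrier, x ≤ yᶜ → f.toFun y = ⊥ := fun y hy => by
    have := f.orth hy
    rw [e, top_le_iff] at this
    rw [← compl_compl' (f.toFun y), this, compl_top']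
  have hn : boolMap f p = none := by
    rcases hp with hp | hp | hp
    · exact (boolMap_eq_none_iff f hp h.ha h.ne_top).2 (Or.inr e)
    · exact (boolMap_eq_none_iff f hp h.hb h.rotate.ne_top).2 (Or.inl (aux b h.ab))
    · exact (boolMap_eq_none_iff f hp h.hc h.rotate.rotate.ne_top).2 (Or.inl (aux c h.ac))
  exact absurd (hn.symm.trans hs) (by simp)

theorem Part4.part3_pairs {A : Type u} [CompleteOML A] {a b c d : A} (h : Part4 a b c d) :
    Part3 (a ⊔ b) c d ∧ Part3 (a ⊔ c) d b ∧ Part3 (a ⊔ d) b c := by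
  refine ⟨h.rotate.rotate.part3.rotate.rotate, h.swap.rotate.rotate.rotate.part3.rotate.rotate, ?_⟩
  have := h.rotate.part3.rotate.rotate
  rwa [sup_comm] at this

/-- Images of the atoms of a line are orthogonal with join `⊤`: they form a partition unless one of
them is `⊥`, and then the other two are complementary. If all vertices of a plane survive, its
partition into four does too. For opposition, an atom of a line that is mapped to a line goes to an
atom, so `x` cannot be an atom of `m` when the image of `m` has the atom `(f x)ᶜ`. -/
theorem isMorphism_boolMap :
    IsMorphism (G := orthogeometryOf A.carrier) (H := orthogeometryOf B.carrier) (boolMap f) where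
  line l hl := by
    obtain ⟨a, b, c, h, rfl⟩ := mem_lines_iff.1 hl
    rcases h.map_or f with k | k | k | k
    · refine Or.inr (Or.inr ⟨?_, ?_⟩)
      · rintro p (hp | hp | hp)
        · exact ⟨_, boolMap_fourPoint f k.ha k.ne_top hp⟩
        · exact ⟨_, boolMap_fourPoint f k.hb k.rotate.ne_top hp⟩
        · exact ⟨_, boolMap_fourPoint f k.hc k.rotate.rotate.ne_top hp⟩
      · exact mem_lines_iff.2 ⟨_, _, _, k, img_tri f k⟩
    · exact (h.line_of_bot f k).imp_right Or.inl
    · rw [tri_rotate]; exact (h.rotate.line_of_bot f k).imp_right Or.inl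
    · rw [tri_rotate, tri_rotate]; exact (h.rotate.rotate.line_of_bot f k).imp_right Or.inl
  plane := by
    intro pa pb pc pd px py pz hw qa qb qc qd ka kb kc kd
    obtain ⟨a, b, c, d, h, ha, hb, hc, hd, hx, hy, hz⟩ := isPlane_iff_part4.1 hw
    obtain ⟨ha', ha0, -⟩ := (boolMap_eq_some_iff f ha h.ha h.part3.ne_top).1 ka
    obtain ⟨hb', hb0, -⟩ := (boolMap_eq_some_iff f hb h.hb h.rotate.part3.ne_top).1 kb
    obtain ⟨hc', hc0, -⟩ := (boolMap_eq_some_iff f hc h.hc h.rotate.rotate.part3.ne_top).1 kc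
    obtain ⟨hd', hd0, -⟩ := (boolMap_eq_some_iff f hd h.hd h.rotate.rotate.rotate.part3.ne_top).1 kd
    have k := h.map f ha0 hb0 hc0 hd0
    obtain ⟨k1, k2, k3⟩ := k.part3_pairs
    simp only [← f.map_sup] at k1 k2 k3
    refine ⟨_, _, _, boolMap_fourPoint f k1.ha k1.ne_top hx, boolMap_fourPoint f k2.ha k2.ne_top hy,
      boolMap_fourPoint f k3.ha k3.ne_top hz, isPlane_iff_part4.2 ⟨_, _, _, _, k, ha', hb', hc',
        hd', ?_, ?_, ?_⟩⟩
    · rw [← f.map_sup]; exact mem_fourPoint _ _ _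
    · rw [← f.map_sup]; exact mem_fourPoint _ _ _
    · rw [← f.map_sup]; exact mem_fourPoint _ _ _
  opposite := by
    intro p p' hp l hl m hm hpl hpm hopp
    obtain ⟨hl', hm'⟩ := hopp.mem_lines
    obtain ⟨y, hy, k1, k2⟩ := opposite_iff.1 hopp
    obtain ⟨x, hx, hd⟩ := exists_down_of_mem hl hpl
    obtain ⟨h1, h2, h3⟩ := (boolMap_eq_some_iff f hx hd.ne_bot hd.ne_top).1 hp
    have hfd := hd.map f hl'
    refine opposite_iff.2 ⟨x, hx, hd, ?_⟩
    rcases BoolPoint.mem_or h1 h2 h3 hy k1.ne_bot k1.ne_top with rfl | rfl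
    · refine (down_or_down_compl hm hpm hx hd.ne_bot hd.ne_top).resolve_left fun w => ?_
      exact (w.map f hm').not_compl k2
    · exact absurd k1 hfd.not_compl

/-- The map of directions given by a morphism of lattices. -/
noncomputable def dirMap (f : CompleteOMLHom A.carrier B.carrier) (hA : (⊥ : A.carrier) ≠ ⊤)
    (d : (orthogeometryOf A.carrier).Dir) : (orthogeometryOf B.carrier).Dir :=
  toDir (f.toFun ((toDirIso hA).symm d))

theorem dirMap_toDir (hA : (⊥ : A.carrier) ≠ ⊤) (x : A.carrier) :
    dirMap f hA (toDir x) = toDir (f.toFun x) :=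
  congrArg (fun y => toDir (f.toFun y)) ((toDirIso hA).symm_apply_apply x)

/-- Both lattices have to be nontrivial: in a one-element lattice `toDir ⊤` is `0`, whereas an
induced map must fix `1`. -/
theorem isDirMap_boolMap (hA : (⊥ : A.carrier) ≠ ⊤) (hB : (⊥ : B.carrier) ≠ ⊤) :
    IsDirMap (G := orthogeometryOf A.carrier) (H := orthogeometryOf B.carrier) (boolMap f)
      (dirMap f hA) := by
  have hF := dirMap_toDir f hA
  refine ⟨?_, ?_, ?_, ?_⟩
  · rw [← toDir_bot, hF, f.map_bot, toDir_bot]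
  · rw [← toDir_top hA, hF, f.map_top, toDir_top hB]
  · intro d q hq
    obtain ⟨x, h0, h1, rfl⟩ := exists_dirOf_eq d
    have hx := mem_fourPoint x h0 h1
    obtain ⟨k, k0, k1⟩ := (boolMap_eq_some_iff f hx h0 h1).1 hq
    refine ⟨dirOf (f.toFun x) k0 k1, ?_, BoolPoint.eq (mem_fourPoint _ k0 k1) k k0 k1, ?_⟩
    · rw [← toDir_of h0 h1, hF, toDir_of k0 k1]
    · intro l h h'
      rcases down_or_down_compl h.1 h.2 hx h0 h1 with w | w
      · exact ((dirOf_val_eq_down _).2 (w.map f h'.1)).trans ((dirOf_val_eq_down _).2 w).symm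
      · have w' := w.map f h'.1
        rw [f.map_compl'] at w'
        exact ((dirOf_val_eq_up _).2 w').trans ((dirOf_val_eq_up _).2 w).symm
  · intro d hd
    obtain ⟨x, h0, h1, rfl⟩ := exists_dirOf_eq d
    have hx := mem_fourPoint x h0 h1
    have hfx := (boolMap_eq_none_iff f hx h0 h1).1 hd
    rw [← toDir_of h0 h1, hF]
    refine ⟨hfx.imp (fun e => by rw [e, toDir_bot]) (fun e => by rw [e, toDir_top hB]), ?_⟩
    intro l h hne
    constructor
    · intro hv
      have w := (dirOf_val_eq_down _).1 hv
      rw [hfx.resolve_right (w.map_ne_top f hne), toDir_bot]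
    · intro hv
      have w := (dirOf_val_eq_up _).1 hv
      rw [hfx.resolve_left fun e => w.map_ne_top f hne (by rw [f.map_compl', e, compl_bot']),
        toDir_top hB]

theorem preservesJoins_boolMap :
    PreservesJoins (G := orthogeometryOf A.carrier) (H := orthogeometryOf B.carrier)
      (boolMap f) := by
  -- The geometry of the one-element lattice still has the two directions `0` and `1`, so `f` cannot
  -- be transported. Instead everything except `0` is sent to `1`; joins are preserved because a
  -- join is nonzero iff one of the joined directions is.
  by_cases hB : (⊥ : B.carrier) = ⊤
  · have htriv : ∀ b : B.carrier, b = ⊥ := fun b => le_bot_iff.1 (hB ▸ le_top)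
    have hnone : ∀ p : BoolPoint A.carrier, boolMap f p = none := fun p =>
      (boolMap_eq_none_iff f p.rep_mem p.rep_ne_bot p.rep_ne_top).2 (Or.inl (htriv _))
    refine ⟨Dir.collapse, ⟨rfl, rfl, fun d q hq => ?_,
      fun d _ => ⟨Or.inr rfl, fun l h hne => ?_⟩⟩, ?_⟩
    · exact absurd ((hnone _).symm.trans hq) (by simp)
    · obtain ⟨s, p, -, hs⟩ := hne
      exact absurd ((hnone _).symm.trans hs) (by simp)
    · intro D e he
      have hle : ∀ d : (orthogeometryOf B.carrier).Dir, Dir.zero ≤ d := fun _ => trivial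
      have hone : ∀ d : (orthogeometryOf B.carrier).Dir, d ≤ Dir.one := fun d => by
        cases d <;> trivial
      have hzero : ∀ d : (orthogeometryOf A.carrier).Dir, d ≤ Dir.zero → d = .zero := fun d h => by
        cases d with
        | zero => rfl
        | one => exact h.elim
        | of d => exact h.elim
      by_cases h0 : e = .zero
      · subst h0
        refine ⟨?_, fun _ _ => hle _⟩
        rintro _ ⟨d, hd, rfl⟩
        rw [hzero d (he.1 hd)]
        exact hle _
      · obtain ⟨d, hd, hd0⟩ : ∃ d ∈ D, d ≠ .zero := by
          by_contra! hcon
          exact h0 (hzero _ (he.2 fun d hd => by rw [hcon d hd]; trivial))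
        rw [Dir.collapse_eq h0]
        refine ⟨fun _ _ => hone _, fun b hb => ?_⟩
        have := hb ⟨d, hd, rfl⟩
        rwa [Dir.collapse_eq hd0] at this
  · have hA : (⊥ : A.carrier) ≠ ⊤ := fun h => hB (by rw [← f.map_bot, h, f.map_top])
    refine ⟨dirMap f hA, isDirMap_boolMap f hA hB, fun D e he => ?_⟩
    obtain ⟨x, rfl⟩ := (toDirIso hA).surjective e
    have h1 : IsLUB ((toDirIso hA).symm '' D) x := by
      rw [← isLUB_image_orderIso (toDirIso hA), Set.image_image]
      simpa using he
    have h2 : IsLUB (f.toFun '' ((toDirIso hA).symm '' D)) (f.toFun x) := by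
      rw [← h1.sSup_eq, f.map_sSup']
      exact isLUB_sSup _
    have h3 := (isLUB_image_orderIso (toDirIso hB)).2 h2
    rw [Set.image_image, Set.image_image] at h3
    have h4 : dirMap f hA (toDirIso hA x) = toDirIso hB (f.toFun x) := dirMap_toDir f hA x
    rw [h4]
    exact h3

end PointMap

/-! ### Proper morphisms -/

section Proper

variable {A B C : COML.{u}}

open CompleteOML PreOrthogeometry

theorem isBooleanSub_bot_top {A : Type u} [CompleteOML A] : IsBooleanSub ({⊥, ⊤} : Set A) := by
  have := isBooleanSub_four (⊥ : A)
  rwa [compl_bot', show ({⊥, ⊤, ⊥, ⊤} : Set A) = {⊥, ⊤} by ext x; simp] at this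

theorem IsBooleanSub.sUnion {A : Type u} [CompleteOML A] {c : Set (Set A)}
    (hc : ∀ S ∈ c, IsBooleanSub S) (hch : IsChain (· ⊆ ·) c) (hne : c.Nonempty) :
    IsBooleanSub (⋃₀ c) := by
  have two : ∀ x ∈ ⋃₀ c, ∀ y ∈ ⋃₀ c, ∃ S ∈ c, x ∈ S ∧ y ∈ S := by
    rintro x ⟨S, hS, hx⟩ y ⟨T, hT, hy⟩
    rcases hch.total hS hT with h | h
    exacts [⟨T, hT, h hx, hy⟩, ⟨S, hS, hx, h hy⟩]
  obtain ⟨S₀, hS₀⟩ := hne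
  constructor
  · exact ⟨S₀, hS₀, (hc _ hS₀).bot_mem⟩
  · exact ⟨S₀, hS₀, (hc _ hS₀).top_mem⟩
  · rintro x ⟨S, hS, hx⟩
    exact ⟨S, hS, (hc _ hS).compl_mem x hx⟩
  · intro x hx y hy
    obtain ⟨S, hS, hx, hy⟩ := two x hx y hy
    exact ⟨S, hS, (hc _ hS).sup_mem x hx y hy⟩
  · intro x hx y hy
    obtain ⟨S, hS, hx, hy⟩ := two x hx y hy
    exact ⟨S, hS, (hc _ hS).inf_mem x hx y hy⟩
  · intro x hx y hy z hz
    obtain ⟨S, hS, hxS, hyS⟩ := two x hx y hy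
    obtain ⟨T, hT, hzT⟩ := hz
    rcases hch.total hS hT with h | h
    · exact (hc _ hT).distrib x (h hxS) y (h hyS) z hzT
    · exact (hc _ hS).distrib x hxS y hyS z (h hzT)

theorem IsBooleanSub.exists_isBlock {A : Type u} [CompleteOML A] {S : Set A}
    (hS : IsBooleanSub S) : ∃ C, IsBlock C ∧ S ⊆ C := by
  obtain ⟨C, hSC, hC⟩ := zorn_subset_nonempty {S : Set A | IsBooleanSub S}
    (fun c hc hch hne => ⟨⋃₀ c, IsBooleanSub.sUnion (fun _ h => hc h) hch hne,
      fun _ h => Set.subset_sUnion_of_mem h⟩) S hS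
  exact ⟨C, hC, hSC⟩

variable (f : CompleteOMLHom A.carrier B.carrier)

/-- Turns geometric growth of the image into growth for blocks: extend `W` to a block. If the image
of a nontrivial element of `r` were `f s` with `s ∈ S`, the point of `s` would lie in `S` and be
mapped to `q`. -/
theorem exists_isBlock_of_boolMap {S W : Set A.carrier} (hW : IsBooleanSub W) (hSW : S ⊆ W)
    {r : BoolPoint A.carrier} {q : BoolPoint B.carrier} (hr : r.1 ⊆ W) (hq : boolMap f r = some q)
    (hS : IsBooleanSub S) (hn : ∀ p : BoolPoint A.carrier, p.1 ⊆ S → boolMap f p ≠ some q) :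
    ∃ C, IsBlock C ∧ S ⊆ C ∧ f.toFun '' S ⊂ f.toFun '' C := by
  obtain ⟨C, hC, hWC⟩ := hW.exists_isBlock
  refine ⟨C, hC, hSW.trans hWC, Set.image_mono (hSW.trans hWC), fun hsub => ?_⟩
  obtain ⟨h1, h2, h3⟩ := (boolMap_eq_some_iff f r.rep_mem r.rep_ne_bot r.rep_ne_top).1 hq
  obtain ⟨s, hs, hsr⟩ := hsub ⟨r.rep, hWC (hr r.rep_mem), rfl⟩
  rw [← hsr] at h1 h2 h3
  have s0 := f.ne_bot_of h2
  have s1 := f.ne_top_of h3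
  have hm := mem_fourPoint s s0 s1
  exact hn (fourPoint s s0 s1) ((BoolPoint.subset_iff hm s0 s1 hS).2 hs)
    ((boolMap_eq_some_iff f hm s0 s1).2 ⟨h1, h2, h3⟩)

theorem ne_compl_of_le {A : Type u} [CompleteOML A] {u x : A} (h : u ≤ x) (h0 : u ≠ ⊥) :
    u ≠ xᶜ := fun e => h0 (eq_bot_of_le_of_le_compl h e.le)

/-- A proper morphism of lattices gives a proper morphism of orthogeometries: points. -/
theorem point_of_isProper (hf : f.IsProper) (p : BoolPoint A.carrier) :
    ∃ l ∈ (orthogeometryOf A.carrier).lines, p ∈ l ∧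
      img (G := orthogeometryOf A.carrier) (H := orthogeometryOf B.carrier) (boolMap f) {p} ⊂
      img (G := orthogeometryOf A.carrier) (H := orthogeometryOf B.carrier) (boolMap f) l := by
  have hfin : p.1.Finite := Set.finite_of_ncard_ne_zero (by rw [p.2.2]; omega)
  obtain ⟨C, hC, hpC, hlt⟩ := hf p.1 p.2.1 hfin (by rw [p.2.2]; omega)
    ((Set.ncard_image_le hfin).trans p.2.2.le)
  obtain ⟨_, ⟨y, hy, rfl⟩, hyp⟩ := Set.exists_of_ssubset hlt
  have hCb : IsBooleanSub C := hC.prop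
  -- With `v = x ⊓ y < x`, the line with atoms `v`, `xᶜ`, `vᶜ ⊓ x` passes through `p`, and the image
  -- of `v` is neither `f x` nor its complement.
  have main : ∀ x ∈ p.1, x ≠ ⊥ → x ≠ ⊤ → f.toFun (x ⊓ y) ≠ ⊥ → f.toFun (x ⊓ y) ≠ f.toFun x →
      ∃ l ∈ (orthogeometryOf A.carrier).lines, p ∈ l ∧
      img (G := orthogeometryOf A.carrier) (H := orthogeometryOf B.carrier) (boolMap f) {p} ⊂
      img (G := orthogeometryOf A.carrier) (H := orthogeometryOf B.carrier) (boolMap f) l := by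
    intro x hx h0 h1 k0 kx
    have hle : x ⊓ y ≤ x := inf_le_left
    generalize x ⊓ y = v at k0 kx hle
    have hfle := f.mono hle
    have k1 : f.toFun v ≠ ⊤ := fun e => kx (by rw [e, eq_comm, ← top_le_iff, ← e]; exact hfle)
    have hP := Part3.of_lt (f.ne_bot_of k0) h1 (lt_of_le_of_ne hle fun e => kx (e ▸ rfl))
    have hpl : p ∈ tri v xᶜ (vᶜ ⊓ x) := Or.inr (Or.inl (p.2.1.compl_mem x hx))
    refine ⟨_, hP.mem_lines, hpl, ?_, fun hsub => ?_⟩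
    · rintro s ⟨r, hr, hrs⟩
      exact ⟨r, (Set.mem_singleton_iff.1 hr) ▸ hpl, hrs⟩
    · obtain ⟨r, hr, hrs⟩ := hsub (a := fourPoint (f.toFun v) k0 k1)
        ⟨fourPoint v (f.ne_bot_of k0) (f.ne_top_of k1), Or.inl (mem_fourPoint _ _ _),
          boolMap_fourPoint f k0 k1 (mem_fourPoint _ _ _)⟩
      obtain rfl : r = p := hr
      obtain ⟨w, w0, w1⟩ := (boolMap_eq_some_iff f hx h0 h1).1 hrs
      rcases BoolPoint.mem_or w w0 w1 (mem_fourPoint _ k0 k1) k0 k1 with e | e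
      · exact kx e
      · exact ne_compl_of_le hfle k0 e
  obtain ⟨x, hx, h0, h1⟩ := IsBooleanSub.exists_four p.2.2
  have hx' := p.2.1.compl_mem x hx
  -- Inside the block `y` splits along `x` and `xᶜ`. If both parts were mapped to `⊥` or to the full
  -- image of `x` or `xᶜ`, then `f y` would lie in the image of `p`.
  have hfy : f.toFun y = f.toFun (x ⊓ y) ⊔ f.toFun (xᶜ ⊓ y) := by
    rw [← f.map_sup, inf_comm x, inf_comm xᶜ, ← hCb.eq_inf_sup_inf hy (hpC hx)]
  by_cases c1 : f.toFun (x ⊓ y) ≠ ⊥ ∧ f.toFun (x ⊓ y) ≠ f.toFun x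
  · exact main x hx h0 h1 c1.1 c1.2
  by_cases c2 : f.toFun (xᶜ ⊓ y) ≠ ⊥ ∧ f.toFun (xᶜ ⊓ y) ≠ f.toFun xᶜ
  · exact main _ hx' (compl_ne_bot h1) (compl_ne_top h0) c2.1 c2.2
  exfalso
  apply hyp
  rw [hfy, image_boolPoint f hx h0 h1]
  rw [not_and_or, not_not, not_not] at c1 c2
  rcases c1 with e1 | e1 <;> rcases c2 with e2 | e2 <;>
    simp [e1, e2, f.map_compl', sup_compl']

theorem ncard_four_le {α : Type*} (a b c d : α) : ({a, b, c, d} : Set α).ncard ≤ 4 := by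
  have h1 := Set.ncard_insert_le a {b, c, d}
  have h2 := Set.ncard_insert_le b {c, d}
  have h3 := Set.ncard_insert_le c {d}
  have h4 := Set.ncard_singleton d
  omega

theorem Part3.range_eq {A : Type u} [CompleteOML A] {a b c : A} (h : Part3 a b c) {x : A}
    (hx : x ∈ Set.range fun s : Finset (Fin 3) => s.sup ![a, b, c]) :
    x = ⊥ ∨ x = ⊤ ∨ (x = a ∨ x = aᶜ) ∨ (x = b ∨ x = bᶜ) ∨ (x = c ∨ x = cᶜ) := by
  have hP := h.isPartition
  obtain ⟨s, hs⟩ := hx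
  have hs' : s.sup ![a, b, c] = x := hs
  rcases Finset.fin_three_cases s with rfl | rfl | (rfl | rfl) | (rfl | rfl) | (rfl | rfl)
  · exact Or.inl (hs'.symm.trans (by simp))
  · exact Or.inr (Or.inl (hs'.symm.trans hP.sup_eq))
  all_goals
    try rw [← hP.compl_sup] at hs'
    simp at hs'
    simp [← hs']

/-- Once an atom is killed, the images of the other two are complementary, and no further elements
arise. -/
theorem Part3.ncard_image_le {a b c : A.carrier} (h : Part3 a b c)
    (h' : f.toFun a = ⊥ ∨ f.toFun b = ⊥ ∨ f.toFun c = ⊥) :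
    (f.toFun '' Set.range fun s : Finset (Fin 3) => s.sup ![a, b, c]).ncard ≤ 4 := by
  obtain ⟨w, hw⟩ : ∃ w, (f.toFun '' Set.range fun s : Finset (Fin 3) => s.sup ![a, b, c]) ⊆
      {⊥, ⊤, w, wᶜ} := by
    rcases h' with k | k | k
    · have e := h.map_eq_compl f k
      refine ⟨f.toFun b, ?_⟩
      rintro _ ⟨x, hx, rfl⟩
      rcases h.range_eq hx with rfl | rfl | (rfl | rfl) | (rfl | rfl) | (rfl | rfl) <;>
        simp [f.map_bot, f.map_top, f.map_compl', k, e, compl_bot', compl_compl']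
    · have e := h.rotate.map_eq_compl f k
      refine ⟨f.toFun c, ?_⟩
      rintro _ ⟨x, hx, rfl⟩
      rcases h.range_eq hx with rfl | rfl | (rfl | rfl) | (rfl | rfl) | (rfl | rfl) <;>
        simp [f.map_bot, f.map_top, f.map_compl', k, e, compl_bot', compl_compl']
    · have e := h.rotate.rotate.map_eq_compl f k
      refine ⟨f.toFun a, ?_⟩
      rintro _ ⟨x, hx, rfl⟩
      rcases h.range_eq hx with rfl | rfl | (rfl | rfl) | (rfl | rfl) | (rfl | rfl) <;>
        simp [f.map_bot, f.map_top, f.map_compl', k, e, compl_bot', compl_compl']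
  exact (Set.ncard_le_ncard hw (by simp)).trans (ncard_four_le _ _ _ _)

theorem Part3.ncard_range_eq {A : Type u} [CompleteOML A] {a b c : A} (h : Part3 a b c) :
    (Set.range fun s : Finset (Fin 3) => s.sup ![a, b, c]).ncard = 8 :=
  h.isPartition.ncard_range h.ne_bot

/-- Below the atom `a` of a line there is an element whose image is new: a plane with a larger
image. -/
theorem Part3.exists_plane {a b c v : A.carrier} (h : Part3 a b c) (hle : v ≤ a)
    (k0 : f.toFun v ≠ ⊥) (ka : f.toFun v ≠ f.toFun a) :
    ∃ w, (orthogeometryOf A.carrier).IsPlaneSet w ∧ tri a b c ⊆ w ∧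
      img (G := orthogeometryOf A.carrier) (H := orthogeometryOf B.carrier)
        (boolMap f) (tri a b c) ⊂
      img (G := orthogeometryOf A.carrier) (H := orthogeometryOf B.carrier) (boolMap f) w := by
  have hfle := f.mono hle
  have k1 : f.toFun v ≠ ⊤ := fun e => ka (by rw [e, eq_comm, ← top_le_iff, ← e]; exact hfle)
  have v0 := f.ne_bot_of k0
  have v1 := f.ne_top_of k1
  have hlt : v < a := lt_of_le_of_ne hle fun e => ka (e ▸ rfl)
  have hc := (Part3.of_lt v0 h.ne_top hlt).hc
  have e : v ⊔ (vᶜ ⊓ a) = a := orthomodular' v a hle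
  -- The plane refines the line by splitting the atom `a` into `v` and `vᶜ ⊓ a`.
  have h4 : Part4 v (vᶜ ⊓ a) b c := ⟨v0, hc, h.hb, h.hc,
    by rw [compl_inf', compl_compl']; exact le_sup_left, hle.trans h.ab, hle.trans h.ac,
    inf_le_right.trans h.ab, inf_le_right.trans h.ac, h.bc, by rw [e, h.sup]⟩
  obtain ⟨-, hy, hz⟩ := h4.part3_pairs
  have hm := mem_fourPoint a h.ha h.ne_top
  have hmb := mem_fourPoint b h.hb h.rotate.ne_top
  have hmc := mem_fourPoint c h.hc h.rotate.rotate.ne_top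
  have hw := isPlane_iff_part4.2 ⟨_, _, _, _, h4, mem_fourPoint v v0 v1,
    mem_fourPoint _ hc h4.rotate.part3.ne_top, hmb, hmc, Set.mem_of_eq_of_mem e hm,
    mem_fourPoint _ hy.ha hy.ne_top, mem_fourPoint _ hz.ha hz.ne_top⟩
  have hsub : tri a b c ⊆ {fourPoint v v0 v1, fourPoint _ hc h4.rotate.part3.ne_top,
      fourPoint b h.hb h.rotate.ne_top, fourPoint c h.hc h.rotate.rotate.ne_top,
      fourPoint a h.ha h.ne_top, fourPoint _ hy.ha hy.ne_top, fourPoint _ hz.ha hz.ne_top} := by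
    rw [h.tri_eq hm hmb hmc]
    rintro p (rfl | rfl | rfl)
    · exact Or.inr (Or.inr (Or.inr (Or.inr (Or.inl rfl))))
    · exact Or.inr (Or.inr (Or.inl rfl))
    · exact Or.inr (Or.inr (Or.inr (Or.inl rfl)))
  refine ⟨_, ⟨_, _, _, _, _, _, _, hw, rfl⟩, hsub, ?_, fun hsub' => ?_⟩
  · rintro s ⟨r, hr, hrs⟩
    exact ⟨r, hsub hr, hrs⟩
  · obtain ⟨r, hr, hrs⟩ := hsub' (a := fourPoint (f.toFun v) k0 k1)
      ⟨fourPoint v v0 v1, Or.inl rfl, boolMap_fourPoint f k0 k1 (mem_fourPoint _ _ _)⟩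
    have hv := mem_fourPoint (f.toFun v) k0 k1
    -- The points of `b` and `c` cannot account for `f v`: `f v = f y` would make `f v` orthogonal
    -- to itself, and `f v = (f y)ᶜ` would give `f a ≤ f v`.
    have aux : ∀ y : A.carrier, y ≠ ⊥ → y ≠ ⊤ → a ≤ yᶜ → y ∈ r.1 → False := by
      intro y y0 y1 hay hy
      obtain ⟨w, w0, w1⟩ := (boolMap_eq_some_iff f hy y0 y1).1 hrs
      have hfa := f.orth hay
      rcases BoolPoint.mem_or w w0 w1 hv k0 k1 with e | e
      · exact k0 (eq_bot_of_le_compl ((hfle.trans hfa).trans_eq (by rw [e])))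
      · exact ka (le_antisymm hfle (hfa.trans_eq e.symm))
    rcases hr with hr | hr | hr
    · obtain ⟨w, w0, w1⟩ := (boolMap_eq_some_iff f hr h.ha h.ne_top).1 hrs
      rcases BoolPoint.mem_or w w0 w1 hv k0 k1 with e | e
      · exact ka e
      · exact ne_compl_of_le hfle k0 e
    · exact aux b h.hb h.rotate.ne_top h.ab hr
    · exact aux c h.hc h.rotate.rotate.ne_top h.ac hr

theorem isProper_boolMap (hf : f.IsProper) :
    IsProper (G := orthogeometryOf A.carrier) (H := orthogeometryOf B.carrier) (boolMap f) where
  bot := by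
    have h2 : ({⊥, ⊤} : Set A.carrier).ncard ≤ 2 := by
      have := Set.ncard_insert_le (⊥ : A.carrier) {⊤}
      rwa [Set.ncard_singleton] at this
    have hfin : ({⊥, ⊤} : Set A.carrier).Finite := by simp
    obtain ⟨C, hC, -, hlt⟩ := hf _ isBooleanSub_bot_top hfin (by omega)
      ((Set.ncard_image_le hfin).trans (by omega))
    obtain ⟨_, ⟨y, hy, rfl⟩, hyp⟩ := Set.exists_of_ssubset hlt
    have k0 : f.toFun y ≠ ⊥ := fun e => hyp ⟨⊥, by simp, by rw [e, f.map_bot]⟩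
    have k1 : f.toFun y ≠ ⊤ := fun e => hyp ⟨⊤, by simp, by rw [e, f.map_top]⟩
    exact ⟨_, _, boolMap_fourPoint f k0 k1 (mem_fourPoint y (f.ne_bot_of k0) (f.ne_top_of k1))⟩
  point := point_of_isProper f hf
  line l hl hs := by
    obtain ⟨a, b, c, h, rfl⟩ := mem_lines_iff.1 hl
    -- If all atoms survived, the image would be a line, which has more than one point.
    have hbot := (h.map_or f).resolve_left fun k => by
      rw [img_tri f k] at hs
      exact Set.not_nontrivial_iff.2 hs (nontrivial_line k.mem_lines)
    set S : Set A.carrier := Set.range fun s : Finset (Fin 3) => s.sup ![a, b, c] with hSdef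
    have hS : IsBooleanSub S := h.isPartition.isBooleanSub
    have h8 : S.ncard = 8 := h.ncard_range_eq
    obtain ⟨C, hC, hSC, hlt⟩ := hf S hS (Set.finite_of_ncard_ne_zero (by omega)) h8.le
      (h.ncard_image_le f hbot)
    obtain ⟨_, ⟨y, hy, rfl⟩, hyp⟩ := Set.exists_of_ssubset hlt
    have hCb : IsBooleanSub C := hC.prop
    have haS : a ∈ S := ⟨{0}, by simp⟩
    have hbS : b ∈ S := ⟨{1}, by simp⟩
    have hcS : c ∈ S := ⟨{2}, by simp⟩
    -- As for points, `y` splits along the atoms of the line; some part must have an image other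
    -- than `⊥` and the image of its atom, since otherwise `f y` would lie in `f[S]`.
    have hfy : f.toFun y = f.toFun (a ⊓ y) ⊔ f.toFun (b ⊓ y) ⊔ f.toFun (c ⊓ y) := by
      rw [← f.map_sup, ← f.map_sup, inf_comm a, inf_comm b, inf_comm c,
        ← hCb.distrib y hy a (hSC haS) b (hSC hbS),
        ← hCb.distrib y hy _ (hSC (hS.sup_mem _ haS _ hbS)) c (hSC hcS), h.sup, inf_top_eq]
    by_cases c1 : f.toFun (a ⊓ y) ≠ ⊥ ∧ f.toFun (a ⊓ y) ≠ f.toFun a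
    · exact h.exists_plane f inf_le_left c1.1 c1.2
    by_cases c2 : f.toFun (b ⊓ y) ≠ ⊥ ∧ f.toFun (b ⊓ y) ≠ f.toFun b
    · rw [tri_rotate]; exact h.rotate.exists_plane f inf_le_left c2.1 c2.2
    by_cases c3 : f.toFun (c ⊓ y) ≠ ⊥ ∧ f.toFun (c ⊓ y) ≠ f.toFun c
    · rw [tri_rotate, tri_rotate]; exact h.rotate.rotate.exists_plane f inf_le_left c3.1 c3.2
    exfalso
    have hfS := hS.image f
    have mem : ∀ x ∈ S, ¬ (f.toFun (x ⊓ y) ≠ ⊥ ∧ f.toFun (x ⊓ y) ≠ f.toFun x) →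
        f.toFun (x ⊓ y) ∈ f.toFun '' S := by
      intro x hx hn
      rw [not_and_or, not_not, not_not] at hn
      rcases hn with e | e
      · rw [e]; exact hfS.bot_mem
      · rw [e]; exact ⟨x, hx, rfl⟩
    apply hyp
    rw [hfy]
    exact hfS.sup_mem _ (hfS.sup_mem _ (mem a haS c1) _ (mem b hbS c2)) _ (mem c hcS c3)

/-- A Boolean subalgebra with at most eight elements is trivial, a point or a line; the three
conditions of geometric properness treat these cases in turn, and the point, line or plane they
supply extends to a block. -/
theorem isProper_of_boolMap
    (h : IsProper (G := orthogeometryOf A.carrier) (H := orthogeometryOf B.carrier) (boolMap f)) :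
    f.IsProper := by
  intro S hS hfin h8 h4
  by_cases hx : ∃ x ∈ S, x ≠ ⊥ ∧ x ≠ ⊤
  · obtain ⟨x, hxS, h0, h1⟩ := hx
    have hxm := mem_fourPoint x h0 h1
    by_cases hy : ∃ y ∈ S, y ∉ (fourPoint x h0 h1).1
    · obtain ⟨y, hyS, hy⟩ := hy
      have hp := (fourPoint x h0 h1).2.1
      obtain ⟨a, b, c, hP, rfl⟩ := hS.exists_part3 hfin h8 hxS hyS h0 h1
        (fun e => hy (e ▸ hp.bot_mem)) (fun e => hy (e ▸ hp.top_mem))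
        (fun e => hy (e ▸ hxm)) (fun e => hy (e ▸ hp.compl_mem _ hxm))
      -- If no atom were killed, the image would have eight elements, contrary to the bound by four.
      have hbot := (hP.map_or f).resolve_left fun k => by
        have hsub := IsPartition.range_subset (hS.image f)
          (e := ![f.toFun a, f.toFun b, f.toFun c]) fun i => by
            fin_cases i
            exacts [⟨a, ⟨{0}, by simp⟩, rfl⟩, ⟨b, ⟨{1}, by simp⟩, rfl⟩, ⟨c, ⟨{2}, by simp⟩, rfl⟩]
        have := Set.ncard_le_ncard hsub (hfin.image _)
        rw [k.ncard_range_eq] at this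
        omega
      obtain ⟨w, ⟨pa, pb, pc, pd, px, py, pz, hw, rfl⟩, hlw, hlt⟩ :=
        h.line _ hP.mem_lines (hP.img_subsingleton f hbot)
      obtain ⟨a', b', c', d', h4', ha, hb, hc, hd, hx, hy, hz⟩ := isPlane_iff_part4.1 hw
      have hW := h4'.isPartition.isBooleanSub
      obtain ⟨k1, k2, k3⟩ := h4'.part3_pairs
      have mem : ∀ r ∈ ({pa, pb, pc, pd, px, py, pz} : Set (BoolPoint A.carrier)),
          r.1 ⊆ Set.range fun s : Finset (Fin 4) => s.sup ![a', b', c', d'] := by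
        rintro r (rfl | rfl | rfl | rfl | rfl | rfl | rfl)
        · exact (BoolPoint.subset_iff ha h4'.ha h4'.part3.ne_top hW).2 ⟨{0}, by simp⟩
        · exact (BoolPoint.subset_iff hb h4'.hb h4'.rotate.part3.ne_top hW).2 ⟨{1}, by simp⟩
        · exact (BoolPoint.subset_iff hc h4'.hc h4'.rotate.rotate.part3.ne_top hW).2
            ⟨{2}, by simp⟩
        · exact (BoolPoint.subset_iff hd h4'.hd h4'.rotate.rotate.rotate.part3.ne_top hW).2
            ⟨{3}, by simp⟩
        · exact (BoolPoint.subset_iff hx k1.ha k1.ne_top hW).2 ⟨{0, 1}, by simp⟩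
        · exact (BoolPoint.subset_iff hy k2.ha k2.ne_top hW).2 ⟨{0, 2}, by simp⟩
        · exact (BoolPoint.subset_iff hz k3.ha k3.ne_top hW).2 ⟨{0, 3}, by simp⟩
      have hSW := IsPartition.range_subset hW (e := ![a, b, c]) fun i => by
        fin_cases i
        · exact mem _ (hlw (Or.inl (mem_fourPoint a hP.ha hP.ne_top))) (mem_fourPoint _ _ _)
        · exact mem _ (hlw (Or.inr (Or.inl (mem_fourPoint b hP.hb hP.rotate.ne_top))))
            (mem_fourPoint _ _ _)
        · exact mem _ (hlw (Or.inr (Or.inr (mem_fourPoint c hP.hc hP.rotate.rotate.ne_top))))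
            (mem_fourPoint _ _ _)
      obtain ⟨q, ⟨r, hr, hrq⟩, hq⟩ := Set.exists_of_ssubset hlt
      refine exists_isBlock_of_boolMap f hW hSW (mem r hr) hrq hS fun p hp hpq => hq ⟨p, ?_, hpq⟩
      have hp' : p ∈ boolLine (Set.range fun s : Finset (Fin 3) => s.sup ![a, b, c]) := hp
      rwa [hP.boolLine_eq] at hp'
    · push Not at hy
      obtain ⟨l, ⟨T, hT, h8, rfl⟩, hpl, hlt⟩ := h.point (fourPoint x h0 h1)
      obtain ⟨q, ⟨r, hr, hrq⟩, hq⟩ := Set.exists_of_ssubset hlt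
      refine exists_isBlock_of_boolMap f hT (fun y hyS => hpl (hy y hyS)) hr hrq hS
        fun p hp hpq => hq ⟨p, ?_, hpq⟩
      exact Set.mem_singleton_iff.2 (BoolPoint.eq p.rep_mem (hy _ (hp p.rep_mem))
        p.rep_ne_bot p.rep_ne_top)
  · push Not at hx
    obtain ⟨p, q, hpq⟩ := h.bot
    have htriv : ∀ x ∈ S, x = ⊥ ∨ x = ⊤ := fun x hxS => by
      by_cases e : x = ⊥
      exacts [Or.inl e, Or.inr (hx x hxS e)]
    refine exists_isBlock_of_boolMap f (W := p.1) p.2.1 (fun x hxS => ?_) subset_rfl hpq hS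
      fun p' hp' _ => ?_
    · rcases htriv x hxS with rfl | rfl
      exacts [p.2.1.bot_mem, p.2.1.top_mem]
    · rcases htriv _ (hp' p'.rep_mem) with e | e
      exacts [p'.rep_ne_bot e, p'.rep_ne_top e]

theorem isProper_iff_boolMap : f.IsProper ↔
    IsProper (G := orthogeometryOf A.carrier) (H := orthogeometryOf B.carrier) (boolMap f) :=
  ⟨isProper_boolMap f, isProper_of_boolMap f⟩

end Proper

/-! ### The functor -/

section Functor

variable {A B C : COML.{u}}

open CompleteOML PreOrthogeometry

/-- An order isomorphism preserving complements is an isomorphism of complete orthomodular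
lattices. -/
def COML.isoOfOrderIso (g : A.carrier ≃o B.carrier) (hg : ∀ x, g xᶜ = (g x)ᶜ) : A ≅ B where
  hom := ⟨g, fun s => by rw [g.map_sSup, sSup_image], hg⟩
  inv := ⟨g.symm, fun s => by rw [g.symm.map_sSup, sSup_image], fun x => by
    apply g.injective; rw [g.apply_symm_apply, hg, g.apply_symm_apply]⟩
  hom_inv_id := CompleteOMLHom.ext (funext fun x => g.symm_apply_apply x)
  inv_hom_id := CompleteOMLHom.ext (funext fun x => g.apply_symm_apply x)

theorem OrderIso.map_compl_of_nontrivial {A B : Type u} [CompleteOML A] [CompleteOML B]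
    (g : A ≃o B) (hg : ∀ x, x ≠ ⊥ → x ≠ ⊤ → g xᶜ = (g x)ᶜ) (x : A) : g xᶜ = (g x)ᶜ := by
  by_cases h0 : x = ⊥
  · rw [h0, compl_bot', g.map_top, g.map_bot, compl_bot']
  by_cases h1 : x = ⊤
  · rw [h1, compl_top', g.map_top, g.map_bot, compl_top']
  exact hg x h0 h1

theorem exists_nontrivial_of_not_atMostTwo (h : ¬ A.AtMostTwo) :
    ∃ x : A.carrier, x ≠ ⊥ ∧ x ≠ ⊤ := by
  simpa [COML.AtMostTwo, not_or] using h

theorem bot_ne_top_of_nontrivial {A : Type u} [CompleteOML A] {x : A} (h : x ≠ ⊥) :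
    (⊥ : A) ≠ ⊤ := fun e => h (le_bot_iff.1 (e ▸ le_top))

/-- The morphism of `COG` given by a morphism of `COML`. -/
noncomputable def cogMap (f : A ⟶ B) : COG.of A ⟶ COG.of B :=
  COG.Hom.mk (X := COG.of A) (Y := COG.of B) (pointMap f) (isMorphism_boolMap f)
    (preservesJoins_boolMap f)

theorem boolMap_id (p : BoolPoint A.carrier) : pointMap (𝟙 A) p = some p :=
  (boolMap_eq_some_iff (A := A) (B := A) (𝟙 A) p.rep_mem p.rep_ne_bot p.rep_ne_top).2
    ⟨p.rep_mem, p.rep_ne_bot, p.rep_ne_top⟩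

theorem boolMap_comp (f : CompleteOMLHom A.carrier B.carrier)
    (g : CompleteOMLHom B.carrier C.carrier) (h : CompleteOMLHom A.carrier C.carrier)
    (hc : ∀ x, h.toFun x = g.toFun (f.toFun x)) (p : BoolPoint A.carrier) :
    boolMap h p = (boolMap f p).bind (boolMap g) := by
  have hx := p.rep_mem
  have h0 := p.rep_ne_bot
  have h1 := p.rep_ne_top
  refine Option.ext fun r => ?_
  rw [boolMap_eq_some_iff h hx h0 h1, Option.bind_eq_some_iff, hc]
  constructor
  · rintro ⟨k, k0, k1⟩
    have m0 := g.ne_bot_of k0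
    have m1 := g.ne_top_of k1
    exact ⟨_, boolMap_fourPoint f m0 m1 hx,
      (boolMap_eq_some_iff g (mem_fourPoint _ m0 m1) m0 m1).2 ⟨k, k0, k1⟩⟩
  · rintro ⟨q, hq, hr⟩
    obtain ⟨m, m0, m1⟩ := (boolMap_eq_some_iff f hx h0 h1).1 hq
    exact (boolMap_eq_some_iff g m m0 m1).1 hr

theorem cogMap_id : cogMap (𝟙 A) = 𝟙 (COG.of A) :=
  COG.Hom.ext (funext boolMap_id)

theorem cogMap_comp (f : A ⟶ B) (g : B ⟶ C) : cogMap (f ≫ g) = cogMap f ≫ cogMap g :=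
  COG.Hom.ext (funext (boolMap_comp (A := A) (B := B) (C := C) f g (f ≫ g) fun _ => rfl))

/-- An isomorphism of orthogeometries is an isomorphism in `COG`. -/
def COG.isoOfIso {X Y : COG.{u}} (e : X.toPre.Iso Y.toPre) : X ≅ Y where
  hom := COG.Hom.mk (fun p => some (e.equiv p)) e.isMorphism e.preservesJoins
  inv := COG.Hom.mk (fun p => some (e.symm.equiv p)) e.symm.isMorphism e.symm.preservesJoins
  hom_inv_id := COG.Hom.ext (funext fun p => congrArg some (e.equiv.symm_apply_apply p))
  inv_hom_id := COG.Hom.ext (funext fun p => congrArg some (e.equiv.apply_symm_apply p))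

theorem COG.exists_direction (Y : COG.{u}) (q : Y.toPre.Point) :
    ∃ d : Y.toPre.Direction, d.point = q := by
  obtain ⟨A, ⟨e⟩⟩ := Y.exists_iso
  obtain ⟨d, hd⟩ := _root_.exists_direction (A := A.carrier) (e.equiv q)
  exact ⟨e.symm.mapDirection d, (congrArg e.equiv.symm hd).trans (e.equiv.symm_apply_apply q)⟩

/-! ### Injectivity on objects -/

/-- The isomorphism of the posets of directions becomes an order isomorphism `g` of lattices. Order
alone does not determine the complement, but `g` respects points, and `g xᶜ` is the nontrivial
element of the point of `g x` other than `g x`. Lattices with at most two elements have no points,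
which explains the exception. -/
theorem nonempty_iso_of_geometry_iso
    (e : (orthogeometryOf A.carrier).Iso (orthogeometryOf B.carrier)) :
    Nonempty (A ≅ B) ∨ (A.AtMostTwo ∧ B.AtMostTwo) := by
  by_cases hA : A.AtMostTwo
  · refine Or.inr ⟨hA, by_contra fun hB => ?_⟩
    obtain ⟨y, y0, y1⟩ := exists_nontrivial_of_not_atMostTwo hB
    let p : BoolPoint A.carrier := e.symm.equiv (fourPoint y y0 y1)
    exact (hA p.rep).elim p.rep_ne_bot p.rep_ne_top
  · refine Or.inl ?_
    obtain ⟨x, x0, x1⟩ := exists_nontrivial_of_not_atMostTwo hA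
    let q : BoolPoint B.carrier := e.equiv (fourPoint x x0 x1)
    have hA' := bot_ne_top_of_nontrivial x0
    have hB' := bot_ne_top_of_nontrivial q.rep_ne_bot
    let g : A.carrier ≃o B.carrier :=
      (toDirIso hA').trans (e.dirIso.trans (toDirIso hB').symm)
    have hg : ∀ x, toDir (g x) = e.mapDir (toDir x) := fun x =>
      (toDirIso hB').apply_symm_apply _
    have key : ∀ x (h0 : x ≠ ⊥) (h1 : x ≠ ⊤), ∃ k0 k1,
        fourPoint (g x) k0 k1 = e.equiv (fourPoint x h0 h1) := by
      intro x h0 h1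
      have k0 : g x ≠ ⊥ := fun k => h0 (g.injective (k.trans g.map_bot.symm))
      have k1 : g x ≠ ⊤ := fun k => h1 (g.injective (k.trans g.map_top.symm))
      have := hg x
      rw [toDir_of h0 h1, toDir_of k0 k1] at this
      exact ⟨k0, k1, congrArg Direction.point (Dir.of.inj this)⟩
    refine ⟨COML.isoOfOrderIso g (OrderIso.map_compl_of_nontrivial g fun x h0 h1 => ?_)⟩
    obtain ⟨k0, k1, hk⟩ := key x h0 h1
    obtain ⟨m0, m1, hm⟩ := key xᶜ (compl_ne_bot h1) (compl_ne_top h0)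
    have hp : fourPoint xᶜ (compl_ne_bot h1) (compl_ne_top h0) = fourPoint x h0 h1 :=
      BoolPoint.eq (mem_fourPoint _ _ _) ((fourPoint x h0 h1).2.1.compl_mem _ (mem_fourPoint _ _ _))
        (compl_ne_bot h1) (compl_ne_top h0)
    have hmem : g xᶜ ∈ (fourPoint (g x) k0 k1).1 := by
      have e1 : fourPoint (g xᶜ) m0 m1 = fourPoint (g x) k0 k1 :=
        hm.trans ((congrArg e.equiv hp).trans hk.symm)
      rw [← e1]; exact mem_fourPoint _ _ _
    rcases BoolPoint.mem_or (mem_fourPoint _ k0 k1) k0 k1 hmem m0 m1 with w | w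
    · exact absurd (g.injective w) (compl_ne_self h0)
    · exact w

/-- Two comparable elements lie in a Boolean subalgebra with four or eight elements. -/
theorem exists_isBooleanSub_of_le {A : Type u} [CompleteOML A] {x y z : A} (z0 : z ≠ ⊥)
    (z1 : z ≠ ⊤) (h : x ≤ y) :
    ∃ S, IsBooleanSub S ∧ (S.ncard = 4 ∨ S.ncard = 8) ∧ x ∈ S ∧ y ∈ S := by
  have four : ∀ w : A, w ≠ ⊥ → w ≠ ⊤ → (x = ⊥ ∨ x = ⊤ ∨ x = w) → (y = ⊥ ∨ y = ⊤ ∨ y = w) →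
      ∃ S, IsBooleanSub S ∧ (S.ncard = 4 ∨ S.ncard = 8) ∧ x ∈ S ∧ y ∈ S := by
    intro w w0 w1 hx hy
    refine ⟨{⊥, ⊤, w, wᶜ}, isBooleanSub_four w, Or.inl (ncard_four w0 w1), ?_, ?_⟩
    · rcases hx with e | e | e <;> simp [e]
    · rcases hy with e | e | e <;> simp [e]
  by_cases hx : x = ⊥ ∨ x = ⊤
  · by_cases hy : y = ⊥ ∨ y = ⊤
    · exact four z z0 z1 (by tauto) (by tauto)
    · push Not at hy
      exact four y hy.1 hy.2 (by tauto) (by tauto)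
  push Not at hx
  by_cases hy : y = ⊥ ∨ y = ⊤
  · exact four x hx.1 hx.2 (by tauto) (by tauto)
  push Not at hy
  rcases h.eq_or_lt with e | hlt
  · exact four x hx.1 hx.2 (by tauto) (Or.inr (Or.inr e.symm))
  · have hP := Part3.of_lt hx.1 hy.2 hlt
    have hS := hP.isPartition.isBooleanSub
    refine ⟨_, hS, Or.inr hP.ncard_range_eq, ⟨{0}, by simp⟩, ?_⟩
    have := hS.compl_mem yᶜ ⟨{1}, by simp⟩
    rwa [compl_compl'] at this

theorem mem_of_booleanGraph {A B : Type u} [CompleteOML A] [CompleteOML B] {U : Type u}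
    {i : A → U} {j : B → U} {S : Set A} {T : Set B} (h : booleanGraph i S = booleanGraph j T)
    {x y : A} (hx : x ∈ S) (hy : y ∈ S) (hxy : x ≤ y) :
    ∃ a ∈ T, ∃ b ∈ T, a ≤ b ∧ j a = i x ∧ j b = i y := by
  have : (i x, i y) ∈ booleanGraph i S := ⟨x, hx, y, hy, hxy, rfl⟩
  rw [h] at this
  obtain ⟨a, ha, b, hb, hab, e⟩ := this
  exact ⟨a, ha, b, hb, hab, (congrArg Prod.fst e).symm, (congrArg Prod.snd e).symm⟩

/-- The order is visible in the small subalgebras because any two comparable elements lie in one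
with four or eight elements. The nontrivial `z` serves pairs that involve only `⊥` and `⊤`. -/
theorem exists_le_of_booleanGraphs {A B : Type u} [CompleteOML A] [CompleteOML B] {U : Type u}
    {i : A → U} {j : B → U} (h4 : booleanGraphs i 4 = booleanGraphs j 4)
    (h8 : booleanGraphs i 8 = booleanGraphs j 8) {x y z : A} (z0 : z ≠ ⊥) (z1 : z ≠ ⊤)
    (hxy : x ≤ y) : ∃ a b : B, a ≤ b ∧ j a = i x ∧ j b = i y := by
  obtain ⟨S, hS, hc, hx, hy⟩ := exists_isBooleanSub_of_le z0 z1 hxy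
  obtain ⟨T, hT⟩ : ∃ T : Set B, booleanGraph i S = booleanGraph j T := by
    rcases hc with hc | hc
    · have : booleanGraph i S ∈ booleanGraphs i 4 := ⟨S, hS, hc, rfl⟩
      rw [h4] at this
      obtain ⟨T, -, -, e⟩ := this
      exact ⟨T, e⟩
    · have : booleanGraph i S ∈ booleanGraphs i 8 := ⟨S, hS, hc, rfl⟩
      rw [h8] at this
      obtain ⟨T, -, -, e⟩ := this
      exact ⟨T, e⟩
  obtain ⟨a, -, b, -, h⟩ := mem_of_booleanGraph hT hx hy hxy
  exact ⟨a, b, h⟩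

theorem exists_nontrivial_of_booleanGraphs {A B : Type u} [CompleteOML A] [CompleteOML B]
    {U : Type u} {i : A → U} {j : B → U} (h4 : booleanGraphs i 4 = booleanGraphs j 4) {z : A}
    (z0 : z ≠ ⊥) (z1 : z ≠ ⊤) : ∃ w : B, w ≠ ⊥ ∧ w ≠ ⊤ := by
  have : booleanGraph i {⊥, ⊤, z, zᶜ} ∈ booleanGraphs i 4 :=
    ⟨_, isBooleanSub_four z, ncard_four z0 z1, rfl⟩
  rw [h4] at this
  obtain ⟨T, -, hc, -⟩ := this
  obtain ⟨w, -, hw⟩ := IsBooleanSub.exists_four hc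
  exact ⟨w, hw⟩

/-- Applied in both directions, `exists_le_of_booleanGraphs` shows that `i` and `j` have the same
range and that the two orders on it coincide. It remains to compare complements. -/
theorem exists_iso_of_booleanGraphs {U : Type u} (i : A.carrier ↪ U) (j : B.carrier ↪ U)
    (h4 : booleanGraphs i 4 = booleanGraphs j 4) (h8 : booleanGraphs i 8 = booleanGraphs j 8) :
    (∃ e : A ≅ B, ∀ x, j (CompleteOMLHom.toFun e.hom x) = i x) ∨
      (A.AtMostTwo ∧ B.AtMostTwo) := by
  by_cases hA : A.AtMostTwo
  · refine Or.inr ⟨hA, by_contra fun hB => ?_⟩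
    obtain ⟨y, y0, y1⟩ := exists_nontrivial_of_not_atMostTwo hB
    obtain ⟨x, x0, x1⟩ := exists_nontrivial_of_booleanGraphs h4.symm y0 y1
    exact (hA x).elim x0 x1
  refine Or.inl ?_
  obtain ⟨z, z0, z1⟩ := exists_nontrivial_of_not_atMostTwo hA
  obtain ⟨w, w0, w1⟩ := exists_nontrivial_of_booleanGraphs h4 z0 z1
  have h1 : ∀ x, ∃ y, j y = i x := fun x => by
    obtain ⟨a, -, -, h, -⟩ := exists_le_of_booleanGraphs h4 h8 z0 z1 (le_refl x)
    exact ⟨a, h⟩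
  have h2 : ∀ y, ∃ x, i x = j y := fun y => by
    obtain ⟨a, -, -, h, -⟩ := exists_le_of_booleanGraphs h4.symm h8.symm w0 w1 (le_refl y)
    exact ⟨a, h⟩
  choose g hg using h1
  choose g' hg' using h2
  let e : A.carrier ≃o B.carrier :=
    { toFun := g
      invFun := g'
      left_inv := fun x => i.injective ((hg' _).trans (hg x))
      right_inv := fun y => j.injective ((hg _).trans (hg' y))
      map_rel_iff' := by
        intro x y
        constructor
        · intro h
          obtain ⟨a, b, hab, ha, hb⟩ := exists_le_of_booleanGraphs h4.symm h8.symm w0 w1 h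
          rwa [i.injective (ha.trans (hg x)), i.injective (hb.trans (hg y))] at hab
        · intro h
          obtain ⟨a, b, hab, ha, hb⟩ := exists_le_of_booleanGraphs h4 h8 z0 z1 h
          rwa [j.injective (ha.trans (hg x).symm), j.injective (hb.trans (hg y).symm)] at hab }
  have he : ∀ x, j (e x) = i x := hg
  refine ⟨COML.isoOfOrderIso e (OrderIso.map_compl_of_nontrivial e fun x x0 x1 => ?_), he⟩
  -- The point of `x` is also a four-element subalgebra of `B`; in it `e xᶜ` is nontrivial and
  -- different from `e x`, hence the complement of `e x`.
  have hm : booleanGraph i {⊥, ⊤, x, xᶜ} ∈ booleanGraphs i 4 :=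
    ⟨_, isBooleanSub_four x, ncard_four x0 x1, rfl⟩
  rw [h4] at hm
  obtain ⟨T, hT, hc, hST⟩ := hm
  have mem : ∀ y ∈ ({⊥, ⊤, x, xᶜ} : Set A.carrier), e y ∈ T := fun y hy => by
    obtain ⟨a, ha, -, -, -, h, -⟩ := mem_of_booleanGraph hST hy hy le_rfl
    rwa [j.injective (h.trans (he y).symm)] at ha
  have nt : ∀ y, y ≠ ⊥ → y ≠ ⊤ → e y ≠ ⊥ ∧ e y ≠ ⊤ := fun y y0 y1 =>
    ⟨fun k => y0 (e.injective (k.trans e.map_bot.symm)),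
      fun k => y1 (e.injective (k.trans e.map_top.symm))⟩
  obtain ⟨k0, k1⟩ := nt x x0 x1
  obtain ⟨m0, m1⟩ := nt _ (compl_ne_bot x1) (compl_ne_top x0)
  rcases BoolPoint.mem_or (p := ⟨T, hT, hc⟩) (mem x (by simp)) k0 k1 (mem xᶜ (by simp)) m0 m1
    with k | k
  · exact absurd (e.injective k) (compl_ne_self x0)
  · exact k

/-! ### Faithfulness, fullness and the induced map of directions -/

theorem bot_ne_top_of_isProper
    {α : BoolPoint A.carrier → Option (BoolPoint B.carrier)}
    (h : IsProper (G := orthogeometryOf A.carrier) (H := orthogeometryOf B.carrier) α) :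
    (⊥ : A.carrier) ≠ ⊤ ∧ (⊥ : B.carrier) ≠ ⊤ := by
  obtain ⟨p, q, -⟩ := h.bot
  exact ⟨bot_ne_top_of_nontrivial (BoolPoint.rep_ne_bot p),
    bot_ne_top_of_nontrivial (BoolPoint.rep_ne_bot q)⟩

/-- Read as maps of directions, `f` and `g` are both induced by the same proper morphism, which
induces only one. -/
theorem eq_of_boolMap_eq (f g : CompleteOMLHom A.carrier B.carrier) (hf : f.IsProper)
    (h : boolMap f = boolMap g) : f = g := by
  have hp := isProper_boolMap f hf
  obtain ⟨hA, hB⟩ := bot_ne_top_of_isProper hp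
  have e := IsDirMap.unique (isMorphism_boolMap f) hp (isDirMap_boolMap f hA hB)
    (h ▸ isDirMap_boolMap g hA hB)
  refine CompleteOMLHom.ext (funext fun x => (toDirIso hB).injective ?_)
  have := congrFun e (toDir x)
  rwa [dirMap_toDir, dirMap_toDir] at this

/-- Fullness: a proper morphism preserving all joins comes from a morphism of lattices. -/
theorem exists_boolMap_eq {α : BoolPoint A.carrier → Option (BoolPoint B.carrier)}
    (hα : IsMorphism (G := orthogeometryOf A.carrier) (H := orthogeometryOf B.carrier) α)
    (hp : IsProper (G := orthogeometryOf A.carrier) (H := orthogeometryOf B.carrier) α)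
    (hj : PreservesJoins (G := orthogeometryOf A.carrier) (H := orthogeometryOf B.carrier) α) :
    ∃ f : CompleteOMLHom A.carrier B.carrier, boolMap f = α := by
  obtain ⟨hA, hB⟩ := bot_ne_top_of_isProper hp
  obtain ⟨F, hF, hFj⟩ := hj
  -- The candidate is the induced map of directions, read through the identification of both
  -- lattices with their directions.
  set g : A.carrier → B.carrier := fun x => (toDirIso hB).symm (F (toDir x)) with hgdef
  have hg : ∀ x, toDir (g x) = F (toDir x) := fun x => (toDirIso hB).apply_symm_apply _
  have hinj : ∀ {x y : B.carrier}, toDir x = toDir y → x = y := fun h =>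
    (toDirIso hB).injective h
  have hbot : g ⊥ = ⊥ := hinj (by rw [hg, toDir_bot, hF.zero, toDir_bot])
  have htop : g ⊤ = ⊤ := hinj (by rw [hg, toDir_top hA, hF.one, toDir_top hB])
  have hsome : ∀ x (h0 : x ≠ ⊥) (h1 : x ≠ ⊤) q, α (fourPoint x h0 h1) = some q →
      g x ∈ q.1 ∧ g x ≠ ⊥ ∧ g x ≠ ⊤ := by
    intro x h0 h1 q hq
    obtain ⟨e, he, hpt, -⟩ := hF.of_some (dirOf x h0 h1) q hq
    obtain ⟨y, k0, k1, rfl⟩ := exists_dirOf_eq e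
    have hy : g x = y := hinj (by rw [hg, toDir_of h0 h1, he, toDir_of k0 k1])
    rw [hy]
    have hpt' : fourPoint y k0 k1 = q := hpt
    exact ⟨hpt' ▸ mem_fourPoint y k0 k1, k0, k1⟩
  have hnone : ∀ x (h0 : x ≠ ⊥) (h1 : x ≠ ⊤), α (fourPoint x h0 h1) = none →
      g x = ⊥ ∨ g x = ⊤ := by
    intro x h0 h1 hq
    refine (hF.of_none (dirOf x h0 h1) hq).1.imp (fun e => hinj ?_) fun e => hinj ?_
    · rw [hg, toDir_of h0 h1, e, toDir_bot]
    · rw [hg, toDir_of h0 h1, e, toDir_top hB]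
  -- `x` and `xᶜ` have the same point; let `l` be a line through it with larger image. If the point
  -- has an image `q`, both values of `g` are nontrivial elements of `q`, and they differ because
  -- the directions of `x` and `xᶜ` have different arrows at `l`. If it has none, these arrows send
  -- one direction to `0` and the other to `1`.
  have hcompl : ∀ x, g xᶜ = (g x)ᶜ := by
    intro x
    by_cases h0 : x = ⊥
    · rw [h0, compl_bot', htop, hbot, compl_bot']
    by_cases h1 : x = ⊤
    · rw [h1, compl_top', htop, hbot, compl_top']
    have k0 := compl_ne_bot h1
    have k1 := compl_ne_top h0
    have hx := mem_fourPoint x h0 h1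
    have hpp : fourPoint xᶜ k0 k1 = fourPoint x h0 h1 :=
      BoolPoint.eq (mem_fourPoint _ _ _) ((fourPoint x h0 h1).2.1.compl_mem _ hx) k0 k1
    obtain ⟨l, hl, hpl, hlt⟩ := hp.point (fourPoint x h0 h1)
    have hpl' : fourPoint xᶜ k0 k1 ∈ l := Set.mem_of_eq_of_mem hpp hpl
    have hdown := down_or_down_compl hl hpl hx h0 h1
    cases hq : α (fourPoint x h0 h1) with
    | some q =>
      have hl' := hα.img_mem_lines hl hpl hq hlt
      obtain ⟨m, m0, m1⟩ := hsome x h0 h1 q hq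
      obtain ⟨n, n0, n1⟩ := hsome xᶜ k0 k1 q (by rw [hpp]; exact hq)
      rcases BoolPoint.mem_or m m0 m1 n n0 n1 with w | w
      · exfalso
        obtain ⟨d, hd, hdp, hdv⟩ := hF.of_some (dirOf x h0 h1) q hq
        obtain ⟨e, he, hep, hev⟩ := hF.of_some (dirOf xᶜ k0 k1) q
          ((congrArg α hpp).trans hq)
        have hde : d = e := by
          rw [← toDir_of, ← hg] at hd he
          rw [w, hd] at he
          exact Dir.of.inj he
        subst hde
        have hm : d.point ∈ img (G := orthogeometryOf A.carrier) (H := orthogeometryOf B.carrier)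
          α l := ⟨_, hpl, hq.trans (congrArg some hdp.symm)⟩
        have hv := (hdv l ⟨hl, hpl⟩ ⟨hl', hm⟩).symm.trans (hev l ⟨hl, hpl'⟩ ⟨hl', hm⟩)
        rcases hdown with k | k
        · exact k.not_compl ((dirOf_val_eq_down _).1 (hv.symm.trans ((dirOf_val_eq_down _).2 k)))
        · have k' := (dirOf_val_eq_down (h0 := k0) (h1 := k1) ⟨hl, hpl'⟩).2 k
          exact ((dirOf_val_eq_down _).1 (hv.trans k')).not_compl k
      · exact w
    | none =>
      obtain ⟨q, hql, -⟩ := Set.exists_of_ssubset hlt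
      obtain ⟨u1, u2⟩ := (hF.of_none (dirOf x h0 h1) hq).2 l ⟨hl, hpl⟩ ⟨q, hql⟩
      obtain ⟨v1, v2⟩ := (hF.of_none (dirOf xᶜ k0 k1) ((congrArg α hpp).trans hq)).2 l ⟨hl, hpl'⟩
        ⟨q, hql⟩
      rw [← toDir_of, ← hg] at u1 u2 v1 v2
      rcases hdown with k | k
      · have e1 : g x = ⊥ := hinj (by rw [u1 ((dirOf_val_eq_down _).2 k), toDir_bot])
        have e2 : g xᶜ = ⊤ := hinj (by
          rw [v2 ((dirOf_val_eq_up _).2 (by rwa [compl_compl'])), toDir_top hB])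
        rw [e1, e2, compl_bot']
      · have e1 : g x = ⊤ := hinj (by rw [u2 ((dirOf_val_eq_up _).2 k), toDir_top hB])
        have e2 : g xᶜ = ⊥ := hinj (by rw [v1 ((dirOf_val_eq_down _).2 k), toDir_bot])
        rw [e1, e2, compl_top']
  -- Joins in the lattices are least upper bounds of directions, so this is the join preservation
  -- assumed of `F`, transported along both order isomorphisms.
  have hsup : ∀ s : Set A.carrier, g (sSup s) = sSup (g '' s) := by
    intro s
    refine (IsLUB.sSup_eq ?_).symm
    rw [← isLUB_image_orderIso (toDirIso hB), Set.image_image]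
    have h1 := hFj _ _ ((isLUB_image_orderIso (toDirIso hA)).2 (isLUB_sSup s))
    rw [Set.image_image] at h1
    have h2 : ∀ x, toDirIso hB (g x) = F (toDirIso hA x) := hg
    simpa only [h2] using h1
  refine ⟨⟨g, hsup, hcompl⟩, funext fun p => ?_⟩
  have hx := p.rep_mem
  have h0 := p.rep_ne_bot
  have h1 := p.rep_ne_top
  have hpp : fourPoint p.rep h0 h1 = p := BoolPoint.eq (mem_fourPoint _ _ _) hx h0 h1
  cases hq : α p with
  | some q =>
    exact (boolMap_eq_some_iff _ hx h0 h1).2 (hsome _ h0 h1 q ((congrArg α hpp).trans hq))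
  | none =>
    exact (boolMap_eq_none_iff _ hx h0 h1).2 (hnone _ h0 h1 ((congrArg α hpp).trans hq))

theorem existsUnique_isDirMap (X Y : COG.{u}) {α : X.toPre.Point → Option Y.toPre.Point}
    (hα : IsMorphism α) (hp : IsProper α) : ∃! F : X.toPre.Dir → Y.toPre.Dir, IsDirMap α F := by
  obtain ⟨F, hF⟩ := exists_isDirMap hα hp (COG.exists_direction Y)
  exact ⟨F, hF, fun F' hF' => hF'.unique hα hp hF⟩

end Functor

theorem mainTheorem10 :
    ∃ (map : ∀ {A B : COML.{u}}, (A ⟶ B) → (COG.of A ⟶ COG.of B))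
      (map_id : ∀ A : COML.{u}, map (𝟙 A) = 𝟙 (COG.of A))
      (map_comp : ∀ {A B C : COML.{u}} (f : A ⟶ B) (g : B ⟶ C), map (f ≫ g) = map f ≫ map g),
      -- the functor is given on morphisms by taking images of four-element Boolean subalgebras
      (∀ {A B : COML.{u}} (f : A ⟶ B), COG.Hom.toFun (map f) = pointMap f) ∧
      -- essentially surjective
      ({ obj := COG.of, map := map, map_id := map_id, map_comp := map_comp } :
        COML.{u} ⥤ COG.{u}).EssSurj ∧
      -- injective on objects up to isomorphism, lattices with at most two elements excepted
      (∀ A B : COML.{u}, Nonempty ((COG.of A).toPre.Iso (COG.of B).toPre) →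
        Nonempty (A ≅ B) ∨ (A.AtMostTwo ∧ B.AtMostTwo)) ∧
      -- injective on objects: lattices on subsets of a set `U` with the same Boolean subalgebras
      -- of 4 and 8 elements are equal, lattices with at most two elements excepted
      (∀ (A B : COML.{u}) (U : Type u) (i : A.carrier ↪ U) (j : B.carrier ↪ U),
        booleanGraphs i 4 = booleanGraphs j 4 → booleanGraphs i 8 = booleanGraphs j 8 →
          (∃ e : A ≅ B, ∀ x, j (CompleteOMLHom.toFun e.hom x) = i x) ∨
            (A.AtMostTwo ∧ B.AtMostTwo)) ∧
      -- proper morphisms correspond to proper morphisms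
      (∀ {A B : COML.{u}} (f : A ⟶ B), CompleteOMLHom.IsProper f ↔
        PreOrthogeometry.IsProper (COG.Hom.toFun (map f))) ∧
      -- faithful on proper morphisms
      (∀ {A B : COML.{u}} (f g : A ⟶ B), CompleteOMLHom.IsProper f → CompleteOMLHom.IsProper g →
        map f = map g → f = g) ∧
      -- full on proper morphisms
      (∀ {A B : COML.{u}} (α : COG.of A ⟶ COG.of B), PreOrthogeometry.IsProper (COG.Hom.toFun α) →
        ∃ f : A ⟶ B, CompleteOMLHom.IsProper f ∧ map f = α) ∧
      -- a proper morphism of orthogeometries induces exactly one map of directions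
      (∀ (X Y : COG.{u}) (α : X.toPre.Point → Option Y.toPre.Point),
        PreOrthogeometry.IsMorphism α → PreOrthogeometry.IsProper α →
          ∃! F : X.toPre.Dir → Y.toPre.Dir, PreOrthogeometry.IsDirMap α F) := by
  refine ⟨cogMap, fun _ => cogMap_id, cogMap_comp, fun _ => rfl, ⟨fun Y => ?_⟩,
    fun A B ⟨e⟩ => nonempty_iso_of_geometry_iso e,
    fun A B U i j h4 h8 => exists_iso_of_booleanGraphs i j h4 h8, fun f => isProper_iff_boolMap f,
    fun f g hf _ h => eq_of_boolMap_eq f g hf (congrArg COG.Hom.toFun h), fun α hα => ?_,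
    fun X Y α hα hp => existsUnique_isDirMap X Y hα hp⟩
  · obtain ⟨A, ⟨e⟩⟩ := Y.exists_iso
    exact ⟨A, ⟨(COG.isoOfIso (X := Y) (Y := COG.of A) e).symm⟩⟩
  · obtain ⟨f, hf⟩ := exists_boolMap_eq (COG.Hom.isMorphism α) hα (COG.Hom.preservesJoins α)
    exact ⟨f, (isProper_iff_boolMap f).2 (hf.symm ▸ hα), COG.Hom.ext hf⟩
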